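/- Let $n=4$ or $n=5$. Let $\gamma$ be a smooth closed curve $\gamma:\mathbb S^1\to\mathbb{RP}^{n-1}$ or a smooth curve $\gamma:I\to\mathbb{RP}^{n-1}$ on a non-degenerate interval $I\subset\mathbb R$ (open, closed or half-open, bounded or not). Suppose that $\gamma$ is (globally) convex, i.e. for every projective hyperplane $H\subset\mathbb{RP}^{n-1}$ the sum of the local multiplicities of all intersections of $\gamma$ with $H$ is at most $n-1$. Let $\gamma_{\mathcal F}(t)$ be the osculating complete flag of $\gamma$ at $t$, whose $k$-dimensional member is the span of the derivatives of orders $0,\dots,k-1$ at $t$ of a smooth local lift of $\gamma$ to $\mathbb R^n\setminus\{0\}$. Two complete flags $f_1,f_2$ in $\mathbb R^n$ are transversal if for every $1\le i\le n-1$ the $i$-dimensional member of $f_1$ and the $(n-i)$-dimensional member of $f_2$ intersect only in the origin. For a complete flag $f$ in $\mathbb R^n$ let $\sharp_{\gamma,f}$ be the number of parameters $t$ at which $\gamma_{\mathcal F}(t)$ and $f$ are not transversal, and let $\sharp_\gamma=\sup_f\sharp_{\gamma,f}$, the supremum being over all complete flags. Then $$\sharp_\gamma=\frac{n^3-n}{6},$$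 that is, $\sharp_\gamma=10$ if $n=4$ and $\sharp_\gamma=20$ if $n=5$. -/

import Mathlib

open scoped ContDiff Topology LinearAlgebra.Projectivization

noncomputable section

/-- The real projective space of lines through the origin of `ℝⁿ`, of dimension `n - 1`. -/
abbrev ProjSpace (n : ℕ) : Type := ℙ ℝ (Fin n → ℝ)

/-- The curve `c`, read in the affine chart of projective space centred at `c t`: for `p` a vector
spanning the line `c t`, this is the unique vector `v` of the line `c s` with `⟨p, v⟩ = 1`
(it exists for all lines not orthogonal to `p`, hence for `s` close to `t` if `c` is continuous). -/
def affineLift {n : ℕ} (c : ℝ → ProjSpace n) (t s : ℝ) : Fin n → ℝ :=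
  ((c t).rep ⬝ᵥ (c s).rep)⁻¹ • (c s).rep

/-- `c` restricted to `I` is smooth at `t`, in the affine chart centred at `c t`
(one-sided at the endpoints of `I`). Off the domain of the chart `affineLift c t` is `0`, so this
includes that `c` stays in the chart near `t`. -/
def SmoothCurveAt {n : ℕ} (c : ℝ → ProjSpace n) (I : Set ℝ) (t : ℝ) : Prop :=
  ContDiffWithinAt ℝ ∞ (affineLift c t) I t

/-- The order of vanishing at `t` of a smooth function on `I`
(`0` if `f t ≠ 0`, and `⊤` if all derivatives vanish). -/
def vanishingOrder (f : ℝ → ℝ) (I : Set ℝ) (t : ℝ) : ℕ∞ :=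
  ⨆ k ∈ {k : ℕ | ∀ j < k, iteratedDerivWithin j f I t = 0}, (k : ℕ∞)

/-- The local multiplicity at the parameter `t` of the intersection of the curve `c` on `I` with
the projective hyperplane `φ = 0`. -/
def intersectionMult {n : ℕ} (c : ℝ → ProjSpace n) (I : Set ℝ)
    (φ : Module.Dual ℝ (Fin n → ℝ)) (t : ℝ) : ℕ∞ :=
  vanishingOrder (fun s => φ (affineLift c t s)) I t

/-- The `k`-dimensional member of the osculating flag of `c` at `t`: the span of the derivatives of
orders `0, …, k - 1` of a smooth lift of `c` to `ℝⁿ`. -/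
def osculatingSubspace {n : ℕ} (c : ℝ → ProjSpace n) (I : Set ℝ) (t : ℝ) (k : ℕ) :
    Submodule ℝ (Fin n → ℝ) :=
  Submodule.span ℝ {v | ∃ j < k, v = iteratedDerivWithin j (affineLift c t) I t}

/-- A complete flag in `ℝⁿ`; `subspace i` is its `i`-dimensional member, for `i ≤ n`. -/
structure CompleteFlag (n : ℕ) where
  subspace : ℕ → Submodule ℝ (Fin n → ℝ)
  mono : Monotone subspace
  finrank_eq : ∀ i ≤ n, Module.finrank ℝ (subspace i) = i

/-- Two flags in `ℝⁿ`, given by their members, are transversal if for `1 ≤ i ≤ n - 1` the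
`i`-dimensional member of the first meets the `(n - i)`-dimensional member of the second only
in the origin. -/
def FlagTransversal {n : ℕ} (F G : ℕ → Submodule ℝ (Fin n → ℝ)) : Prop :=
  ∀ i, 1 ≤ i → i ≤ n - 1 → F i ⊓ G (n - i) = ⊥

/-! ### Curves on an interval -/

/-- A (globally) convex curve `I → ℝP^(n-1)`: a smooth curve such that, for every hyperplane, the
sum of all local multiplicities of its intersection with the curve is at most `n - 1`. -/
structure IsConvexCurveOn {n : ℕ} (γ : ℝ → ProjSpace n) (I : Set ℝ) : Prop where
  smooth : ∀ t ∈ I, SmoothCurveAt γ I t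
  sum_mult_le : ∀ φ : Module.Dual ℝ (Fin n → ℝ), φ ≠ 0 → ∀ S : Finset ℝ, (S : Set ℝ) ⊆ I →
    ∑ t ∈ S, intersectionMult γ I φ t ≤ ((n - 1 : ℕ) : ℕ∞)

/-- The number of moments `t ∈ I` at which the osculating flag of `γ` is not transversal
to `f`. -/
def sharpFlagOn {n : ℕ} (γ : ℝ → ProjSpace n) (I : Set ℝ) (f : CompleteFlag n) : ℕ∞ :=
  {t ∈ I | ¬ FlagTransversal (osculatingSubspace γ I t) f.subspace}.encard

/-- The supremum over all complete flags `f` of the number of moments of non-transversality. -/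
def sharpOn {n : ℕ} (γ : ℝ → ProjSpace n) (I : Set ℝ) : ℕ∞ :=
  ⨆ f : CompleteFlag n, sharpFlagOn γ I f

/-! ### Closed curves -/

/-- The closed curve `γ` in the angular coordinate of the circle centred at `z`; the point `z`
has coordinate `0`. -/
def angular {n : ℕ} (γ : Circle → ProjSpace n) (z : Circle) (s : ℝ) : ProjSpace n :=
  γ (z * Circle.exp s)

/-- A (globally) convex closed curve `S¹ → ℝP^(n-1)`. -/
structure IsConvexClosedCurve {n : ℕ} (γ : Circle → ProjSpace n) : Prop where
  smooth : ∀ z, SmoothCurveAt (angular γ z) Set.univ 0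
  sum_mult_le : ∀ φ : Module.Dual ℝ (Fin n → ℝ), φ ≠ 0 → ∀ S : Finset Circle,
    ∑ z ∈ S, intersectionMult (angular γ z) Set.univ φ 0 ≤ ((n - 1 : ℕ) : ℕ∞)

/-- The number of points of the circle at which the osculating flag of `γ` is not transversal
to `f`. -/
def sharpFlagClosed {n : ℕ} (γ : Circle → ProjSpace n) (f : CompleteFlag n) : ℕ∞ :=
  {z | ¬ FlagTransversal (osculatingSubspace (angular γ z) Set.univ 0) f.subspace}.encard

/-- The supremum over all complete flags `f` of the number of moments of non-transversality. -/
def sharpClosed {n : ℕ} (γ : Circle → ProjSpace n) : ℕ∞ :=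
  ⨆ f : CompleteFlag n, sharpFlagClosed γ f

end

/-! The osculating flag at `t` fails to be transversal to `f` when, for some `k`, the
`k`-dimensional osculating subspace meets the member of `f` of dimension `n - k`. Since `(n³ - n)/6`
is the sum of `k(n - k)` over `1 ≤ k ≤ n - 1`, it suffices that each such `meetingSet` has at most
`k(n - k)` elements, and that some flag produces this many distinct moments altogether. For `n = 4,
5` only `k = 1, 2, n - 2, n - 1` occur.

Upper bound. The case `k = 1` is convexity. The case `k = n - 1` is a Rolle argument on determinants
mixing the jet at `t` with the jet at a fixed first meeting `t₁`
(`ConvexJet.encard_hyperplanes_le`). For `k = 2`, write `n = r + 3`, fix a meeting `t₁` and count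
the later ones. Choose independent functionals `g₁, g₂` vanishing on `V`, with `g₁` also vanishing
on the two-dimensional osculating subspace at `t₁`. Later meetings are zeros of the Wronskian of `g₁
∘ γ` and `g₂ ∘ γ`, where the plane curve with these components stops turning about the origin. The
coordinates of the curve dual to the reversed jet at `t₁` form a Chebyshev system, in which `g₁`
does not involve the last two functions.

Sampling this plane curve gives a polygonal path of directions, weighted by its turns plus twice its
half-turns. An elimination step on the samples replaces consecutive vectors `u a, u (a + 1)` by a
vector `d a` such that `u (a + 1)` is a positive combination of `u a` and `d a`; the weight of the
old path exceeds that of the new one by at most two (`pathCount_le_add_two`). After `r` steps the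
weight is at most one, so the Wronskian changes sign at most `2r + 1` times. Zeros without sign
change are included by averaging over four sign choices of a generic perturbation
(`encard_pencilWronskian_zeros_le`). Together with `t₁` this gives `2(r + 1) = 2(n - 2)`. The case
`k = n - 2` is the same argument for the osculating hyperplanes, which again give a Chebyshev system
(`ConvexJet.isChebyshevOn_dual`).

Lower bound. Rescaled at an interior point, a convex curve tends with its derivatives to the moment
curve. Transversality to a flag of kernels then becomes nonvanishing of Wronskians of polynomials,
and explicit polynomials whose Wronskians have all their `k(n - k)` sign changes give a flag for
every curve (`exists_flag_of_polyWronskian`). A closed curve is reduced to an interval by cutting it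
at a point. -/

/-! ### Turns and half-turns of polygonal paths of directions -/

/-- The determinant of two plane vectors. -/
def planeDet (a b : ℝ × ℝ) : ℝ := a.1 * b.2 - a.2 * b.1

open Classical in
/-- `b` lies to the left of `a`. -/
noncomputable def isLeft (a b : ℝ × ℝ) : Bool := decide (0 < planeDet a b)

/-- A list of plane vectors in general position. -/
def GenericList (l : List (ℝ × ℝ)) : Prop := l.Pairwise fun a b => planeDet a b ≠ 0

/-- For the polygonal path of directions through `x` and `l`, on its way in direction `σ`
(`true` for left) in a monotone run that started at `r`: the number of turns to come, plus twice
the number of times the path crosses the line of the start of the current run. -/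
noncomputable def runCount (r x : ℝ × ℝ) (σ : Bool) : List (ℝ × ℝ) → ℕ
  | [] => 0
  | y :: l => if isLeft x y = σ then (if isLeft r x = isLeft r y then 0 else 2) + runCount r y σ l
      else 1 + runCount x y (!σ) l

theorem planeDet_swap (a b : ℝ × ℝ) : planeDet b a = -planeDet a b := by
  unfold planeDet; ring

theorem planeDet_ne_swap {a b : ℝ × ℝ} (h : planeDet a b ≠ 0) : planeDet b a ≠ 0 := by
  rw [planeDet_swap]; exact neg_ne_zero.mpr h

theorem isLeft_swap {a b : ℝ × ℝ} (h : planeDet a b ≠ 0) : isLeft b a = !isLeft a b := by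
  unfold isLeft
  rw [planeDet_swap]
  rcases lt_or_gt_of_ne h with h | h
  · simp [h, h.le]
  · simp [h, h.le]

theorem planeDet_plucker (a b c d : ℝ × ℝ) :
    planeDet a b * planeDet c d - planeDet a c * planeDet b d + planeDet a d * planeDet b c = 0 := by
  unfold planeDet; ring

theorem isLeft_true_iff {a b : ℝ × ℝ} : isLeft a b = true ↔ 0 < planeDet a b := by
  unfold isLeft; simp

theorem isLeft_false_iff {a b : ℝ × ℝ} (h : planeDet a b ≠ 0) :
    isLeft a b = false ↔ planeDet a b < 0 := by
  unfold isLeft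
  simp only [decide_eq_false_iff_not, not_lt]
  exact ⟨fun h' => lt_of_le_of_ne h' h, le_of_lt⟩

theorem isLeft_eq_iff {a b c d : ℝ × ℝ} (h : planeDet a b ≠ 0) (h' : planeDet c d ≠ 0) :
    isLeft a b = isLeft c d ↔ 0 < planeDet a b * planeDet c d := by
  cases h1 : isLeft a b <;> cases h2 : isLeft c d <;>
    simp only [isLeft_true_iff, isLeft_false_iff h, isLeft_false_iff h'] at h1 h2
  · simp [mul_pos_of_neg_of_neg h1 h2]
  · simp [(mul_neg_of_neg_of_pos h1 h2).le]
  · simp [(mul_neg_of_pos_of_neg h1 h2).le]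
  · simp [mul_pos h1 h2]

/-- The three-term relation between the orientations of four vectors. -/
theorem isLeft_plucker {a b c d : ℝ × ℝ} (hab : planeDet a b ≠ 0) (hac : planeDet a c ≠ 0)
    (had : planeDet a d ≠ 0) (hbc : planeDet b c ≠ 0) (hbd : planeDet b d ≠ 0)
    (hcd : planeDet c d ≠ 0) :
    ¬ (isLeft a b = isLeft c d ∧ isLeft a c ≠ isLeft b d ∧ isLeft a d = isLeft b c) ∧
    ¬ (isLeft a b ≠ isLeft c d ∧ isLeft a c = isLeft b d ∧ isLeft a d ≠ isLeft b c) := by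
  have h := planeDet_plucker a b c d
  simp only [ne_eq, isLeft_eq_iff hab hcd, isLeft_eq_iff hac hbd, isLeft_eq_iff had hbc, not_lt]
  constructor
  · rintro ⟨h1, h2, h3⟩; linarith
  · rintro ⟨h1, h2, h3⟩
    linarith

theorem GenericList.cons_iff {a : ℝ × ℝ} {l : List (ℝ × ℝ)} :
    GenericList (a :: l) ↔ (∀ b ∈ l, planeDet a b ≠ 0) ∧ GenericList l :=
  List.pairwise_cons

/-- Moving in direction `σ` from `x`, the line of `r₁` is met before the line of `r₂`. -/
def MetFirst (σ : Bool) (x r₁ r₂ : ℝ × ℝ) : Prop :=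
  (isLeft x r₁ ^^ isLeft x r₂ ^^ isLeft r₁ r₂) = σ

/-- Until the next turn the path crosses the lines of `r₁` and `r₂` alternately, beginning with
`r₁`; so it crosses the first line as often as the second or once more. At a turn the start of the
run is replaced, and the two counts agree from there on. -/
theorem runCount_start (σ : Bool) (l : List (ℝ × ℝ)) : ∀ (x r₁ r₂ : ℝ × ℝ),
    GenericList (r₁ :: r₂ :: x :: l) → MetFirst σ x r₁ r₂ →
    runCount r₂ x σ l ≤ runCount r₁ x σ l ∧ runCount r₁ x σ l ≤ runCount r₂ x σ l + 2 := by
  induction l with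
  | nil => intro x r₁ r₂ _ _; simp [runCount]
  | cons y l ih =>
    intro x r₁ r₂ hg hm
    simp only [GenericList.cons_iff, List.mem_cons, forall_eq_or_imp] at hg
    obtain ⟨⟨h12, h1x, h1y, h1l⟩, ⟨h2x, h2y, h2l⟩, ⟨hxy, hxl⟩, hyl, hl⟩ := hg
    -- Everything depends only on orientations; the three-term relation rules out the sign patterns
    -- that four plane vectors cannot have, and the remaining ones are checked one by one.
    have hP := isLeft_plucker h12 h1x h1y h2x h2y hxy
    have g1 : GenericList (r₁ :: r₂ :: y :: l) := by
      simp only [GenericList.cons_iff, List.mem_cons, forall_eq_or_imp]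
      exact ⟨⟨h12, h1y, h1l⟩, ⟨h2y, h2l⟩, hyl, hl⟩
    have g2 : GenericList (r₂ :: r₁ :: y :: l) := by
      simp only [GenericList.cons_iff, List.mem_cons, forall_eq_or_imp]
      exact ⟨⟨planeDet_ne_swap h12, h2y, h2l⟩, ⟨h1y, h1l⟩, hyl, hl⟩
    have i1 := ih y r₁ r₂ g1
    have i2 := ih y r₂ r₁ g2
    unfold MetFirst at hm i1 i2
    rw [isLeft_swap h1y, isLeft_swap h2y] at i1 i2
    rw [isLeft_swap h12] at i2
    rw [isLeft_swap h1x, isLeft_swap h2x] at hm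
    simp only [runCount]
    generalize isLeft r₁ x = a1 at *
    generalize isLeft r₂ x = a2 at *
    generalize isLeft r₁ y = a3 at *
    generalize isLeft r₂ y = a4 at *
    generalize isLeft r₁ r₂ = a5 at *
    generalize isLeft x y = a6 at *
    cases a1 <;> cases a2 <;> cases a3 <;> cases a4 <;> cases a5 <;> cases a6 <;> cases σ <;>
      simp at hP hm i1 i2 ⊢ <;> omega

/-- Opposite directions at the same vector make a difference of at most one. -/
theorem runCount_opposite (σ : Bool) (l : List (ℝ × ℝ)) (x r r' : ℝ × ℝ)
    (hg : GenericList (r :: x :: l)) (hg' : GenericList (r' :: x :: l)) :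
    runCount r x σ l ≤ runCount r' x (!σ) l + 1 := by
  cases l with
  | nil => simp [runCount]
  | cons y l =>
    simp only [GenericList.cons_iff, List.mem_cons, forall_eq_or_imp] at hg hg'
    obtain ⟨⟨h1x, h1y, h1l⟩, ⟨hxy, hxl⟩, hyl, hl⟩ := hg
    obtain ⟨⟨h2x, h2y, h2l⟩, -⟩ := hg'
    have g1 : GenericList (r :: x :: y :: l) := by
      simp only [GenericList.cons_iff, List.mem_cons, forall_eq_or_imp]
      exact ⟨⟨h1x, h1y, h1l⟩, ⟨hxy, hxl⟩, hyl, hl⟩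
    have g2 : GenericList (x :: r' :: y :: l) := by
      simp only [GenericList.cons_iff, List.mem_cons, forall_eq_or_imp]
      exact ⟨⟨planeDet_ne_swap h2x, hxy, hxl⟩, ⟨h2y, h2l⟩, hyl, hl⟩
    have g3 : GenericList (x :: r :: y :: l) := by
      simp only [GenericList.cons_iff, List.mem_cons, forall_eq_or_imp]
      exact ⟨⟨planeDet_ne_swap h1x, hxy, hxl⟩, ⟨h1y, h1l⟩, hyl, hl⟩
    have g4 : GenericList (r' :: x :: y :: l) := by
      simp only [GenericList.cons_iff, List.mem_cons, forall_eq_or_imp]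
      exact ⟨⟨h2x, h2y, h2l⟩, ⟨hxy, hxl⟩, hyl, hl⟩
    -- At `y` both paths move in the same direction: one of them has turned at `x`, and its run
    -- starts there, while the other keeps `r` or `r'`. Comparing these two starts leaves a
    -- difference of at most one after the turn is charged.
    have i1 := runCount_start σ l y r x g1
    have i3 := runCount_start σ l y x r g3
    have i2 := runCount_start (!σ) l y x r' g2
    have i4 := runCount_start (!σ) l y r' x g4
    unfold MetFirst at i1 i2 i3 i4
    rw [isLeft_swap h1y, isLeft_swap hxy] at i1 i3
    rw [isLeft_swap h2y, isLeft_swap hxy] at i2 i4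
    rw [isLeft_swap h1x] at i3
    rw [isLeft_swap h2x] at i2
    simp only [runCount]
    generalize isLeft r x = a1 at *
    generalize isLeft r' x = a2 at *
    generalize isLeft r y = a3 at *
    generalize isLeft r' y = a4 at *
    generalize isLeft x y = a6 at *
    cases a1 <;> cases a2 <;> cases a3 <;> cases a4 <;> cases a6 <;> cases σ <;>
      simp at i1 i2 i3 i4 ⊢ <;> omega

/-- Removing a vector does not increase the count. -/
theorem runCount_remove (σ : Bool) (l : List (ℝ × ℝ)) (r x z y : ℝ × ℝ)
    (hg : GenericList (r :: x :: z :: y :: l)) :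
    runCount r x σ (y :: l) ≤ runCount r x σ (z :: y :: l) := by
  simp only [GenericList.cons_iff, List.mem_cons, forall_eq_or_imp] at hg
  obtain ⟨⟨hrx, hrz, hry, hrl⟩, ⟨hxz, hxy, hxl⟩, ⟨hzy, hzl⟩, hyl, hl⟩ := hg
  have gr : GenericList (r :: y :: l) := by
    simp only [GenericList.cons_iff, List.mem_cons, forall_eq_or_imp]
    exact ⟨⟨hry, hrl⟩, hyl, hl⟩
  have gx : GenericList (x :: y :: l) := by
    simp only [GenericList.cons_iff, List.mem_cons, forall_eq_or_imp]
    exact ⟨⟨hxy, hxl⟩, hyl, hl⟩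
  have gz : GenericList (z :: y :: l) := by
    simp only [GenericList.cons_iff, List.mem_cons, forall_eq_or_imp]
    exact ⟨⟨hzy, hzl⟩, hyl, hl⟩
  have gzr : GenericList (z :: r :: y :: l) := by
    simp only [GenericList.cons_iff, List.mem_cons, forall_eq_or_imp]
    exact ⟨⟨planeDet_ne_swap hrz, hzy, hzl⟩, ⟨hry, hrl⟩, hyl, hl⟩
  have grz : GenericList (r :: z :: y :: l) := by
    simp only [GenericList.cons_iff, List.mem_cons, forall_eq_or_imp]
    exact ⟨⟨hrz, hry, hrl⟩, ⟨hzy, hzl⟩, hyl, hl⟩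
  have gzx : GenericList (z :: x :: y :: l) := by
    simp only [GenericList.cons_iff, List.mem_cons, forall_eq_or_imp]
    exact ⟨⟨planeDet_ne_swap hxz, hzy, hzl⟩, ⟨hxy, hxl⟩, hyl, hl⟩
  -- Both paths continue from `y` through `l`; they can differ there only in the direction of
  -- arrival (`b1` to `b4`) and in the start of the run (`a1` to `a3`). The turns and crossings made
  -- on the way to `y` pay for these differences.
  have b1 := runCount_opposite σ l y r z gr gz
  have b2 := runCount_opposite σ l y r x gr gx
  have b3 := runCount_opposite (!σ) l y x z gx gz
  have b4 := runCount_opposite (!σ) l y x r gx gr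
  rw [Bool.not_not] at b3 b4
  have a1 := runCount_start σ l y z r gzr
  have a2 := runCount_start σ l y r z grz
  have a3 := runCount_start (!σ) l y z x gzx
  have hP := isLeft_plucker hrx hrz hry hxz hxy hzy
  unfold MetFirst at a1 a2 a3
  rw [isLeft_swap hzy] at a1 a2 a3
  rw [isLeft_swap hry] at a1 a2
  rw [isLeft_swap hrz] at a1
  rw [isLeft_swap hxy, isLeft_swap hxz] at a3
  simp only [runCount, Bool.not_not]
  generalize isLeft r x = s1 at *
  generalize isLeft r z = s2 at *
  generalize isLeft r y = s3 at *
  generalize isLeft x z = s4 at *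
  generalize isLeft x y = s5 at *
  generalize isLeft z y = s6 at *
  cases s1 <;> cases s2 <;> cases s3 <;> cases s4 <;> cases s5 <;> cases s6 <;> cases σ <;>
    simp at hP a1 a2 a3 b1 b2 b3 b4 ⊢ <;> omega

theorem isLeft_eq_of_pos {a b c d : ℝ × ℝ} {k : ℝ} (hk : 0 < k)
    (h : planeDet a b = k * planeDet c d) : isLeft a b = isLeft c d := by
  unfold isLeft
  rw [h]
  simp [hk]

theorem isLeft_eq_of_add {r x u d : ℝ × ℝ} {α β : ℝ} (hα : 0 < α) (hβ : 0 < β)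
    (hu : u = α • x + β • d) (hrx : planeDet r x ≠ 0) (hrd : planeDet r d ≠ 0)
    (h : isLeft r x = isLeft r d) : isLeft r u = isLeft r x := by
  have e : planeDet r u = α * planeDet r x + β * planeDet r d := by
    subst hu; simp [planeDet]; ring
  cases h1 : isLeft r x
  · have h2 := h ▸ h1
    rw [isLeft_false_iff hrx] at h1
    rw [isLeft_false_iff hrd] at h2
    unfold isLeft
    simp only [decide_eq_false_iff_not, not_lt, e]
    nlinarith
  · have h2 := h ▸ h1
    rw [isLeft_true_iff] at *
    rw [e]; positivity

/-- Inserting a positive combination of two consecutive vectors does not change the count. -/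
theorem runCount_insert {r x u d : ℝ × ℝ} {α β : ℝ} (hα : 0 < α) (hβ : 0 < β)
    (hu : u = α • x + β • d) (hrx : planeDet r x ≠ 0) (hrd : planeDet r d ≠ 0)
    (σ : Bool) (l : List (ℝ × ℝ)) :
    runCount r x σ (u :: d :: l) = runCount r x σ (d :: l) := by
  have h1 : isLeft x u = isLeft x d :=
    isLeft_eq_of_pos hβ (by subst hu; simp [planeDet]; ring)
  have h2 : isLeft u d = isLeft x d :=
    isLeft_eq_of_pos hα (by subst hu; simp [planeDet]; ring)
  have h3 := isLeft_eq_of_add hα hβ hu hrx hrd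
  simp only [runCount, h1, h2]
  generalize isLeft x d = s1 at *
  generalize isLeft r u = s2 at *
  generalize isLeft r x = s3 at *
  generalize isLeft r d = s4 at *
  cases s1 <;> cases s2 <;> cases s3 <;> cases s4 <;> cases σ <;> simp at h3 ⊢

/-- The count of a polygonal path of directions: the number of its turns, plus twice the number
of half-turns made in its monotone runs. -/
noncomputable def pathCount : List (ℝ × ℝ) → ℕ
  | x :: y :: l => runCount x y (isLeft x y) l
  | _ => 0

/-- The new vector either adds a turn at `x`, or moves the start of the first run back from `x` to
`u`. In the second case a crossing of the line of `u` before `y` makes the line of `x` the next one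
to be met, so that the total excess is still at most one crossing. -/
theorem runCount_prepend (u x y : ℝ × ℝ) (l : List (ℝ × ℝ)) (hg : GenericList (u :: x :: y :: l)) :
    runCount u x (isLeft u x) (y :: l) ≤ pathCount (x :: y :: l) + 2 := by
  have hg' := hg
  simp only [GenericList.cons_iff, List.mem_cons, forall_eq_or_imp] at hg
  obtain ⟨⟨hux, huy, hul⟩, ⟨hxy, hxl⟩, hyl, hl⟩ := hg
  have g1 : GenericList (x :: u :: y :: l) := by
    simp only [GenericList.cons_iff, List.mem_cons, forall_eq_or_imp]
    exact ⟨⟨planeDet_ne_swap hux, hxy, hxl⟩, ⟨huy, hul⟩, hyl, hl⟩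
  have a1 := runCount_start (isLeft x y) l y x u g1
  have a2 := runCount_start (isLeft x y) l y u x hg'
  unfold MetFirst at a1 a2
  rw [isLeft_swap hxy, isLeft_swap huy] at a1 a2
  rw [isLeft_swap hux] at a1
  simp only [runCount, pathCount]
  generalize isLeft u x = s1 at *
  generalize isLeft u y = s2 at *
  generalize isLeft x y = s3 at *
  cases s1 <;> cases s2 <;> cases s3 <;> simp at a1 a2 ⊢ <;> omega

/-! ### Sampled paths, derived paths and sign changes -/

/-- The list `u a, …, u (a + k - 1)`. -/
def sampleList {α : Type*} (u : ℕ → α) (a k : ℕ) : List α := (List.range' a k).map u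

theorem sampleList_zero {α : Type*} (u : ℕ → α) (a : ℕ) : sampleList u a 0 = [] := rfl

theorem sampleList_succ {α : Type*} (u : ℕ → α) (a k : ℕ) :
    sampleList u a (k + 1) = u a :: sampleList u (a + 1) k := by
  simp [sampleList, List.range'_succ]

theorem mem_sampleList {α : Type*} {u : ℕ → α} {a k : ℕ} {x : α} (h : x ∈ sampleList u a k) :
    ∃ b, a ≤ b ∧ u b = x := by
  simp only [sampleList, List.mem_map, List.mem_range'_1] at h
  obtain ⟨b, hb, rfl⟩ := h
  exact ⟨b, hb.1, rfl⟩

theorem genericList_sampleList {u : ℕ → ℝ × ℝ} (h : ∀ i j, i ≠ j → planeDet (u i) (u j) ≠ 0)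
    (k : ℕ) : ∀ a, GenericList (sampleList u a k) := by
  induction k with
  | zero => intro a; exact List.Pairwise.nil
  | succ k ih =>
    intro a
    rw [sampleList_succ, GenericList.cons_iff]
    refine ⟨fun b hb => ?_, ih _⟩
    obtain ⟨c, hc, rfl⟩ := mem_sampleList hb
    exact h _ _ (by omega)

section Refinement

variable {u d : ℕ → ℝ × ℝ} {α β : ℕ → ℝ} (hα : ∀ a, 0 < α a) (hβ : ∀ a, 0 < β a)
  (hu : ∀ a, u (a + 1) = α a • u a + β a • d a)
  (huu : ∀ i j, i ≠ j → planeDet (u i) (u j) ≠ 0)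
  (hdd : ∀ i j, i ≠ j → planeDet (d i) (d j) ≠ 0)
  (hud : ∀ i j, planeDet (u i) (d j) ≠ 0)

include hα hβ hu huu hdd hud

/-- The path through the `d`'s is converted into the path through the `u`'s vector by vector: `u (a
+ 1)` lies between `u a` and `d a` and is inserted at no cost, and then `d a` is removed, which does
not increase the count. -/
theorem runCount_sampleList_le (k : ℕ) : ∀ (a : ℕ) (r : ℝ × ℝ) (σ : Bool),
    (∀ b, a ≤ b → planeDet r (u b) ≠ 0) → (∀ b, planeDet r (d b) ≠ 0) →
    runCount r (u a) σ (sampleList u (a + 1) k) ≤ runCount r (u a) σ (sampleList d a k) := by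
  induction k with
  | zero => intro a r σ _ _; simp [sampleList_zero]
  | succ k ih =>
    intro a r σ hru hrd
    rw [sampleList_succ, sampleList_succ,
      ← runCount_insert (hα a) (hβ a) (hu a) (hru a le_rfl) (hrd a)]
    have key : runCount r (u a) σ (u (a + 1) :: sampleList d (a + 1) k) ≤
        runCount r (u a) σ (u (a + 1) :: d a :: sampleList d (a + 1) k) := by
      have hrem : ∀ (r' : ℝ × ℝ) (σ' : Bool), (∀ b, planeDet r' (d b) ≠ 0) →
          planeDet r' (u (a + 1)) ≠ 0 →
          runCount r' (u (a + 1)) σ' (sampleList d (a + 1) k) ≤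
          runCount r' (u (a + 1)) σ' (d a :: sampleList d (a + 1) k) := by
        intro r' σ' h1 h2
        cases k with
        | zero => simp [sampleList_zero, runCount]
        | succ k =>
          rw [sampleList_succ]
          apply runCount_remove
          have hseg := genericList_sampleList hdd k (a + 1 + 1)
          have hmem : ∀ v : ℝ × ℝ, ∀ i, (∀ b, i < b → planeDet v (d b) ≠ 0) → i ≤ a + 1 →
              ∀ b ∈ sampleList d (a + 1 + 1) k, planeDet v b ≠ 0 := by
            intro v i hv hi b hb
            obtain ⟨c, hc, rfl⟩ := mem_sampleList hb
            exact hv c (by omega)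
          simp only [GenericList.cons_iff, List.mem_cons, forall_eq_or_imp]
          exact ⟨⟨h2, h1 _, h1 _, hmem _ 0 (fun b _ => h1 b) (by omega)⟩,
            ⟨hud _ _, hud _ _, hmem _ 0 (fun b _ => hud _ b) (by omega)⟩,
            ⟨hdd _ _ (by omega), hmem _ a (fun b hb => hdd _ _ (by omega)) (by omega)⟩,
            hmem _ (a + 1) (fun b hb => hdd _ _ (by omega)) (by omega), hseg⟩
      have q1 := hrem r σ hrd (hru _ (by omega))
      have q2 := hrem (u a) (!σ) (hud a) (huu _ _ (by omega))
      rw [runCount, runCount]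
      split_ifs <;> omega
    refine le_trans ?_ key
    have i1 := ih (a + 1) r σ (fun b hb => hru b (by omega)) hrd
    have i2 := ih (a + 1) (u a) (!σ) (fun b hb => huu _ _ (by omega)) (hud a)
    rw [runCount, runCount]
    split_ifs <;> omega

/-- The count of a path exceeds the count of its derived path by at most two. -/
theorem pathCount_le_add_two (a k : ℕ) :
    pathCount (sampleList u a (k + 2)) ≤ pathCount (sampleList d a (k + 1)) + 2 := by
  have hs : isLeft (u a) (u (a + 1)) = isLeft (u a) (d a) :=
    isLeft_eq_of_pos (hβ a) (by rw [hu a]; simp [planeDet]; ring)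
  have hs' : isLeft (u (a + 1)) (d a) = isLeft (u a) (d a) :=
    isLeft_eq_of_pos (hα a) (by rw [hu a]; simp [planeDet]; ring)
  have hmem : ∀ v : ℝ × ℝ, ∀ i m, (∀ b, i < b → planeDet v (d b) ≠ 0) → i < m →
      ∀ k, ∀ b ∈ sampleList d m k, planeDet v b ≠ 0 := by
    intro v i m hv hi k b hb
    obtain ⟨c, hc, rfl⟩ := mem_sampleList hb
    exact hv c (by omega)
  rw [sampleList_succ, sampleList_succ, sampleList_succ]
  simp only [pathCount]
  cases k with
  | zero => simp [sampleList_zero, runCount]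
  | succ k =>
    -- After the first two vectors all `u`'s are replaced by `d`'s. Next, `d a` is put in front of
    -- `d (a + 1)`; then `u (a + 1)`, which lies between `u a` and `d a`, is dropped at no cost.
    -- Dropping `u a` is the only move that costs two.
    have h1 := runCount_sampleList_le hα hβ hu huu hdd hud (k + 1) (a + 1) (u a)
      (isLeft (u a) (u (a + 1))) (fun b hb => huu _ _ (by omega)) (hud a)
    refine h1.trans ?_
    rw [sampleList_succ]
    have h2 : runCount (u a) (u (a + 1)) (isLeft (u a) (u (a + 1)))
        (d (a + 1) :: sampleList d (a + 1 + 1) k) ≤ runCount (u a) (u (a + 1))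
        (isLeft (u a) (u (a + 1))) (d a :: d (a + 1) :: sampleList d (a + 1 + 1) k) := by
      apply runCount_remove
      simp only [GenericList.cons_iff, List.mem_cons, forall_eq_or_imp]
      exact ⟨⟨huu _ _ (by omega), hud _ _, hud _ _, hmem _ 0 _ (fun b _ => hud _ b) (by omega) _⟩,
        ⟨hud _ _, hud _ _, hmem _ 0 _ (fun b _ => hud _ b) (by omega) _⟩,
        ⟨hdd _ _ (by omega), hmem _ a _ (fun b hb => hdd _ _ (by omega)) (by omega) _⟩,
        hmem _ (a + 1) _ (fun b hb => hdd _ _ (by omega)) (by omega) _,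
        genericList_sampleList hdd _ _⟩
    refine h2.trans ?_
    have h3 : runCount (u a) (u (a + 1)) (isLeft (u a) (u (a + 1)))
        (d a :: d (a + 1) :: sampleList d (a + 1 + 1) k) = runCount (u a) (d a) (isLeft (u a) (d a))
        (d (a + 1) :: sampleList d (a + 1 + 1) k) := by
      rw [runCount]
      simp [hs, hs']
    rw [h3]
    apply runCount_prepend
    simp only [GenericList.cons_iff, List.mem_cons, forall_eq_or_imp]
    exact ⟨⟨hud _ _, hud _ _, hmem _ 0 _ (fun b _ => hud _ b) (by omega) _⟩,
        ⟨hdd _ _ (by omega), hmem _ a _ (fun b hb => hdd _ _ (by omega)) (by omega) _⟩,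
        hmem _ (a + 1) _ (fun b hb => hdd _ _ (by omega)) (by omega) _,
        genericList_sampleList hdd _ _⟩

end Refinement

/-- The number of changes in a list of signs. -/
def changes : List Bool → ℕ
  | b :: c :: l => (if b = c then 0 else 1) + changes (c :: l)
  | _ => 0

/-- If the pairs `u (2i), u (2i + 1)` and `u (2i + 2), u (2i + 3)` turn in opposite senses, the path
makes a turn between them; the link joining the pairs can only add to the count. -/
theorem changes_le_runCount (u : ℕ → ℝ × ℝ) (k : ℕ) : ∀ (i : ℕ) (r : ℝ × ℝ) (σ : Bool),
    changes (σ :: sampleList (fun i => isLeft (u (2 * i)) (u (2 * i + 1))) (i + 1) k) ≤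
      runCount r (u (2 * i + 1)) σ (sampleList u (2 * i + 2) (2 * k)) := by
  induction k with
  | zero => intro i r σ; simp [sampleList_zero, changes]
  | succ k ih =>
    intro i r σ
    rw [show 2 * (k + 1) = 2 * k + 1 + 1 by ring, sampleList_succ, sampleList_succ, sampleList_succ]
    have h := fun r => ih (i + 1) r (isLeft (u (2 * i + 2)) (u (2 * i + 3)))
    rw [show 2 * (i + 1) + 1 = 2 * i + 3 by ring, show 2 * (i + 1) + 2 = 2 * i + 4 by ring] at h
    rw [show 2 * i + 2 + 1 = 2 * i + 3 by ring, show 2 * i + 3 + 1 = 2 * i + 4 by ring]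
    simp only [changes, runCount, show 2 * (i + 1) = 2 * i + 2 by ring]
    have h1 := h r
    have h2 := h (u (2 * i + 1))
    have h3 := h (u (2 * i + 2))
    generalize isLeft (u (2 * i + 2)) (u (2 * i + 3)) = s1 at *
    generalize isLeft (u (2 * i + 1)) (u (2 * i + 2)) = s2 at *
    cases s1 <;> cases s2 <;> cases σ <;> simp at h1 h2 h3 ⊢ <;> omega

theorem changes_le_pathCount (u : ℕ → ℝ × ℝ) (k : ℕ) :
    changes (sampleList (fun i => isLeft (u (2 * i)) (u (2 * i + 1))) 0 (k + 1)) ≤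
      pathCount (sampleList u 0 (2 * k + 2)) := by
  have h := changes_le_runCount u k 0 (u 0) (isLeft (u 0) (u 1))
  simpa [sampleList_succ, pathCount] using h

section OneTurn

variable {u : ℕ → ℝ × ℝ}
  (hrun : ∀ (σ : Bool) (i j : ℕ), i < j →
    (∀ b, i ≤ b → b < j → isLeft (u b) (u (b + 1)) = σ) → isLeft (u i) (u j) = σ)
  (hturn : ∀ a, isLeft (u a) (u (a + 1)) ≠ isLeft (u (a + 1)) (u (a + 2)) →
    ∀ b, a + 1 ≤ b → isLeft (u b) (u (b + 1)) = isLeft (u (a + 1)) (u (a + 2)))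

include hrun

theorem runCount_eq_zero (k : ℕ) : ∀ (r a : ℕ) (σ : Bool), r < a →
    (∀ b, r ≤ b → isLeft (u b) (u (b + 1)) = σ) →
    runCount (u r) (u a) σ (sampleList u (a + 1) k) = 0 := by
  induction k with
  | zero => intros; simp [sampleList_zero, runCount]
  | succ k ih =>
    intro r a σ hra h
    rw [sampleList_succ, runCount, if_pos (h a hra.le), ih r (a + 1) σ (by omega) h,
      hrun σ r a hra (fun b hb _ => h b hb), hrun σ r (a + 1) (by omega) (fun b hb _ => h b hb)]
    simp

include hturn

/-- By `hrun` a monotone run stays on one side of its start, so no half-turn is counted; by `hturn`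
the first turn is the last. -/
theorem runCount_le_one (k : ℕ) : ∀ (r a : ℕ) (σ : Bool), r < a →
    (∀ b, r ≤ b → b < a → isLeft (u b) (u (b + 1)) = σ) →
    runCount (u r) (u a) σ (sampleList u (a + 1) k) ≤ 1 := by
  induction k with
  | zero => intros; simp [sampleList_zero, runCount]
  | succ k ih =>
    intro r a σ hra h
    rw [sampleList_succ, runCount]
    split_ifs with h1 h2
    · rw [zero_add]
      refine ih r (a + 1) σ (by omega) fun b hb hb' => ?_
      rcases Nat.lt_succ_iff_lt_or_eq.mp hb' with h3 | rfl
      · exact h b hb h3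
      · exact h1
    · refine absurd ?_ h2
      rw [hrun σ r a hra h, hrun σ r (a + 1) (by omega)]
      intro b hb hb'
      rcases Nat.lt_succ_iff_lt_or_eq.mp hb' with h3 | rfl
      · exact h b hb h3
      · exact h1
    · obtain ⟨a, rfl⟩ : ∃ a', a = a' + 1 := ⟨a - 1, by omega⟩
      have h3 := hturn a (by rw [h a (by omega) (by omega)]; exact fun e => h1 e.symm)
      rw [runCount_eq_zero hrun k (a + 1) (a + 1 + 1) (!σ) (by omega)]
      intro b hb
      rw [h3 b hb]
      exact Bool.eq_not.mpr h1

theorem pathCount_le_one (a k : ℕ) : pathCount (sampleList u a k) ≤ 1 := by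
  match k with
  | 0 => simp [sampleList_zero, pathCount]
  | 1 => simp [sampleList_succ, sampleList_zero, pathCount]
  | k + 2 =>
    rw [sampleList_succ, sampleList_succ, pathCount]
    refine runCount_le_one hrun hturn k a (a + 1) _ (by omega) fun b hb hb' => ?_
    obtain rfl : b = a := by omega
    rfl

end OneTurn

/-! ### Elimination in samples with positive minors -/

/-- One step of elimination: consecutive columns of `B` are combined so that row `l` vanishes. -/
def eliminate (l : ℕ) (B : ℕ → ℕ → ℝ) (a i : ℕ) : ℝ := B a l * B (a + 1) i - B (a + 1) l * B a i

/-- The columns after elimination of the rows below `l`. -/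
def eliminated (A : ℕ → ℕ → ℝ) : ℕ → ℕ → ℕ → ℝ
  | 0 => A
  | l + 1 => eliminate l (eliminated A l)

theorem eliminated_eq_zero (A : ℕ → ℕ → ℝ) (l : ℕ) :
    ∀ a i, i < l → eliminated A l a i = 0 := by
  induction l with
  | zero => intro a i h; omega
  | succ l ih =>
    intro a i h
    rcases Nat.lt_succ_iff_lt_or_eq.mp h with h | rfl
    · simp [eliminated, eliminate, ih _ _ h]
    · simp [eliminated, eliminate, mul_comm]

/-- All minors of consecutive columns and the first rows from row `l` up to row `n - 1`
are positive. -/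
def PosMinors (n l : ℕ) (B : ℕ → ℕ → ℝ) : Prop :=
  ∀ k, l + k ≤ n → ∀ a, 0 < (Matrix.of fun i j : Fin k => B (a + j) (l + i)).det

theorem PosMinors.pos {n l : ℕ} {B : ℕ → ℕ → ℝ} (h : PosMinors n l B) (hl : l + 1 ≤ n) (a : ℕ) :
    0 < B a l := by
  simpa using h 1 hl a

theorem PosMinors.two {n l : ℕ} {B : ℕ → ℕ → ℝ} (h : PosMinors n l B) (hl : l + 2 ≤ n) (a : ℕ) :
    0 < B a l * B (a + 1) (l + 1) - B (a + 1) l * B a (l + 1) := by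
  simpa [Matrix.det_fin_two] using h 2 hl a

/-- Subtracting from each column the multiple of its predecessor that cancels row `l` leaves only
the corner entry in that row. The remaining columns are those of `eliminate l B`, divided by the
positive entries of row `l`. -/
theorem det_eliminate (B : ℕ → ℕ → ℝ) (l k a : ℕ) (h : ∀ a, 0 < B a l) :
    (Matrix.of fun i j : Fin (k + 1) => B (a + j) (l + i)).det =
      B a l * ((∏ j : Fin k, (B (a + j) l)⁻¹) *
        (Matrix.of fun i j : Fin k => eliminate l B (a + j) (l + 1 + i)).det) := by
  set c : Fin k → ℝ := fun j => B (a + j + 1) l / B (a + j) l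
  set N : Matrix (Fin (k + 1)) (Fin (k + 1)) ℝ := Matrix.of fun i j =>
    Fin.cases (B a (l + i))
      (fun j : Fin k => B (a + j + 1) (l + i) - c j * B (a + j) (l + i)) j with hN
  have h1 : (Matrix.of fun i j : Fin (k + 1) => B (a + j) (l + i)).det = N.det := by
    refine Matrix.det_eq_of_forall_col_eq_smul_add_pred c ?_ ?_
    · intro i; simp [hN]
    · intro i j
      simp [hN, add_assoc]
  rw [h1, Matrix.det_succ_row_zero, Finset.sum_eq_single 0]
  · have h2 : N.submatrix Fin.succ (Fin.succAbove 0) = Matrix.of fun i j : Fin k =>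
        (B (a + j) l)⁻¹ * (Matrix.of fun i j : Fin k => eliminate l B (a + j) (l + 1 + i)) i j := by
      ext i j
      have := (h (a + j)).ne'
      simp only [hN, Matrix.submatrix_apply, Matrix.of_apply, eliminate, c, Fin.succAbove_zero,
        Fin.cases_succ, Fin.val_succ]
      rw [show l + (↑i + 1) = l + 1 + ↑i by ring]
      field_simp
    rw [h2, Matrix.det_mul_row]
    simp [hN]
  · intro j _ hj
    obtain ⟨j, rfl⟩ := Fin.exists_succ_eq_of_ne_zero hj
    have : N 0 j.succ = 0 := by
      have := (h (a + j)).ne'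
      simp only [hN, Matrix.of_apply, Fin.cases_succ, c, Fin.val_zero, add_zero]
      field_simp
      simp
    rw [this]; ring
  · simp

theorem PosMinors.eliminate {n l : ℕ} {B : ℕ → ℕ → ℝ} (h : PosMinors n l B) (hl : l + 1 ≤ n) :
    PosMinors n (l + 1) (eliminate l B) := by
  intro k hk a
  have h1 := h (k + 1) (by omega) a
  rw [det_eliminate B l k a (h.pos hl)] at h1
  have h2 : 0 < ∏ j : Fin k, (B (a + j) l)⁻¹ :=
    Finset.prod_pos fun j _ => inv_pos.mpr (h.pos hl _)
  exact (mul_pos_iff_of_pos_left h2).mp ((mul_pos_iff_of_pos_left (h.pos hl a)).mp h1)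

theorem PosMinors.eliminated {n : ℕ} {A : ℕ → ℕ → ℝ} (h : PosMinors n 0 A) (l : ℕ) (hl : l ≤ n) :
    PosMinors n l (eliminated A l) := by
  induction l with
  | zero => exact h
  | succ l ih => exact (ih (by omega)).eliminate hl

/-- The plane vectors with coordinates given by a pencil of two linear combinations of the rows,
of which the first does not involve the last two of the `r + 3` rows. -/
def pencilVec (r : ℕ) (x y : ℕ → ℝ) (b : ℕ → ℝ) : ℝ × ℝ :=
  (∑ i ∈ Finset.range (r + 1), x i * b i, ∑ i ∈ Finset.range (r + 3), y i * b i)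

theorem pencilVec_add (r : ℕ) (x y b b' b'' : ℕ → ℝ) (α β : ℝ)
    (h : ∀ i, b i = α * b' i + β * b'' i) :
    pencilVec r x y b = α • pencilVec r x y b' + β • pencilVec r x y b'' := by
  simp only [pencilVec, Prod.smul_mk, Prod.mk_add_mk, smul_eq_mul, Finset.mul_sum,
    ← Finset.sum_add_distrib, Prod.mk.injEq]
  constructor <;> exact Finset.sum_congr rfl fun i _ => by rw [h]; ring

theorem pencilVec_last {r : ℕ} (x y : ℕ → ℝ) {b : ℕ → ℝ} (h : ∀ i < r, b i = 0) :
    pencilVec r x y b = (x r * b r, y r * b r + y (r + 1) * b (r + 1) + y (r + 2) * b (r + 2)) := by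
  have h' : ∀ z : ℕ → ℝ, ∑ i ∈ Finset.range r, z i * b i = 0 := fun z =>
    Finset.sum_eq_zero fun i hi => by rw [h i (Finset.mem_range.mp hi), mul_zero]
  simp [pencilVec, Finset.sum_range_succ, h']

/-- Only the last three rows survive, and the first component is `x r` times a positive number. The
path turns as its slope moves, and the slope increments have the sign of a function affine in a
monotone ratio of minors; such a function changes sign at most once. -/
theorem pathCount_last_le_one {r : ℕ} {A : ℕ → ℕ → ℝ} (hA : PosMinors (r + 3) 0 A)
    (x y : ℕ → ℝ) (a k : ℕ) :
    pathCount (sampleList (fun a => pencilVec r x y (eliminated A r a)) a k) ≤ 1 := by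
  have hr := hA.eliminated r (by omega)
  have hr1 := hA.eliminated (r + 1) (by omega)
  have hpos := hr.pos (by omega)
  have hpos1 := hr1.pos (by omega)
  have htwo := hr1.two (by omega)
  set B := eliminated A r with hB
  set C := eliminated A (r + 1) with hC
  have hCB : ∀ a i, C a i = B a r * B (a + 1) i - B (a + 1) r * B a i := fun a i => rfl
  -- This is the slope of the vector times the square of `x r`; the factor removes the sign of `x r`
  -- and covers `x r = 0`, where all vectors are parallel and no turn occurs.
  set Q : ℕ → ℝ := fun a =>
    x r * ((y r * B a r + y (r + 1) * B a (r + 1) + y (r + 2) * B a (r + 2)) / B a r) with hQ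
  set κ : ℕ → ℝ := fun a => C a (r + 2) / C a (r + 1) with hκ
  set g : ℕ → ℝ := fun a => x r * (y (r + 1) + y (r + 2) * κ a) with hg
  have hleft : ∀ i j, isLeft (pencilVec r x y (B i)) (pencilVec r x y (B j)) = true ↔
      Q i < Q j := by
    intro i j
    rw [isLeft_true_iff, pencilVec_last x y (eliminated_eq_zero A r i),
      pencilVec_last x y (eliminated_eq_zero A r j), planeDet, ← sub_pos (a := Q j)]
    have h1 := hpos i
    have h2 := hpos j
    rw [← mul_pos_iff_of_pos_left (mul_pos h1 h2) (b := Q j - Q i)]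
    refine iff_of_eq (congrArg _ ?_)
    simp only [hQ, ← hB]
    field_simp
  have hstep : ∀ a, Q a < Q (a + 1) ↔ 0 < g a := by
    intro a
    have h1 := hpos a
    have h2 := hpos (a + 1)
    have h3 := hpos1 a
    rw [← sub_pos (a := Q (a + 1)),
      ← mul_pos_iff_of_pos_left (mul_pos h1 h2) (b := Q (a + 1) - Q a),
      ← mul_pos_iff_of_pos_left h3 (b := g a)]
    refine iff_of_eq (congrArg _ ?_)
    simp only [hQ, hg, hκ]
    field_simp
    rw [hCB, hCB]
    ring
  have hκmono : Monotone κ := by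
    refine monotone_nat_of_le_succ fun a => ?_
    simp only [hκ]
    rw [div_le_div_iff₀ (hpos1 a) (hpos1 (a + 1))]
    have := htwo a
    rw [add_assoc] at this
    linarith
  have hmono : Monotone g ∨ Antitone g := by
    rcases le_total 0 (x r * y (r + 2)) with h | h
    · left
      intro a b hab
      have := mul_le_mul_of_nonneg_left (hκmono hab) h
      simp only [hg]; linarith
    · right
      intro a b hab
      have := mul_le_mul_of_nonpos_left (hκmono hab) h
      simp only [hg]; linarith
  have hfalse : ∀ i j, isLeft (pencilVec r x y (B i)) (pencilVec r x y (B j)) = false ↔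
      Q j ≤ Q i := by
    intro i j
    rw [← not_lt, ← hleft, Bool.not_eq_true]
  refine pathCount_le_one (u := fun a => pencilVec r x y (B a)) ?_ ?_ a k
  · intro σ i j hij hb
    obtain ⟨m, rfl⟩ := Nat.exists_eq_add_of_lt hij
    cases σ
    · simp only [hfalse] at hb ⊢
      have : ∀ m, (∀ b, i ≤ b → b < i + m → Q (b + 1) ≤ Q b) → Q (i + m) ≤ Q i := by
        intro m
        induction m with
        | zero => intro _; exact le_rfl
        | succ m ih =>
          intro h
          exact (h (i + m) (by omega) (by omega)).trans
            (ih fun b hb hb' => h b hb (by omega))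
      exact this (m + 1) hb
    · simp only [hleft] at hb ⊢
      have : ∀ m, (∀ b, i ≤ b → b < i + (m + 1) → Q b < Q (b + 1)) → Q i < Q (i + (m + 1)) := by
        intro m
        induction m with
        | zero => intro h; exact h i le_rfl (by omega)
        | succ m ih =>
          intro h
          exact (ih fun b hb hb' => h b hb (by omega)).trans
            (h (i + (m + 1)) (by omega) (by omega))
      exact this m hb
  · intro a hne b hb
    have e1 : ∀ a, isLeft (pencilVec r x y (B a)) (pencilVec r x y (B (a + 1))) = decide (0 < g a) := by
      intro a
      rw [Bool.eq_iff_iff, hleft, hstep, decide_eq_true_iff]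
    rw [e1] at hne ⊢
    have e2 := e1 (a + 1)
    rw [show a + 1 + 1 = a + 2 by ring] at e2
    rw [e2] at hne ⊢
    rw [decide_eq_decide]
    rw [Ne, decide_eq_decide] at hne
    rcases hmono with h | h
    · have h1 := h (Nat.le_succ a)
      have h2 := h hb
      simp only [Nat.succ_eq_add_one] at h1
      constructor
      · intro _; by_contra h3; exact hne ⟨fun h4 => by linarith, fun h4 => absurd h4 h3⟩
      · intro h3; linarith
    · have h1 := h (Nat.le_succ a)
      have h2 := h hb
      simp only [Nat.succ_eq_add_one] at h1
      constructor
      · intro h3; linarith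
      · intro h3; exact absurd ⟨fun _ => h3, fun _ => by linarith⟩ hne

/-- Each level of elimination costs at most two and the last level has at most one turn. The weights
come from solving the definition of `eliminate` for column `a + 1`; they are positive because row
`l` is. -/
theorem pathCount_eliminated_le {r : ℕ} {A : ℕ → ℕ → ℝ} (hA : PosMinors (r + 3) 0 A)
    (x y : ℕ → ℝ)
    (hgen : ∀ l a l' a', l ≤ r → l' ≤ r → (l, a) ≠ (l', a') →
      planeDet (pencilVec r x y (eliminated A l a)) (pencilVec r x y (eliminated A l' a')) ≠ 0)
    (m : ℕ) : ∀ l, l + m = r → ∀ a k,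
      pathCount (sampleList (fun a => pencilVec r x y (eliminated A l a)) a k) ≤ 2 * m + 1 := by
  induction m with
  | zero =>
    intro l hl a k
    obtain rfl : l = r := by omega
    simpa using pathCount_last_le_one hA x y a k
  | succ m ih =>
    intro l hl a k
    match k with
    | 0 => simp [sampleList_zero, pathCount]
    | 1 => simp [sampleList_succ, sampleList_zero, pathCount]
    | k + 2 =>
      have hpos := (hA.eliminated l (by omega)).pos (by omega)
      have h1 := ih (l + 1) (by omega) a (k + 1)
      refine (pathCount_le_add_two (d := fun a => pencilVec r x y (eliminated A (l + 1) a))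
        (α := fun a => eliminated A l (a + 1) l / eliminated A l a l)
        (β := fun a => (eliminated A l a l)⁻¹) (fun a => div_pos (hpos _) (hpos _))
        (fun a => inv_pos.mpr (hpos a)) ?_ ?_ ?_ ?_ a k).trans (by omega)
      · intro a
        refine pencilVec_add r x y _ _ _ _ _ fun i => ?_
        have := (hpos a).ne'
        simp only [eliminated, eliminate]
        field_simp
        ring
      · intro i j hij
        exact hgen _ _ _ _ (by omega) (by omega) (by simpa using hij)
      · intro i j hij
        exact hgen _ _ _ _ (by omega) (by omega) (by simpa using hij)
      · intro i j
        exact hgen _ _ _ _ (by omega) (by omega) (by simp)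

/-! ### Generic pencils -/

/-- A function with the scaling behaviour of a quadratic form on every line, which is not
identically zero, is nonzero on a dense set. -/
theorem dense_ne_zero_of_quadratic {E : Type*} [NormedAddCommGroup E] [NormedSpace ℝ E]
    (Q : E → ℝ) (hQ : ∀ g h, ∃ b : ℝ, ∀ t : ℝ, Q (g + t • h) = Q g + t * b + t ^ 2 * Q h)
    {v : E} (hv : Q v ≠ 0) : Dense {g | Q g ≠ 0} := by
  intro g
  rw [mem_closure_iff_nhds]
  intro U hU
  have hc : Filter.Tendsto (fun t : ℝ => g + t • v) (𝓝 0) (𝓝 g) := by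
    have : Continuous fun t : ℝ => g + t • v := by fun_prop
    simpa using this.tendsto 0
  obtain ⟨δ, hδ, hball⟩ := Metric.mem_nhds_iff.mp (hc hU)
  obtain ⟨b, hb⟩ := hQ g v
  by_contra hne
  rw [Set.not_nonempty_iff_eq_empty] at hne
  have key : ∀ t : ℝ, |t| < δ → Q (g + t • v) = 0 := by
    intro t ht
    by_contra h
    have : g + t • v ∈ U ∩ {g | Q g ≠ 0} := ⟨hball (by simpa using ht), h⟩
    rw [hne] at this
    exact this
  have h0 := key 0 (by simpa using hδ)
  have h1 := key (δ / 2) (by rw [abs_of_pos (by positivity)]; linarith)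
  have h2 := key (-(δ / 2)) (by rw [abs_neg, abs_of_pos (by positivity)]; linarith)
  rw [hb] at h0 h1 h2
  simp only [zero_mul, add_zero, ne_eq, OfNat.ofNat_ne_zero, not_false_eq_true, zero_pow] at h0
  -- The second difference at `0` and `±δ/2` isolates the quadratic coefficient.
  have h3 : δ ^ 2 * Q v = 0 := by linear_combination 2 * h1 + 2 * h2 - 4 * h0
  rcases mul_eq_zero.mp h3 with h | h
  · exact hδ.ne' (by simpa using h)
  · exact hv h

/-- Extension by zero of a finite sequence. -/
def extendZero {n : ℕ} (f : Fin n → ℝ) (i : ℕ) : ℝ := if h : i < n then f ⟨i, h⟩ else 0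

theorem extendZero_restrict {n : ℕ} (x : ℕ → ℝ) {i : ℕ} (h : i < n) :
    extendZero (fun j : Fin n => x j) i = x i := by simp [extendZero, h]

theorem extendZero_add_smul {n : ℕ} (f g : Fin n → ℝ) (t : ℝ) (i : ℕ) :
    extendZero (f + t • g) i = extendZero f i + t * extendZero g i := by
  unfold extendZero; split_ifs <;> simp

theorem continuous_extendZero {n : ℕ} (i : ℕ) : Continuous fun f : Fin n → ℝ => extendZero f i := by
  unfold extendZero; split_ifs <;> fun_prop

/-- The parameters of pencils. -/
abbrev PencilSpace (r : ℕ) : Type := (Fin (r + 1) → ℝ) × (Fin (r + 3) → ℝ)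

/-- The plane vector of a pencil given by its parameters. -/
def PencilSpace.vec {r : ℕ} (p : PencilSpace r) (b : ℕ → ℝ) : ℝ × ℝ :=
  pencilVec r (extendZero p.1) (extendZero p.2) b

theorem PencilSpace.vec_restrict {r : ℕ} (x y b : ℕ → ℝ) :
    PencilSpace.vec (r := r) (fun i => x i, fun i => y i) b = pencilVec r x y b := by
  unfold PencilSpace.vec pencilVec
  rw [Prod.mk.injEq]
  constructor <;> exact Finset.sum_congr rfl fun i hi => by
    rw [extendZero_restrict _ (Finset.mem_range.mp hi)]

theorem PencilSpace.continuous_vec {r : ℕ} (b : ℕ → ℝ) :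
    Continuous fun p : PencilSpace r => p.vec b := by
  unfold PencilSpace.vec pencilVec
  refine Continuous.prodMk ?_ ?_ <;> refine continuous_finsetSum _ fun i _ => ?_
  · exact ((continuous_extendZero i).comp continuous_fst).mul continuous_const
  · exact ((continuous_extendZero i).comp continuous_snd).mul continuous_const

theorem PencilSpace.vec_add_smul {r : ℕ} (p q : PencilSpace r) (t : ℝ) (b : ℕ → ℝ) :
    (p + t • q).vec b = p.vec b + t • q.vec b := by
  unfold PencilSpace.vec pencilVec
  simp only [Prod.fst_add, Prod.snd_add, Prod.smul_fst, Prod.smul_snd, extendZero_add_smul,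
    Prod.smul_mk, Prod.mk_add_mk, smul_eq_mul, Finset.mul_sum, ← Finset.sum_add_distrib,
    Prod.mk.injEq]
  constructor <;> exact Finset.sum_congr rfl fun i _ => by ring

theorem PencilSpace.continuous_planeDet {r : ℕ} (b b' : ℕ → ℝ) :
    Continuous fun p : PencilSpace r => planeDet (p.vec b) (p.vec b') := by
  have h1 := PencilSpace.continuous_vec (r := r) b
  have h2 := PencilSpace.continuous_vec (r := r) b'
  exact (h1.fst.mul h2.snd).sub (h1.snd.mul h2.fst)

theorem PencilSpace.planeDet_quadratic {r : ℕ} (b b' : ℕ → ℝ) (p q : PencilSpace r) :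
    ∃ c : ℝ, ∀ t : ℝ, planeDet ((p + t • q).vec b) ((p + t • q).vec b') =
      planeDet (p.vec b) (p.vec b') + t * c + t ^ 2 * planeDet (q.vec b) (q.vec b') := by
  refine ⟨planeDet (p.vec b) (q.vec b') + planeDet (q.vec b) (p.vec b'), fun t => ?_⟩
  rw [PencilSpace.vec_add_smul, PencilSpace.vec_add_smul]
  simp only [planeDet, Prod.fst_add, Prod.snd_add, Prod.smul_fst, Prod.smul_snd, smul_eq_mul]
  ring

theorem PencilSpace.exists_planeDet_ne_zero {r : ℕ} {b b' : ℕ → ℝ} {i j : ℕ} (hi : i ≤ r)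
    (hj : j ≤ r + 2) (h : b i * b' j - b j * b' i ≠ 0) :
    ∃ p : PencilSpace r, planeDet (p.vec b) (p.vec b') ≠ 0 := by
  refine ⟨(fun k => if (k : ℕ) = i then 1 else 0, fun k => if (k : ℕ) = j then 1 else 0), ?_⟩
  rw [PencilSpace.vec_restrict (fun k => if k = i then 1 else 0) (fun k => if k = j then 1 else 0),
    PencilSpace.vec_restrict (fun k => if k = i then 1 else 0) (fun k => if k = j then 1 else 0)]
  have h1 : i < r + 1 := by omega
  have h2 : j < r + 3 := by omega
  simpa [pencilVec, planeDet, h1, h2] using h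

theorem dense_generic_pencil {r : ℕ} {A : ℕ → ℕ → ℝ} (hA : PosMinors (r + 3) 0 A) :
    Dense {p : PencilSpace r | ∀ l a l' a', l ≤ r → l' ≤ r → (l, a) ≠ (l', a') →
      planeDet (p.vec (eliminated A l a)) (p.vec (eliminated A l' a')) ≠ 0} := by
  have hlt : ∀ l a l' a', l ≤ r → l' ≤ r → (l < l' ∨ l = l' ∧ a < a') →
      Dense {p : PencilSpace r |
        planeDet (p.vec (eliminated A l a)) (p.vec (eliminated A l' a')) ≠ 0} := by
    intro l a l' a' hl hl' hlt
    suffices h : ∃ p : PencilSpace r,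
        planeDet (p.vec (eliminated A l a)) (p.vec (eliminated A l' a')) ≠ 0 by
      obtain ⟨p, hp⟩ := h
      exact dense_ne_zero_of_quadratic _ (PencilSpace.planeDet_quadratic _ _) hp
    have hpos := fun l (hl : l ≤ r) => (hA.eliminated l (by omega)).pos (by omega)
    rcases hlt with hlt | ⟨rfl, hlt⟩
    -- With coordinates `l` and `l'` the determinant is triangular: the column eliminated further
    -- has entry zero in row `l`. At equal levels, rows `l` and `l + 1` are used instead, whose
    -- ratio increases strictly with the column.
    · refine PencilSpace.exists_planeDet_ne_zero (i := l) (j := l') hl (by omega) ?_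
      rw [eliminated_eq_zero A l' a' l hlt, mul_zero, sub_zero]
      exact (mul_pos (hpos l hl _) (hpos l' hl' _)).ne'
    · refine PencilSpace.exists_planeDet_ne_zero (i := l) (j := l + 1) hl (by omega) ?_
      have htwo := (hA.eliminated l (by omega)).two (by omega)
      have hmono : StrictMono fun a => eliminated A l a (l + 1) / eliminated A l a l := by
        refine strictMono_nat_of_lt_succ fun a => ?_
        rw [div_lt_div_iff₀ (hpos l hl a) (hpos l hl (a + 1))]
        have := htwo a
        linarith
      have := hmono hlt
      rw [div_lt_div_iff₀ (hpos l hl a) (hpos l hl a')] at this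
      refine (?_ : (0 : ℝ) < _).ne'
      linarith
  have hopen : ∀ l a l' a', IsOpen {p : PencilSpace r |
        planeDet (p.vec (eliminated A l a)) (p.vec (eliminated A l' a')) ≠ 0} :=
    fun l a l' a' => isOpen_ne.preimage (PencilSpace.continuous_planeDet _ _)
  -- Baire: there are countably many pairs of columns, and each gives an open dense condition.
  have hD := dense_iInter_of_isOpen (ι := {q : (ℕ × ℕ) × ℕ × ℕ //
      q.1.1 ≤ r ∧ q.2.1 ≤ r ∧ (q.1.1 < q.2.1 ∨ q.1.1 = q.2.1 ∧ q.1.2 < q.2.2)})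
    (fun q => hopen q.1.1.1 q.1.1.2 q.1.2.1 q.1.2.2)
    (fun q => hlt q.1.1.1 q.1.1.2 q.1.2.1 q.1.2.2 q.2.1 q.2.2.1 q.2.2.2)
  refine hD.mono fun p hp l a l' a' hl hl' hne => ?_
  rw [Set.mem_iInter] at hp
  by_cases h : l < l' ∨ l = l' ∧ a < a'
  · exact hp ⟨((l, a), (l', a')), hl, hl', h⟩
  · refine planeDet_ne_swap (hp ⟨((l', a'), (l, a)), hl', hl, ?_⟩)
    rw [Ne, Prod.mk.injEq] at hne
    show l' < l ∨ l' = l ∧ a' < a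
    omega

/-- The orientations of finitely many pairs of consecutive samples of a pencil, alternating with
arbitrary samples, change at most `2 * r + 1` times. -/
theorem changes_pencil_le {r : ℕ} {A : ℕ → ℕ → ℝ} (hA : PosMinors (r + 3) 0 A) (x y : ℕ → ℝ)
    (L : ℕ) (hne : ∀ i ≤ L,
      planeDet (pencilVec r x y (A (2 * i))) (pencilVec r x y (A (2 * i + 1))) ≠ 0) :
    changes (sampleList (fun i => isLeft (pencilVec r x y (A (2 * i)))
      (pencilVec r x y (A (2 * i + 1)))) 0 (L + 1)) ≤ 2 * r + 1 := by
  set p₀ : PencilSpace r := (fun i => x i, fun i => y i) with hp₀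
  have hvec : ∀ b, p₀.vec b = pencilVec r x y b := PencilSpace.vec_restrict x y
  -- The given pencil need not be generic, but its finitely many nonzero orientations persist under
  -- small changes, so it may be replaced by a generic pencil nearby.
  have hopen : ∀ i ≤ L, ∀ᶠ p in 𝓝 p₀, isLeft (p.vec (A (2 * i))) (p.vec (A (2 * i + 1))) =
      isLeft (p₀.vec (A (2 * i))) (p₀.vec (A (2 * i + 1))) := by
    intro i hi
    have hc := (PencilSpace.continuous_planeDet (r := r) (A (2 * i)) (A (2 * i + 1))).tendsto p₀
    have h := hne i hi
    rw [← hvec, ← hvec] at h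
    have : ∀ᶠ p in 𝓝 p₀, 0 < planeDet (p.vec (A (2 * i))) (p.vec (A (2 * i + 1))) *
        planeDet (p₀.vec (A (2 * i))) (p₀.vec (A (2 * i + 1))) :=
      (hc.mul_const _).eventually (lt_mem_nhds (mul_self_pos.mpr h))
    filter_upwards [this] with p hp
    exact (isLeft_eq_iff (left_ne_zero_of_mul hp.ne') h).mpr hp
  have hall : ∀ᶠ p in 𝓝 p₀, ∀ i ∈ Finset.range (L + 1),
      isLeft (p.vec (A (2 * i))) (p.vec (A (2 * i + 1))) =
      isLeft (p₀.vec (A (2 * i))) (p₀.vec (A (2 * i + 1))) :=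
    (Filter.eventually_all_finset _).mpr fun i hi =>
      hopen i (by have := Finset.mem_range.mp hi; omega)
  obtain ⟨p, hp, hgen⟩ := mem_closure_iff_nhds.mp (dense_generic_pencil hA p₀) _ hall
  have e : sampleList (fun i => isLeft (pencilVec r x y (A (2 * i)))
      (pencilVec r x y (A (2 * i + 1)))) 0 (L + 1) =
      sampleList (fun i => isLeft (p.vec (A (2 * i))) (p.vec (A (2 * i + 1)))) 0 (L + 1) := by
    unfold sampleList
    refine List.map_congr_left fun i hi => ?_
    rw [List.mem_range'_1] at hi
    rw [hp i (Finset.mem_range.mpr (by omega)), hvec, hvec]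
  rw [e]
  exact (changes_le_pathCount (fun a => p.vec (A a)) L).trans
    (pathCount_eliminated_le hA _ _ hgen r 0 (by omega) 0 _)

/-! ### Chebyshev systems and Wronskians of pencils -/

/-- The functions `z 0, …, z (n - 1)` with derivatives `zd` form a Chebyshev system on the
interval `J`, which does not contain its left endpoint, adapted to the flag of spans of
`z 0, …, z (k - 1)`. -/
structure IsChebyshevOn (n : ℕ) (z zd : ℕ → ℝ → ℝ) (J : Set ℝ) : Prop where
  ordConnected : J.OrdConnected
  exists_lt : ∀ t ∈ J, ∃ s ∈ J, s < t
  hasDerivWithinAt : ∀ i < n, ∀ t ∈ J, HasDerivWithinAt (z i) (zd i t) J t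
  continuousOn_deriv : ∀ i < n, ContinuousOn (zd i) J
  det_ne_zero : ∀ k ≤ n, ∀ x : Fin k → ℝ, StrictMono x → (∀ j, x j ∈ J) →
    (Matrix.of fun i j : Fin k => z i (x j)).det ≠ 0
  wronskian_ne_zero : ∀ t ∈ J, z 0 t * zd 1 t - z 1 t * zd 0 t ≠ 0

/-- The Wronskian of the pencil with coefficients `x` and `y`. -/
def pencilWronskian (r : ℕ) (z zd : ℕ → ℝ → ℝ) (x y : ℕ → ℝ) (t : ℝ) : ℝ :=
  planeDet (pencilVec r x y fun i => z i t) (pencilVec r x y fun i => zd i t)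

theorem hasDerivWithinAt_pencilVec {r : ℕ} {z zd : ℕ → ℝ → ℝ} {J : Set ℝ}
    (h : ∀ i < r + 3, ∀ t ∈ J, HasDerivWithinAt (z i) (zd i t) J t) (x y : ℕ → ℝ) {t : ℝ}
    (ht : t ∈ J) : HasDerivWithinAt (fun t => (pencilVec r x y fun i => z i t).1)
      (pencilVec r x y fun i => zd i t).1 J t ∧
      HasDerivWithinAt (fun t => (pencilVec r x y fun i => z i t).2)
      (pencilVec r x y fun i => zd i t).2 J t := by
  unfold pencilVec
  constructor
  · exact HasDerivWithinAt.fun_sum (u := Finset.range (r + 1)) fun i hi =>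
      (h i (by have := Finset.mem_range.mp hi; omega) t ht).const_mul (x i)
  · exact HasDerivWithinAt.fun_sum (u := Finset.range (r + 3)) fun i hi =>
      (h i (Finset.mem_range.mp hi) t ht).const_mul (y i)

/-- Just after `a`, the plane vector of a pencil turns as its Wronskian tells. -/
theorem exists_isLeft_pencil {r : ℕ} {z zd : ℕ → ℝ → ℝ} {J : Set ℝ}
    (h : ∀ i < r + 3, ∀ t ∈ J, HasDerivWithinAt (z i) (zd i t) J t) (x y : ℕ → ℝ) {a b : ℝ}
    (hab : a < b) (haJ : a ∈ J) (hJ : Set.Ioo a b ⊆ J)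
    (hw : pencilWronskian r z zd x y a ≠ 0) :
    ∃ t, a < t ∧ t < b ∧
      planeDet (pencilVec r x y fun i => z i a) (pencilVec r x y fun i => z i t) ≠ 0 ∧
      isLeft (pencilVec r x y fun i => z i a) (pencilVec r x y fun i => z i t) =
        decide (0 < pencilWronskian r z zd x y a) := by
  set u : ℝ → ℝ × ℝ := fun t => pencilVec r x y fun i => z i t with hu
  set w := pencilWronskian r z zd x y a with hw'
  obtain ⟨h1, h2⟩ := hasDerivWithinAt_pencilVec h x y haJ
  have hφ : HasDerivWithinAt (fun t => planeDet (u a) (u t)) w J a := by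
    have := (h2.const_mul (u a).1).sub (h1.const_mul (u a).2)
    exact this
  have hφ' := (hasDerivWithinAt_iff_tendsto_slope.mp hφ).mono_left
    (nhdsWithin_mono a (s := Set.Ioo a b) fun t ht => ⟨hJ ht, ht.1.ne'⟩)
  rw [nhdsWithin_Ioo_eq_nhdsGT hab] at hφ'
  have hev : ∀ᶠ t in 𝓝[>] a, 0 < slope (fun t => planeDet (u a) (u t)) a t * w :=
    (hφ'.mul_const w).eventually (lt_mem_nhds (mul_self_pos.mpr hw))
  obtain ⟨t, ht1, ht2⟩ := (hev.and (Ioo_mem_nhdsGT hab)).exists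
  have haa : planeDet (u a) (u a) = 0 := by unfold planeDet; ring
  rw [slope_def_field, haa, sub_zero] at ht1
  have hta : 0 < t - a := sub_pos.mpr ht2.1
  have ht3 : 0 < planeDet (u a) (u t) * w := by
    have := mul_pos ht1 hta
    have e : planeDet (u a) (u t) / (t - a) * w * (t - a) = planeDet (u a) (u t) * w := by
      field_simp
    rwa [e] at this
  refine ⟨t, ht2.1, ht2.2, left_ne_zero_of_mul ht3.ne', ?_⟩
  unfold isLeft
  rw [decide_eq_decide]
  exact pos_iff_pos_of_mul_pos ht3

theorem changes_wronskian_le_of_pos {r : ℕ} {z zd : ℕ → ℝ → ℝ} {J : Set ℝ}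
    (h : IsChebyshevOn (r + 3) z zd J)
    (hdet : ∀ k ≤ r + 3, ∀ x : Fin k → ℝ, StrictMono x → (∀ j, x j ∈ J) →
      0 < (Matrix.of fun i j : Fin k => z i (x j)).det) (x y : ℕ → ℝ) {Y : ℕ → ℝ}
    (hY : StrictMono Y) (hYJ : ∀ i, Y i ∈ J) (L : ℕ)
    (hw : ∀ i ≤ L, pencilWronskian r z zd x y (Y i) ≠ 0) :
    changes (sampleList (fun i => decide (0 < pencilWronskian r z zd x y (Y i))) 0 (L + 1)) ≤
      2 * r + 1 := by
  have hIoo : ∀ i, Set.Ioo (Y i) (Y (i + 1)) ⊆ J := fun i t ht =>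
    h.ordConnected.out (hYJ i) (hYJ (i + 1)) (Set.Ioo_subset_Icc_self ht)
  have hex : ∀ i, ∃ t, Y i < t ∧ t < Y (i + 1) ∧ (i ≤ L →
      planeDet (pencilVec r x y fun j => z j (Y i)) (pencilVec r x y fun j => z j t) ≠ 0 ∧
      isLeft (pencilVec r x y fun j => z j (Y i)) (pencilVec r x y fun j => z j t) =
        decide (0 < pencilWronskian r z zd x y (Y i))) := by
    intro i
    have hlt := hY (Nat.lt_succ_self i)
    by_cases hi : i ≤ L
    · obtain ⟨t, h1, h2, h3, h4⟩ := exists_isLeft_pencil h.hasDerivWithinAt x y hlt (hYJ i)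
        (hIoo i) (hw i hi)
      exact ⟨t, h1, h2, fun _ => ⟨h3, h4⟩⟩
    · obtain ⟨t, h1, h2⟩ := exists_between hlt
      exact ⟨t, h1, h2, fun h => absurd h hi⟩
  choose T hT1 hT2 hT3 using hex
  -- The samples are `Y 0, T 0, Y 1, T 1, …`, where `T i` is so close after `Y i` that the pair
  -- turns in the sense given by the Wronskian at `Y i`.
  set P : ℕ → ℝ := fun m => if m % 2 = 0 then Y (m / 2) else T (m / 2) with hP
  have hPe : ∀ i, P (2 * i) = Y i := fun i => by simp [hP]
  have hPo : ∀ i, P (2 * i + 1) = T i := fun i => by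
    simp only [hP]
    rw [if_neg (by omega), show (2 * i + 1) / 2 = i by omega]
  have hPmono : StrictMono P := by
    refine strictMono_nat_of_lt_succ fun m => ?_
    rcases Nat.even_or_odd' m with ⟨i, rfl | rfl⟩
    · rw [hPe, hPo]; exact hT1 i
    · rw [hPo, show 2 * i + 1 + 1 = 2 * (i + 1) by ring, hPe]; exact hT2 i
  have hPJ : ∀ m, P m ∈ J := by
    intro m
    rcases Nat.even_or_odd' m with ⟨i, rfl | rfl⟩
    · rw [hPe]; exact hYJ i
    · rw [hPo]; exact hIoo i ⟨hT1 i, hT2 i⟩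
  have hA : PosMinors (r + 3) 0 fun a i => z i (P a) := by
    intro k hk a
    have := hdet k (by omega) (fun j => P (a + j))
      (fun i j hij => hPmono (by simpa using hij)) (fun j => hPJ _)
    simpa using this
  have := changes_pencil_le hA x y L (fun i hi => by
    simp only [hPe, hPo]; exact (hT3 i hi).1)
  refine le_of_eq_of_le (congrArg _ ?_) this
  unfold sampleList
  refine List.map_congr_left fun i hi => ?_
  rw [List.mem_range'_1] at hi
  simp only [hPe, hPo]
  exact ((hT3 i (by omega)).2).symm

theorem exists_sign_of_preconnected {E : Type*} [TopologicalSpace E] {S : Set E}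
    (hS : IsPreconnected S) {f : E → ℝ} (hf : ContinuousOn f S) (h0 : ∀ x ∈ S, f x ≠ 0) :
    ∃ κ : ℝ, κ ^ 2 = 1 ∧ ∀ x ∈ S, 0 < κ * f x := by
  by_cases h : ∃ x ∈ S, 0 < f x
  · obtain ⟨x, hx, hpos⟩ := h
    refine ⟨1, by norm_num, fun y hy => ?_⟩
    rw [one_mul]
    by_contra hy'
    obtain ⟨c, hc, hc0⟩ := hS.intermediate_value hy hx hf ⟨not_lt.mp hy', hpos.le⟩
    exact h0 c hc hc0
  · refine ⟨-1, by norm_num, fun y hy => ?_⟩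
    push Not at h
    have := lt_of_le_of_ne (h y hy) (h0 y hy)
    linarith

theorem convex_strictMono_mem {J : Set ℝ} (hJ : J.OrdConnected) (k : ℕ) :
    Convex ℝ {x : Fin k → ℝ | StrictMono x ∧ ∀ j, x j ∈ J} := by
  intro x hx y hy a b ha hb hab
  refine ⟨fun i j hij => ?_, fun j => ?_⟩
  · have h1 := hx.1 hij
    have h2 := hy.1 hij
    simp only [Pi.add_apply, Pi.smul_apply, smul_eq_mul]
    rcases ha.lt_or_eq with h | h
    · nlinarith
    · have : b = 1 := by linarith
      subst this; rw [← h]; linarith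
  · exact hJ.convex (hx.2 j) (hy.2 j) ha hb hab

theorem pencilVec_congr {r : ℕ} {x y x' y' b b' : ℕ → ℝ}
    (hx : ∀ i < r + 1, x i * b i = x' i * b' i) (hy : ∀ i < r + 3, y i * b i = y' i * b' i) :
    pencilVec r x y b = pencilVec r x' y' b' := by
  unfold pencilVec
  rw [Prod.mk.injEq]
  exact ⟨Finset.sum_congr rfl fun i hi => hx i (Finset.mem_range.mp hi),
    Finset.sum_congr rfl fun i hi => hy i (Finset.mem_range.mp hi)⟩

/-- The Wronskian of a pencil in a Chebyshev system changes its sign at most `2 * r + 1` times. -/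
theorem changes_wronskian_le {r : ℕ} {z zd : ℕ → ℝ → ℝ} {J : Set ℝ}
    (h : IsChebyshevOn (r + 3) z zd J) (x y : ℕ → ℝ) {Y : ℕ → ℝ}
    (hY : StrictMono Y) (hYJ : ∀ i, Y i ∈ J) (L : ℕ)
    (hw : ∀ i ≤ L, pencilWronskian r z zd x y (Y i) ≠ 0) :
    changes (sampleList (fun i => decide (0 < pencilWronskian r z zd x y (Y i))) 0 (L + 1)) ≤
      2 * r + 1 := by
  -- Ordered configurations in `J` form a convex set, on which the nonvanishing minors of each size
  -- have a constant sign.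
  have hsign : ∀ k, ∃ κ : ℝ, κ ^ 2 = 1 ∧ (k ≤ r + 3 → ∀ x : Fin k → ℝ, StrictMono x →
      (∀ j, x j ∈ J) → 0 < κ * (Matrix.of fun i j : Fin k => z i (x j)).det) := by
    intro k
    by_cases hk : k ≤ r + 3
    · have hc : ContinuousOn (fun x : Fin k → ℝ => (Matrix.of fun i j : Fin k => z i (x j)).det)
          {x : Fin k → ℝ | StrictMono x ∧ ∀ j, x j ∈ J} := by
        simp only [Matrix.det_apply, Matrix.of_apply]
        refine continuousOn_finsetSum _ fun σ _ => ContinuousOn.const_smul ?_ _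
        refine continuousOn_finsetProd _ fun i _ => ?_
        have hz : ContinuousOn (z (σ i)) J := fun t ht =>
          (h.hasDerivWithinAt (σ i) (by have := (σ i).2; omega) t ht).continuousWithinAt
        exact hz.comp (continuous_apply i).continuousOn fun x hx => hx.2 i
      obtain ⟨κ, h1, h2⟩ := exists_sign_of_preconnected
        (convex_strictMono_mem h.ordConnected k).isPreconnected hc
        (fun x hx => h.det_ne_zero k hk x hx.1 hx.2)
      exact ⟨κ, h1, fun _ x hx hx' => h2 x ⟨hx, hx'⟩⟩
    · exact ⟨1, by norm_num, fun h => absurd h hk⟩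
  choose κ hκ hκdet using hsign
  -- The product of the first `k` of these signs telescopes to `κ k`, so multiplying row `i` by `e
  -- i` makes all initial minors positive. The same change of the pencil coefficients preserves the
  -- Wronskian.
  set e : ℕ → ℝ := fun i => κ (i + 1) * κ i with he
  have he2 : ∀ i, e i * e i = 1 := fun i => by
    have h1 := hκ i
    have h2 := hκ (i + 1)
    simp only [he]
    linear_combination κ i ^ 2 * h2 + h1
  have hκ0 : κ 0 = 1 := by
    have := hκdet 0 (by omega) Fin.elim0 (fun i => i.elim0) (fun i => i.elim0)
    rw [Matrix.det_fin_zero, mul_one] at this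
    have h1 := hκ 0
    nlinarith
  have hprod : ∀ k, ∏ i : Fin k, e i = κ k := by
    intro k
    induction k with
    | zero => simp [hκ0]
    | succ k ih =>
      rw [Fin.prod_univ_castSucc]
      simp only [Fin.val_castSucc, Fin.val_last]
      rw [ih]
      simp only [he]
      linear_combination κ (k + 1) * hκ k
  have h' : IsChebyshevOn (r + 3) (fun i t => e i * z i t) (fun i t => e i * zd i t) J := by
    refine ⟨h.ordConnected, h.exists_lt, fun i hi t ht => (h.hasDerivWithinAt i hi t ht).const_mul _,
      fun i hi => continuousOn_const.mul (h.continuousOn_deriv i hi), ?_, ?_⟩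
    · intro k hk x hx hxJ
      have := h.det_ne_zero k hk x hx hxJ
      have e1 := Matrix.det_mul_column (fun i : Fin k => e i)
        (Matrix.of fun i j : Fin k => z i (x j))
      simp only [Matrix.of_apply] at e1
      rw [e1, hprod]
      exact mul_ne_zero (fun h0 => by have := hκ k; rw [h0] at this; norm_num at this) this
    · intro t ht
      have := h.wronskian_ne_zero t ht
      have e1 : e 0 * e 1 ≠ 0 := fun h0 => by
        have h1 := he2 0
        have h2 := he2 1
        have : (e 0 * e 1) * (e 0 * e 1) = 1 := by
          linear_combination h1 * (e 1 * e 1) + h2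
        rw [h0] at this; norm_num at this
      have e2 : e 0 * z 0 t * (e 1 * zd 1 t) - e 1 * z 1 t * (e 0 * zd 0 t) =
        e 0 * e 1 * (z 0 t * zd 1 t - z 1 t * zd 0 t) := by ring
      rw [e2]
      exact mul_ne_zero e1 this
  have hW : ∀ t, pencilWronskian r (fun i t => e i * z i t) (fun i t => e i * zd i t)
      (fun i => x i * e i) (fun i => y i * e i) t = pencilWronskian r z zd x y t := by
    intro t
    unfold pencilWronskian
    rw [pencilVec_congr (r := r) (x := fun i => x i * e i) (y := fun i => y i * e i)
      (b := fun i => e i * z i t) (x' := x) (y' := y) (b' := fun i => z i t),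
      pencilVec_congr (r := r) (x := fun i => x i * e i) (y := fun i => y i * e i)
      (b := fun i => e i * zd i t) (x' := x) (y' := y) (b' := fun i => zd i t)]
    · intro i _; linear_combination x i * zd i t * he2 i
    · intro i _; linear_combination y i * zd i t * he2 i
    · intro i _; linear_combination x i * z i t * he2 i
    · intro i _; linear_combination y i * z i t * he2 i
  have := changes_wronskian_le_of_pos h' ?_ (fun i => x i * e i) (fun i => y i * e i) hY hYJ L
    (fun i hi => by rw [hW]; exact hw i hi)
  · simpa only [hW] using this
  · intro k hk x hx hxJ
    have e1 := Matrix.det_mul_column (fun i : Fin k => e i)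
      (Matrix.of fun i j : Fin k => z i (x j))
    simp only [Matrix.of_apply] at e1
    rw [e1, hprod]
    exact hκdet k hk x hx hxJ

theorem IsChebyshevOn.eq_zero_of_zeros {n : ℕ} {z zd : ℕ → ℝ → ℝ} {J : Set ℝ}
    (h : IsChebyshevOn n z zd J) (c : ℕ → ℝ) {x : Fin n → ℝ} (hx : StrictMono x)
    (hxJ : ∀ j, x j ∈ J) (h0 : ∀ j, ∑ i ∈ Finset.range n, c i * z i (x j) = 0) :
    ∀ i < n, c i = 0 := by
  have := Matrix.eq_zero_of_vecMul_eq_zero (h.det_ne_zero n le_rfl x hx hxJ)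
    (v := fun i : Fin n => c i) ?_
  · intro i hi
    exact congrFun this ⟨i, hi⟩
  · ext j
    have := h0 j
    rw [Finset.sum_range] at this
    simpa [Matrix.vecMul, dotProduct] using this

theorem IsChebyshevOn.exists_ne_zero {n : ℕ} {z zd : ℕ → ℝ → ℝ} {J : Set ℝ}
    (h : IsChebyshevOn n z zd J) (c : ℕ → ℝ) {a b : ℝ} (hab : a < b) (hJ : Set.Ioo a b ⊆ J)
    {i : ℕ} (hi : i < n) (hc : c i ≠ 0) :
    ∃ t ∈ Set.Ioo a b, ∑ i ∈ Finset.range n, c i * z i t ≠ 0 := by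
  by_contra hcon
  push Not at hcon
  set x : Fin n → ℝ := fun j => a + (b - a) * ((j + 1 : ℝ) / (n + 1)) with hx
  have hba : 0 < b - a := sub_pos.mpr hab
  have hxI : ∀ j, x j ∈ Set.Ioo a b := by
    intro j
    have h1 : (0 : ℝ) < (j + 1 : ℝ) / (n + 1) := by positivity
    have h2 : (j + 1 : ℝ) / (n + 1) < 1 := by
      rw [div_lt_one (by positivity)]
      have : (j : ℝ) < n := by exact_mod_cast j.2
      linarith
    constructor
    · simp only [hx]; nlinarith
    · simp only [hx]; nlinarith
  have hmono : StrictMono x := by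
    intro i j hij
    have : (i : ℝ) < j := by exact_mod_cast hij
    simp only [hx]
    gcongr
  exact hc (h.eq_zero_of_zeros c hmono (fun j => hJ (hxI j)) (fun j => hcon _ (hxI j)) i hi)

theorem pencilVec_combination {r : ℕ} (x y b : ℕ → ℝ) (α β : ℝ) :
    α * (pencilVec r x y b).1 + β * (pencilVec r x y b).2 =
      ∑ i ∈ Finset.range (r + 3), (α * (if i < r + 1 then x i else 0) + β * y i) * b i := by
  have : ∑ i ∈ Finset.range (r + 1), x i * b i =
      ∑ i ∈ Finset.range (r + 3), (if i < r + 1 then x i else 0) * b i := by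
    rw [Finset.sum_range_succ _ (r + 2), Finset.sum_range_succ _ (r + 1)]
    simp only [add_lt_add_iff_left, lt_irrefl, ↓reduceIte, zero_mul, add_zero,
      show ¬ (2 < 1) by norm_num]
    exact Finset.sum_congr rfl fun i hi => by rw [if_pos (Finset.mem_range.mp hi)]
  simp only [pencilVec, this, Finset.mul_sum, ← Finset.sum_add_distrib]
  exact Finset.sum_congr rfl fun i _ => by ring

/-- The pencil with coefficients `x` and `y` is spanned by two linearly independent functions. -/
def IndepPencil (r : ℕ) (x y : ℕ → ℝ) : Prop :=
  ∀ α β : ℝ, (∀ i < r + 3, α * (if i < r + 1 then x i else 0) + β * y i = 0) → α = 0 ∧ β = 0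

/-- If the Wronskian vanished on a subinterval, the quotient of the two members would be locally
constant wherever the first is nonzero. Some nontrivial combination would then vanish on an
interval, with more zeros than a Chebyshev system allows. -/
theorem IsChebyshevOn.exists_wronskian_ne_zero {r : ℕ} {z zd : ℕ → ℝ → ℝ} {J : Set ℝ}
    (h : IsChebyshevOn (r + 3) z zd J) {x y : ℕ → ℝ} (hxy : IndepPencil r x y) {a b : ℝ}
    (hab : a < b) (hJ : Set.Ioo a b ⊆ J) :
    ∃ t ∈ Set.Ioo a b, pencilWronskian r z zd x y t ≠ 0 := by
  have hcomb : ∀ α β : ℝ, ¬ (α = 0 ∧ β = 0) → ∀ a b : ℝ, a < b → Set.Ioo a b ⊆ J →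
      ∃ t ∈ Set.Ioo a b, α * (pencilVec r x y fun i => z i t).1 +
        β * (pencilVec r x y fun i => z i t).2 ≠ 0 := by
    intro α β hαβ a b hab hJ
    have hne := mt (hxy α β) hαβ
    push Not at hne
    obtain ⟨i, hi, hne⟩ := hne
    simp only [pencilVec_combination]
    exact h.exists_ne_zero (fun i => α * (if i < r + 1 then x i else 0) + β * y i) hab hJ hi hne
  by_contra hcon
  push Not at hcon
  set X : ℝ → ℝ := fun t => (pencilVec r x y fun i => z i t).1 with hX
  set Y : ℝ → ℝ := fun t => (pencilVec r x y fun i => z i t).2 with hY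
  obtain ⟨t₀, ht₀, hX0⟩ := hcomb 1 0 (by simp) a b hab hJ
  replace hX0 : X t₀ ≠ 0 := by simpa using hX0
  have hd : ∀ t ∈ Set.Ioo a b, HasDerivAt X (pencilVec r x y fun i => zd i t).1 t ∧
      HasDerivAt Y (pencilVec r x y fun i => zd i t).2 t := by
    intro t ht
    obtain ⟨h1, h2⟩ := hasDerivWithinAt_pencilVec h.hasDerivWithinAt x y (hJ ht)
    have hn : J ∈ 𝓝 t := Filter.mem_of_superset (isOpen_Ioo.mem_nhds ht) hJ
    exact ⟨h1.hasDerivAt hn, h2.hasDerivAt hn⟩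
  have hev : ∀ᶠ t in 𝓝 t₀, X t ≠ 0 ∧ t ∈ Set.Ioo a b :=
    ((hd t₀ ht₀).1.continuousAt.eventually_ne hX0).and (isOpen_Ioo.mem_nhds ht₀)
  obtain ⟨c, d, ⟨hc, hd'⟩, hcd⟩ := mem_nhds_iff_exists_Ioo_subset.mp hev
  have hder : ∀ t ∈ Set.Ioo c d, HasDerivAt (fun t => Y t / X t) 0 t := by
    intro t ht
    obtain ⟨hXt, htab⟩ := hcd ht
    obtain ⟨h1, h2⟩ := hd t htab
    have hw := hcon t htab
    have := h2.div h1 hXt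
    have e : (pencilVec r x y fun i => zd i t).2 * X t -
        Y t * (pencilVec r x y fun i => zd i t).1 = 0 := by
      rw [← hw]
      simp only [pencilWronskian, planeDet, hX, hY]
      ring
    rw [e, zero_div] at this
    exact this
  have hconst : ∀ t ∈ Set.Ioo c d, Y t / X t = Y t₀ / X t₀ := fun t ht =>
    isOpen_Ioo.is_const_of_deriv_eq_zero isPreconnected_Ioo
      (fun s hs => (hder s hs).differentiableAt.differentiableWithinAt)
      (fun s hs => (hder s hs).deriv) ht ⟨hc, hd'⟩
  obtain ⟨t, ht, hne⟩ := hcomb (-(Y t₀ / X t₀)) 1 (by simp) c d (hc.trans hd')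
    (fun s hs => hJ (hcd hs).2)
  apply hne
  have := hconst t ht
  have hXt := (hcd ht).1
  rw [div_eq_iff hXt] at this
  show -(Y t₀ / X t₀) * X t + 1 * Y t = 0
  rw [this]; ring

/-! ### From sign changes to zeros: four perturbations -/

/-- Even places carry a sign common to the four sequences, odd places carry two signs of each kind.
An odd place between two even ones contributes four changes in total: two sequences with two changes
if the neighbours agree, one change in each sequence otherwise. The last odd place has only a left
neighbour and contributes two. -/
theorem four_mul_le_changes (b : Bool → Bool → ℕ → Bool)
    (hs : ∀ e f i, b e f (2 * i) = b true true (2 * i)) (m : ℕ) : ∀ i,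
    (∀ j, i ≤ j → j < i + m + 1 → (b true true (2 * j + 1)).toNat + (b true false (2 * j + 1)).toNat +
      (b false true (2 * j + 1)).toNat + (b false false (2 * j + 1)).toNat = 2) →
    4 * m + 2 ≤ changes (sampleList (b true true) (2 * i) (2 * (m + 1))) +
      changes (sampleList (b true false) (2 * i) (2 * (m + 1))) +
      changes (sampleList (b false true) (2 * i) (2 * (m + 1))) +
      changes (sampleList (b false false) (2 * i) (2 * (m + 1))) := by
  induction m with
  | zero =>
    intro i hb
    have h1 := hb i le_rfl (by omega)
    simp only [sampleList_succ, sampleList_zero, changes, zero_add, mul_one]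
    rw [hs true false i, hs false true i, hs false false i]
    generalize b true true (2 * i) = s0 at *
    generalize b true true (2 * i + 1) = s1 at *
    generalize b true false (2 * i + 1) = s2 at *
    generalize b false true (2 * i + 1) = s3 at *
    generalize b false false (2 * i + 1) = s4 at *
    cases s0 <;> cases s1 <;> cases s2 <;> cases s3 <;> cases s4 <;> simp at h1 ⊢
  | succ m ih =>
    intro i hb
    have h1 := hb i le_rfl (by omega)
    have h2 := ih (i + 1) fun j hj hj' => hb j (by omega) (by omega)
    have key : ∀ u : ℕ → Bool, changes (sampleList u (2 * i) (2 * (m + 1 + 1))) =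
        (if u (2 * i) = u (2 * i + 1) then 0 else 1) +
        ((if u (2 * i + 1) = u (2 * (i + 1)) then 0 else 1) +
        changes (sampleList u (2 * (i + 1)) (2 * (m + 1)))) := by
      intro u
      rw [show 2 * (m + 1 + 1) = 2 * m + 1 + 1 + 1 + 1 by ring,
        show 2 * (m + 1) = 2 * m + 1 + 1 by ring, show 2 * (i + 1) = 2 * i + 1 + 1 by ring]
      simp only [sampleList_succ, changes]
    simp only [key]
    rw [hs true false i, hs false true i, hs false false i, hs true false (i + 1),
      hs false true (i + 1), hs false false (i + 1)]
    generalize b true true (2 * i) = s0 at *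
    generalize b true true (2 * i + 1) = s1 at *
    generalize b true false (2 * i + 1) = s2 at *
    generalize b false true (2 * i + 1) = s3 at *
    generalize b false false (2 * i + 1) = s4 at *
    generalize b true true (2 * (i + 1)) = s5 at *
    cases s0 <;> cases s1 <;> cases s2 <;> cases s3 <;> cases s4 <;> cases s5 <;>
      simp at h1 <;> simp <;> omega

/-- The sign belonging to a truth value. -/
def boolSign (e : Bool) : ℝ := if e then 1 else -1

/-- A direction in the space of pencils, with the signs of its two components changed. -/
def PencilSpace.flip {r : ℕ} (h : PencilSpace r) (e f : Bool) : PencilSpace r :=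
  (boolSign e • h.1, boolSign f • h.2)

theorem extendZero_smul {n : ℕ} (f : Fin n → ℝ) (t : ℝ) (i : ℕ) :
    extendZero (t • f) i = t * extendZero f i := by
  unfold extendZero; split_ifs <;> simp

theorem PencilSpace.flip_vec {r : ℕ} (h : PencilSpace r) (e f : Bool) (b : ℕ → ℝ) :
    (h.flip e f).vec b = (boolSign e * (h.vec b).1, boolSign f * (h.vec b).2) := by
  unfold PencilSpace.flip PencilSpace.vec pencilVec
  simp only [extendZero_smul, Finset.mul_sum, mul_assoc]

/-- Half of the four choices of signs of a generic perturbation make a zero of the Wronskian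
positive. -/
theorem exists_balanced {W₀ A B C : ℝ} (hW : W₀ = 0) (h : A ^ 2 ≠ B ^ 2 ∨ A = 0 ∧ B = 0 ∧ C ≠ 0) :
    ∃ β : Bool → Bool → Bool, ((β true true).toNat + (β true false).toNat +
      (β false true).toNat + (β false false).toNat = 2) ∧ ∀ e f, ∀ᶠ ε in 𝓝[>] (0 : ℝ),
      W₀ + ε * (boolSign e * A + boolSign f * B) + ε ^ 2 * (boolSign e * boolSign f * C) ≠ 0 ∧
      decide (0 < W₀ + ε * (boolSign e * A + boolSign f * B) +
        ε ^ 2 * (boolSign e * boolSign f * C)) = β e f := by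
  subst hW
  have hpos : ∀ᶠ ε : ℝ in 𝓝[>] (0 : ℝ), 0 < ε := self_mem_nhdsWithin
  -- If the first-order term is nonzero for all sign choices, it decides, and reversing both signs
  -- reverses it. Otherwise the second-order term decides, through the product of the two signs.
  -- Either way two of the four choices are positive.
  rcases h with h | ⟨rfl, rfl, hC⟩
  · have hne : ∀ e f, boolSign e * A + boolSign f * B ≠ 0 := by
      intro e f h0
      apply h
      have he : boolSign e ^ 2 = 1 := by cases e <;> simp [boolSign]
      have hf : boolSign f ^ 2 = 1 := by cases f <;> simp [boolSign]
      linear_combination -(A ^ 2) * he + B ^ 2 * hf + (boolSign e * A - boolSign f * B) * h0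
    refine ⟨fun e f => decide (0 < boolSign e * A + boolSign f * B), ?_, fun e f => ?_⟩
    · have h1 := hne true true
      have h2 := hne true false
      simp only [boolSign, if_true, Bool.false_eq_true, if_false, one_mul] at h1 h2 ⊢
      have e1 : (0 < -1 * A + -1 * B) ↔ ¬ (0 < A + B) :=
        ⟨fun h => by linarith, fun h => by
          have := lt_of_le_of_ne (not_lt.mp h) h1; linarith⟩
      have e2 : (0 < -1 * A + B) ↔ ¬ (0 < A + -1 * B) :=
        ⟨fun h => by linarith, fun h => by
          have := lt_of_le_of_ne (not_lt.mp h) h2; linarith⟩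
      simp only [e1, e2]
      by_cases c1 : 0 < A + B <;> by_cases c2 : 0 < A + -1 * B <;>
        simp only [c1, c2, decide_true, decide_false, not_true, not_false_eq_true, Bool.toNat_true,
          Bool.toNat_false]
    · have hc : Filter.Tendsto (fun ε : ℝ => ((boolSign e * A + boolSign f * B) +
          ε * (boolSign e * boolSign f * C)) * (boolSign e * A + boolSign f * B)) (𝓝 0)
          (𝓝 ((boolSign e * A + boolSign f * B) * (boolSign e * A + boolSign f * B))) := by
        have : Continuous fun ε : ℝ => ((boolSign e * A + boolSign f * B) +
          ε * (boolSign e * boolSign f * C)) * (boolSign e * A + boolSign f * B) := by fun_prop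
        simpa using this.tendsto 0
      filter_upwards [hpos, nhdsWithin_le_nhds
        (hc.eventually (lt_mem_nhds (mul_self_pos.mpr (hne e f))))] with ε hε h1
      have e1 : 0 + ε * (boolSign e * A + boolSign f * B) + ε ^ 2 * (boolSign e * boolSign f * C) =
        ε * ((boolSign e * A + boolSign f * B) + ε * (boolSign e * boolSign f * C)) := by ring
      rw [e1]
      refine ⟨mul_ne_zero hε.ne' (left_ne_zero_of_mul h1.ne'), ?_⟩
      rw [decide_eq_decide, mul_pos_iff_of_pos_left hε]
      exact pos_iff_pos_of_mul_pos h1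
  · refine ⟨fun e f => decide (0 < boolSign e * boolSign f * C), ?_, fun e f => ?_⟩
    · simp only [boolSign, if_true, Bool.false_eq_true, if_false, one_mul]
      rcases lt_or_gt_of_ne hC with h | h
      · have e1 : ¬ 0 < C := h.not_gt
        have e2 : ¬ 0 < -1 * -1 * C := by linarith
        have e3 : 0 < -1 * C := by linarith
        simp only [e1, e2, e3, mul_one, decide_true, decide_false, Bool.toNat_true,
          Bool.toNat_false]
      · have e1 : 0 < C := h
        have e2 : 0 < -1 * -1 * C := by linarith
        have e3 : ¬ 0 < -1 * C := by linarith
        simp only [e1, e2, e3, mul_one, decide_true, decide_false, Bool.toNat_true,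
          Bool.toNat_false]
    · filter_upwards [hpos] with ε hε
      have : boolSign e * boolSign f * C ≠ 0 := by
        refine mul_ne_zero ?_ hC
        cases e <;> cases f <;> simp [boolSign]
      simp only [mul_zero, add_zero, zero_add]
      refine ⟨mul_ne_zero (by positivity) this, ?_⟩
      rw [decide_eq_decide, mul_pos_iff_of_pos_left (by positivity)]

/-- This is the genericity required by `exists_balanced`; the Wronskian of the first two functions
enters only when the first-order terms vanish for all directions. -/
theorem PencilSpace.exists_open_dense_generic {r : ℕ} (p : PencilSpace r) {b b' : ℕ → ℝ}
    (hb : b 0 * b' 1 - b 1 * b' 0 ≠ 0) :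
    ∃ U : Set (PencilSpace r), IsOpen U ∧ Dense U ∧ ∀ h ∈ U,
      ((h.vec b).1 * (p.vec b').2 - (p.vec b).2 * (h.vec b').1) ^ 2 ≠
        ((p.vec b).1 * (h.vec b').2 - (h.vec b).2 * (p.vec b').1) ^ 2 ∨
      (h.vec b).1 * (p.vec b').2 - (p.vec b).2 * (h.vec b').1 = 0 ∧
        (p.vec b).1 * (h.vec b').2 - (h.vec b).2 * (p.vec b').1 = 0 ∧
        planeDet (h.vec b) (h.vec b') ≠ 0 := by
  set A : PencilSpace r → ℝ := fun h => (h.vec b).1 * (p.vec b').2 - (p.vec b).2 * (h.vec b').1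
    with hA
  set B : PencilSpace r → ℝ := fun h => (p.vec b).1 * (h.vec b').2 - (h.vec b).2 * (p.vec b').1
    with hB
  have hc := PencilSpace.continuous_vec (r := r) b
  have hc' := PencilSpace.continuous_vec (r := r) b'
  have hAc : Continuous A := (hc.fst.mul continuous_const).sub (continuous_const.mul hc'.fst)
  have hBc : Continuous B := (continuous_const.mul hc'.snd).sub (hc.snd.mul continuous_const)
  by_cases hex : ∃ h, A h ^ 2 ≠ B h ^ 2
  · obtain ⟨v, hv⟩ := hex
    refine ⟨{h | A h ^ 2 - B h ^ 2 ≠ 0},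
      isOpen_ne_fun ((by fun_prop : Continuous fun h => A h ^ 2 - B h ^ 2)) continuous_const, ?_, fun h hh => Or.inl ?_⟩
    · refine dense_ne_zero_of_quadratic (fun h => A h ^ 2 - B h ^ 2) (fun g h => ?_)
        (sub_ne_zero.mpr hv)
      refine ⟨2 * (A g * A h - B g * B h), fun t => ?_⟩
      have e1 : A (g + t • h) = A g + t * A h := by
        simp only [hA, PencilSpace.vec_add_smul, Prod.fst_add, Prod.smul_fst, smul_eq_mul]; ring
      have e2 : B (g + t • h) = B g + t * B h := by
        simp only [hB, PencilSpace.vec_add_smul, Prod.snd_add, Prod.smul_snd, smul_eq_mul]; ring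
      simp only [e1, e2]; ring
    · exact sub_ne_zero.mp hh
  -- `A` depends only on the first component of the direction and `B` only on the second, so `A² =
  -- B²` everywhere forces both to vanish identically.
  · push Not at hex
    have h2 : ∀ (h : Fin (r + 1) → ℝ) (c : ℕ → ℝ),
        (PencilSpace.vec (r := r) (h, 0) c).2 = 0 := by
      intro h c; simp [PencilSpace.vec, pencilVec, extendZero]
    have h1 : ∀ (h : Fin (r + 3) → ℝ) (c : ℕ → ℝ),
        (PencilSpace.vec (r := r) (0, h) c).1 = 0 := by
      intro h c; simp [PencilSpace.vec, pencilVec, extendZero]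
    have hA0 : ∀ h, A h = 0 := by
      intro h
      have e1 : A h = A (h.1, 0) := rfl
      have e2 : B (h.1, 0) = 0 := by simp [hB, h2]
      have := hex (h.1, 0)
      rw [e2] at this
      rw [e1]; simpa using this
    have hB0 : ∀ h, B h = 0 := by
      intro h
      have e1 : B h = B (0, h.2) := rfl
      have := hex (0, h.2)
      rw [hA0] at this
      rw [e1]; simpa using this.symm
    obtain ⟨v, hv⟩ := PencilSpace.exists_planeDet_ne_zero (r := r) (i := 0) (j := 1)
      (Nat.zero_le _) (by omega) hb
    exact ⟨{h | planeDet (h.vec b) (h.vec b') ≠ 0},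
      isOpen_ne.preimage (PencilSpace.continuous_planeDet b b'),
      dense_ne_zero_of_quadratic _ (fun g h => PencilSpace.planeDet_quadratic b b' g h) hv,
      fun h hh => Or.inr ⟨hA0 h, hB0 h, hh⟩⟩

theorem PencilSpace.planeDet_add_flip {r : ℕ} (p h : PencilSpace r) (b b' : ℕ → ℝ) (e f : Bool)
    (ε : ℝ) : planeDet ((p + ε • h.flip e f).vec b) ((p + ε • h.flip e f).vec b') =
      planeDet (p.vec b) (p.vec b') +
      ε * (boolSign e * ((h.vec b).1 * (p.vec b').2 - (p.vec b).2 * (h.vec b').1) +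
        boolSign f * ((p.vec b).1 * (h.vec b').2 - (h.vec b).2 * (p.vec b').1)) +
      ε ^ 2 * (boolSign e * boolSign f * planeDet (h.vec b) (h.vec b')) := by
  simp only [PencilSpace.vec_add_smul, PencilSpace.flip_vec, planeDet, Prod.fst_add, Prod.snd_add,
    Prod.smul_fst, Prod.smul_snd, smul_eq_mul]
  ring

/-- `T 0` is an auxiliary point of `J` to the left of the chosen `m + 1` elements of `Z`; beyond
index `m + 1` only membership in `J` matters. -/
theorem exists_seq_of_lt_encard {J Z : Set ℝ} (hJ : ∀ t ∈ J, ∃ s ∈ J, s < t) (hZ : Z ⊆ J) {m : ℕ}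
    (hm : (m : ℕ∞) < Z.encard) : ∃ T : ℕ → ℝ, (∀ i, T i ∈ J) ∧ (∀ i < m + 1, T i < T (i + 1)) ∧
      ∀ i < m + 1, T (i + 1) ∈ Z := by
  obtain ⟨S, hS, hcard⟩ := Set.exists_subset_encard_eq (s := Z) (k := ((m + 1 : ℕ) : ℕ∞))
    (by push_cast; exact Order.add_one_le_of_lt hm)
  have hfin : S.Finite := Set.finite_of_encard_eq_coe hcard
  have hc : hfin.toFinset.card = m + 1 := by
    rw [hfin.encard_eq_coe_toFinset_card] at hcard
    exact_mod_cast hcard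
  set σ := hfin.toFinset.orderEmbOfFin hc
  have hσ : ∀ i, σ i ∈ Z := fun i => hS (by
    have := hfin.toFinset.orderEmbOfFin_mem hc i
    exact hfin.mem_toFinset.mp this)
  obtain ⟨t, htJ, ht⟩ := hJ (σ 0) (hZ (hσ 0))
  refine ⟨fun i => if i = 0 then t else σ (Fin.ofNat (m + 1) (i - 1)), fun i => ?_,
    fun i hi => ?_, fun i hi => ?_⟩
  · dsimp only
    split_ifs
    · exact htJ
    · exact hZ (hσ _)
  · rcases Nat.eq_zero_or_pos i with rfl | h
    · simpa using ht
    · simp only [h.ne', ↓reduceIte, Nat.add_eq_zero_iff, one_ne_zero, and_false,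
        Nat.add_sub_cancel]
      apply σ.strictMono
      rw [Fin.lt_def]
      simp only [Fin.ofNat]
      rw [Nat.mod_eq_of_lt (by omega), Nat.mod_eq_of_lt (by omega)]
      omega
  · simpa using hσ _

theorem continuousOn_pencilWronskian {r : ℕ} {z zd : ℕ → ℝ → ℝ} {J : Set ℝ}
    (h : IsChebyshevOn (r + 3) z zd J) (x y : ℕ → ℝ) :
    ContinuousOn (pencilWronskian r z zd x y) J := by
  have hz : ∀ i < r + 3, ContinuousOn (z i) J := fun i hi t ht =>
    (h.hasDerivWithinAt i hi t ht).continuousWithinAt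
  have hzd := h.continuousOn_deriv
  unfold pencilWronskian planeDet pencilVec
  refine ContinuousOn.sub (ContinuousOn.mul ?_ ?_) (ContinuousOn.mul ?_ ?_) <;>
  · dsimp only
    refine continuousOn_finsetSum _ fun i hi => continuousOn_const.mul ?_
    have := Finset.mem_range.mp hi
    first | exact hz i (by omega) | exact hzd i (by omega)

/-- The Wronskian of a two-dimensional pencil in a Chebyshev system, one member of which is taken
from the corank two member of the flag, has at most `2 * r + 1` zeros. -/
theorem encard_pencilWronskian_zeros_le {r : ℕ} {z zd : ℕ → ℝ → ℝ} {J : Set ℝ}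
    (h : IsChebyshevOn (r + 3) z zd J) {x y : ℕ → ℝ} (hxy : IndepPencil r x y) :
    {t ∈ J | pencilWronskian r z zd x y t = 0}.encard ≤ ((2 * r + 1 : ℕ) : ℕ∞) := by
  by_contra hcon
  obtain ⟨T, hTJ, hT, hTZ⟩ := exists_seq_of_lt_encard h.exists_lt (fun t ht => ht.1)
    (not_le.mp hcon)
  have hIoo : ∀ i, Set.Ioo (T i) (T (i + 1)) ⊆ J := fun i t ht =>
    h.ordConnected.out (hTJ i) (hTJ (i + 1)) (Set.Ioo_subset_Icc_self ht)
  have hs : ∀ i, ∃ s ∈ J, i < 2 * r + 1 + 1 → T i < s ∧ s < T (i + 1) ∧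
      pencilWronskian r z zd x y s ≠ 0 := by
    intro i
    by_cases hi : i < 2 * r + 1 + 1
    · obtain ⟨s, hs, hw⟩ := h.exists_wronskian_ne_zero hxy (hT i hi) (hIoo i)
      exact ⟨s, hIoo i hs, fun _ => ⟨hs.1, hs.2, hw⟩⟩
    · exact ⟨T i, hTJ i, fun h => absurd h hi⟩
  choose s hsJ hs using hs
  set p : PencilSpace r := (fun i => x i, fun i => y i) with hp
  have hpw : ∀ t, planeDet (p.vec fun i => z i t) (p.vec fun i => zd i t) =
      pencilWronskian r z zd x y t := fun t => by
    rw [hp, PencilSpace.vec_restrict, PencilSpace.vec_restrict]; rfl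
  choose U hUo hUd hU using fun i =>
    PencilSpace.exists_open_dense_generic p (b := fun j => z j (T i))
      (b' := fun j => zd j (T i)) (h.wronskian_ne_zero (T i) (hTJ i))
  obtain ⟨d, hd⟩ := (dense_iInter_of_isOpen hUo hUd).nonempty
  rw [Set.mem_iInter] at hd
  set W : Bool → Bool → ℝ → ℝ → ℝ := fun e f ε t =>
    pencilWronskian r z zd (extendZero (p + ε • d.flip e f).1) (extendZero (p + ε • d.flip e f).2) t
    with hW
  have hW' : ∀ e f ε t, W e f ε t = planeDet ((p + ε • d.flip e f).vec fun i => z i t)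
    ((p + ε • d.flip e f).vec fun i => zd i t) := fun e f ε t => rfl
  have hβ : ∀ i : Fin (2 * r + 1 + 1), ∃ β : Bool → Bool → Bool,
      ((β true true).toNat + (β true false).toNat +
      (β false true).toNat + (β false false).toNat = 2) ∧ ∀ e f, ∀ᶠ ε in 𝓝[>] (0 : ℝ),
      W e f ε (T (i + 1)) ≠ 0 ∧ decide (0 < W e f ε (T (i + 1))) = β e f := by
    intro i
    obtain ⟨β, h1, h2⟩ := exists_balanced
      (W₀ := planeDet (p.vec fun j => z j (T (i + 1))) (p.vec fun j => zd j (T (i + 1))))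
      (by rw [hpw]; exact (hTZ i i.2).2) (hU (i + 1) d (hd (i + 1)))
    refine ⟨β, h1, fun e f => ?_⟩
    simp only [hW', PencilSpace.planeDet_add_flip]
    exact h2 e f
  choose β hβ1 hβ2 using hβ
  have hev : ∀ (i : Fin (2 * r + 1 + 1)) (e f : Bool), ∀ᶠ ε in 𝓝[>] (0 : ℝ),
      W e f ε (s i) ≠ 0 ∧ decide (0 < W e f ε (s i)) =
        decide (0 < pencilWronskian r z zd x y (s i)) := by
    intro i e f
    have hw := (hs i i.2).2.2
    have hc : Filter.Tendsto (fun ε : ℝ => W e f ε (s i) * pencilWronskian r z zd x y (s i)) (𝓝 0)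
        (𝓝 (pencilWronskian r z zd x y (s i) * pencilWronskian r z zd x y (s i))) := by
      simp only [hW', PencilSpace.planeDet_add_flip, hpw]
      have : Continuous fun ε : ℝ => (pencilWronskian r z zd x y (s i) +
        ε * (boolSign e * ((d.vec fun j => z j (s i)).1 * (p.vec fun j => zd j (s i)).2 -
            (p.vec fun j => z j (s i)).2 * (d.vec fun j => zd j (s i)).1) +
          boolSign f * ((p.vec fun j => z j (s i)).1 * (d.vec fun j => zd j (s i)).2 -
            (d.vec fun j => z j (s i)).2 * (p.vec fun j => zd j (s i)).1)) +
        ε ^ 2 * (boolSign e * boolSign f *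
          planeDet (d.vec fun j => z j (s i)) (d.vec fun j => zd j (s i)))) *
        pencilWronskian r z zd x y (s i) := by fun_prop
      simpa using this.tendsto 0
    filter_upwards [nhdsWithin_le_nhds (hc.eventually (lt_mem_nhds (mul_self_pos.mpr hw)))]
      with ε hε
    exact ⟨left_ne_zero_of_mul hε.ne', decide_eq_decide.mpr (pos_iff_pos_of_mul_pos hε)⟩
  have hall : ∀ᶠ ε in 𝓝[>] (0 : ℝ), ∀ (i : Fin (2 * r + 1 + 1)) (e f : Bool),
      (W e f ε (T (i + 1)) ≠ 0 ∧ decide (0 < W e f ε (T (i + 1))) = β i e f) ∧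
      (W e f ε (s i) ≠ 0 ∧ decide (0 < W e f ε (s i)) =
        decide (0 < pencilWronskian r z zd x y (s i))) := by
    simp only [Filter.eventually_all]
    exact fun i e f => (hβ2 i e f).and (hev i e f)
  obtain ⟨ε, hε⟩ := hall.exists
  -- The last zero `b` may be the right end of `J`, with no room for a sample behind it. The
  -- perturbed Wronskians do not vanish at `b`, so points just to its left have the same signs; a
  -- sequence of them replaces `b` and supplies the infinite tail of `Y`.
  have hlast := hs (2 * r + 1) (by omega)
  set b := T (2 * r + 1 + 1) with hb
  have hnear : ∀ᶠ t in 𝓝[<] b, ∀ e f : Bool, W e f ε t ≠ 0 ∧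
      decide (0 < W e f ε t) = β (Fin.last _) e f := by
    simp only [Filter.eventually_all]
    intro e f
    obtain ⟨h1, h2⟩ := (hε (Fin.last _) e f).1
    simp only [Fin.val_last, ← hb] at h1 h2
    have hc : ContinuousWithinAt (W e f ε) J b := continuousOn_pencilWronskian h _ _ b (hTJ _)
    have hle : 𝓝[<] b ≤ 𝓝[J] b := by
      rw [← nhdsWithin_Ioo_eq_nhdsLT (hT (2 * r + 1) (by omega))]
      exact nhdsWithin_mono _ (hIoo _)
    have hc' := (hc.mono_left hle).mul_const (W e f ε b)
    filter_upwards [hc'.eventually (lt_mem_nhds (mul_self_pos.mpr h1))] with t ht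
    refine ⟨left_ne_zero_of_mul ht.ne', ?_⟩
    rw [← h2]
    exact decide_eq_decide.mpr (pos_iff_pos_of_mul_pos ht)
  obtain ⟨l, hl, hlb⟩ := (mem_nhdsLT_iff_exists_mem_Ico_Ioo_subset hlast.2.1).mp hnear
  have hlb' : 0 < b - l := sub_pos.mpr hl.2
  have hfar : ∀ k : ℕ, l < b - (b - l) / (k + 2) ∧ b - (b - l) / (k + 2) < b := by
    intro k
    have h1 : 0 < (b - l) / (k + 2) := by positivity
    have h2 : (b - l) / (k + 2) < b - l := by
      rw [div_lt_iff₀ (by positivity)]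
      have : (0 : ℝ) ≤ k := k.cast_nonneg
      nlinarith
    constructor <;> linarith
  set Y : ℕ → ℝ := fun j => if j < 4 * r + 3 then (if j % 2 = 0 then s (j / 2) else T (j / 2 + 1))
    else b - (b - l) / ((j - (4 * r + 3) : ℕ) + 2) with hY
  have hYe : ∀ i, i ≤ 2 * r + 1 → Y (2 * i) = s i := by
    intro i hi
    simp only [hY]
    rw [if_pos (by omega), if_pos (by omega), show 2 * i / 2 = i by omega]
  have hYo : ∀ i, i < 2 * r + 1 → Y (2 * i + 1) = T (i + 1) := by
    intro i hi
    simp only [hY]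
    rw [if_pos (by omega), if_neg (by omega), show (2 * i + 1) / 2 = i by omega]
  have hYl : ∀ k, Y (4 * r + 3 + k) = b - (b - l) / (k + 2) := by
    intro k
    simp only [hY]
    rw [if_neg (by omega), Nat.add_sub_cancel_left]
  have hYmono : StrictMono Y := by
    refine strictMono_nat_of_lt_succ fun j => ?_
    by_cases hj : j < 4 * r + 2
    · rcases Nat.even_or_odd' j with ⟨i, rfl | rfl⟩
      · rw [hYe i (by omega), hYo i (by omega)]
        exact (hs i (by omega)).2.1
      · rw [hYo i (by omega), show 2 * i + 1 + 1 = 2 * (i + 1) by ring, hYe _ (by omega)]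
        exact (hs (i + 1) (by omega)).1
    · by_cases hj' : j = 4 * r + 2
      · subst hj'
        have := hYl 0
        rw [show 4 * r + 2 = 2 * (2 * r + 1) by ring, hYe _ le_rfl,
          show 2 * (2 * r + 1) + 1 = 4 * r + 3 + 0 by ring, hYl]
        exact lt_of_le_of_lt hl.1 (hfar 0).1
      · obtain ⟨k, rfl⟩ := Nat.exists_eq_add_of_le (show 4 * r + 3 ≤ j by omega)
        rw [add_assoc (4 * r + 3) k 1, hYl, hYl]
        push_cast
        gcongr
        linarith
  have hYJ : ∀ j, Y j ∈ J := by
    intro j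
    simp only [hY]
    split_ifs
    · exact hsJ _
    · exact hTJ _
    · have := hfar (j - (4 * r + 3))
      exact hIoo (2 * r + 1) ⟨hlast.1.trans_le (hl.1.trans this.1.le), this.2⟩
  have hsgn : ∀ e f (i : Fin (2 * r + 1 + 1)), W e f ε (Y (2 * i + 1)) ≠ 0 ∧
      decide (0 < W e f ε (Y (2 * i + 1))) = β i e f := by
    intro e f i
    by_cases hi : (i : ℕ) < 2 * r + 1
    · rw [hYo i hi]; exact (hε i e f).1
    · have : i = Fin.last _ := Fin.ext (by rw [Fin.val_last]; have := i.2; omega)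
      subst this
      rw [Fin.val_last, show 2 * (2 * r + 1) + 1 = 4 * r + 3 + 0 by ring, hYl]
      exact hlb (hfar 0) e f
  have hWY : ∀ e f, ∀ j ≤ 2 * (2 * r + 1) + 1, W e f ε (Y j) ≠ 0 := by
    intro e f j hj
    rcases Nat.even_or_odd' j with ⟨i, rfl | rfl⟩
    · rw [hYe i (by omega)]
      exact (hε ⟨i, by omega⟩ e f).2.1
    · exact (hsgn e f ⟨i, by omega⟩).1
  have hch : ∀ e f, changes (sampleList (fun j => decide (0 < W e f ε (Y j))) 0
      (2 * (2 * r + 1) + 1 + 1)) ≤ 2 * r + 1 := fun e f =>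
    changes_wronskian_le h _ _ hYmono hYJ (2 * (2 * r + 1) + 1) (hWY e f)
  -- Only `4r + 4` samples are used; the default value beyond them makes the even places agree for
  -- all indices, as `four_mul_le_changes` demands.
  set B : Bool → Bool → ℕ → Bool := fun e f j =>
    if j < 4 * r + 4 then decide (0 < W e f ε (Y j)) else false with hB
  have hsl : ∀ e f, sampleList (B e f) (2 * 0) (2 * (2 * r + 1 + 1)) =
      sampleList (fun j => decide (0 < W e f ε (Y j))) 0 (2 * (2 * r + 1) + 1 + 1) := by
    intro e f
    unfold sampleList
    rw [show 2 * (2 * r + 1 + 1) = 2 * (2 * r + 1) + 1 + 1 by ring]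
    refine List.map_congr_left fun j hj => ?_
    rw [List.mem_range'_1] at hj
    simp only [hB]
    rw [if_pos (by omega)]
  -- With `2r + 2` zeros the four sequences have at least `4(2r + 1) + 2` changes in total, while
  -- each of them has at most `2r + 1`.
  have hfour := four_mul_le_changes B ?_ (2 * r + 1) 0 ?_
  · simp only [hsl] at hfour
    have h1 := hch true true
    have h2 := hch true false
    have h3 := hch false true
    have h4 := hch false false
    omega
  · intro e f i
    simp only [hB]
    split_ifs with hi
    · rw [hYe i (by omega), (hε ⟨i, by omega⟩ e f).2.2, (hε ⟨i, by omega⟩ true true).2.2]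
    · rfl
  · intro j _ hj
    simp only [hB]
    rw [if_pos (by omega), if_pos (by omega), if_pos (by omega), if_pos (by omega)]
    have hj' : j < 2 * r + 1 + 1 := by omega
    rw [(hsgn true true ⟨j, hj'⟩).2, (hsgn true false ⟨j, hj'⟩).2, (hsgn false true ⟨j, hj'⟩).2,
      (hsgn false false ⟨j, hj'⟩).2]
    exact hβ1 _

/-! ### Lifts, jets and convexity -/

/-- The span of the derivatives of orders `0, …, k - 1` of `f` at `t`. -/
def jetSpan {n : ℕ} (f : ℝ → Fin n → ℝ) (I : Set ℝ) (t : ℝ) (k : ℕ) : Submodule ℝ (Fin n → ℝ) :=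
  Submodule.span ℝ {v | ∃ j < k, v = iteratedDerivWithin j f I t}

theorem iteratedDerivWithin_mem_jetSpan {n : ℕ} (f : ℝ → Fin n → ℝ) (I : Set ℝ) (t : ℝ)
    {j k : ℕ} (h : j < k) : iteratedDerivWithin j f I t ∈ jetSpan f I t k :=
  Submodule.subset_span ⟨j, h, rfl⟩

theorem jetSpan_congr {n : ℕ} {f g : ℝ → Fin n → ℝ} {I : Set ℝ} {t : ℝ} (ht : t ∈ I)
    (h : f =ᶠ[𝓝[I] t] g) (k : ℕ) : jetSpan f I t k = jetSpan g I t k := by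
  unfold jetSpan
  simp only [h.iteratedDerivWithin_eq (h.self_of_nhdsWithin ht)]

theorem jetSpan_smul_le {n : ℕ} {h : ℝ → ℝ} {g : ℝ → Fin n → ℝ} {I : Set ℝ} {t : ℝ} (ht : t ∈ I)
    (hI : UniqueDiffOn ℝ I) (hh : ContDiffWithinAt ℝ ∞ h I t) (hg : ContDiffWithinAt ℝ ∞ g I t)
    (k : ℕ) : jetSpan (h • g) I t k ≤ jetSpan g I t k := by
  refine Submodule.span_le.mpr ?_
  rintro _ ⟨j, hj, rfl⟩
  rw [iteratedDerivWithin_smul ht hI (hh.of_le (mod_cast le_top)) (hg.of_le (mod_cast le_top))]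
  refine Submodule.sum_mem _ fun i hi => ?_
  exact Submodule.smul_of_tower_mem _ _ (Submodule.smul_mem _ _
    (iteratedDerivWithin_mem_jetSpan g I t (by omega)))

theorem iteratedDerivWithin_dual {n : ℕ} (φ : Module.Dual ℝ (Fin n → ℝ)) {f : ℝ → Fin n → ℝ}
    {I : Set ℝ} {t : ℝ} (ht : t ∈ I) (hI : UniqueDiffOn ℝ I) (hf : ContDiffWithinAt ℝ ∞ f I t)
    (j : ℕ) : iteratedDerivWithin j (fun s => φ (f s)) I t = φ (iteratedDerivWithin j f I t) := by
  have := (LinearMap.toContinuousLinearMap φ).iteratedFDerivWithin_comp_left (i := j)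
    (hf.of_le (mod_cast le_top : ((j : ℕ∞) : WithTop ℕ∞) ≤ ∞)) hI ht le_rfl
  have := congrArg (fun m => m (fun _ => (1 : ℝ))) this
  exact this

/-- The lift of a curve to the affine hyperplane `φ = 1`. -/
noncomputable def dualLift {n : ℕ} (c : ℝ → ProjSpace n) (φ : Module.Dual ℝ (Fin n → ℝ)) (s : ℝ) : Fin n → ℝ :=
  (φ (c s).rep)⁻¹ • (c s).rep

/-- The dot product with a vector as a functional. -/
def dotDual {n : ℕ} (p : Fin n → ℝ) : Module.Dual ℝ (Fin n → ℝ) where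
  toFun w := p ⬝ᵥ w
  map_add' := dotProduct_add p
  map_smul' a w := by simp

theorem dotDual_rep_ne_zero {n : ℕ} (c : ℝ → ProjSpace n) (t : ℝ) :
    dotDual (c t).rep (c t).rep ≠ 0 := by
  change (c t).rep ⬝ᵥ (c t).rep ≠ 0
  rw [Ne, dotProduct_self_eq_zero]
  exact (c t).rep_nonzero

theorem dual_contDiffWithinAt {n : ℕ} (φ : Module.Dual ℝ (Fin n → ℝ)) {f : ℝ → Fin n → ℝ}
    {I : Set ℝ} {t : ℝ} (hf : ContDiffWithinAt ℝ ∞ f I t) :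
    ContDiffWithinAt ℝ ∞ (fun s => φ (f s)) I t :=
  (LinearMap.toContinuousLinearMap φ).contDiff.comp_contDiffWithinAt hf

/-- Near `t` the two lifts differ by a smooth factor, so the Leibniz rule expresses the derivatives
of the new lift through those of the old of no higher order. -/
theorem dualLift_change {n : ℕ} {c : ℝ → ProjSpace n} {φ ψ : Module.Dual ℝ (Fin n → ℝ)}
    {I : Set ℝ} {t : ℝ} (hI : UniqueDiffOn ℝ I) (ht : t ∈ I) (hφ : φ (c t).rep ≠ 0)
    (hψ : ψ (c t).rep ≠ 0) (h : ContDiffWithinAt ℝ ∞ (dualLift c φ) I t) :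
    ContDiffWithinAt ℝ ∞ (dualLift c ψ) I t ∧
      ∀ k, jetSpan (dualLift c ψ) I t k ≤ jetSpan (dualLift c φ) I t k := by
  have h1 := dual_contDiffWithinAt ψ h
  have h0 : ψ (dualLift c φ t) ≠ 0 := by
    simp only [dualLift, map_smul, smul_eq_mul]
    exact mul_ne_zero (inv_ne_zero hφ) hψ
  have heq : dualLift c ψ =ᶠ[𝓝[I] t] (fun s => (ψ (dualLift c φ s))⁻¹) • dualLift c φ := by
    filter_upwards [h1.continuousWithinAt.eventually_ne h0] with s hs
    simp only [Pi.smul_apply']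
    have e : ψ (dualLift c φ s) = (φ (c s).rep)⁻¹ * ψ (c s).rep := by
      simp only [dualLift, map_smul, smul_eq_mul]
    rw [e] at hs ⊢
    have h2 := left_ne_zero_of_mul hs
    simp only [dualLift, smul_smul]
    rw [mul_inv_rev, mul_assoc, inv_mul_cancel₀ h2, mul_one]
  have h2 := h1.inv h0
  refine ⟨(h2.smul h).congr_of_eventuallyEq heq (heq.self_of_nhdsWithin ht), fun k => ?_⟩
  rw [jetSpan_congr ht heq]
  exact jetSpan_smul_le ht hI h2 h k

theorem dualLift_of_smooth {n : ℕ} {c : ℝ → ProjSpace n} {φ : Module.Dual ℝ (Fin n → ℝ)}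
    {I : Set ℝ} {t : ℝ} (hI : UniqueDiffOn ℝ I) (ht : t ∈ I) (h : SmoothCurveAt c I t)
    (hφ : φ (c t).rep ≠ 0) : ContDiffWithinAt ℝ ∞ (dualLift c φ) I t ∧
      ∀ k, jetSpan (dualLift c φ) I t k = osculatingSubspace c I t k := by
  -- `affineLift c t` is by definition the lift normalised by the dot product with the
  -- representative at `t`.
  obtain ⟨h1, h2⟩ := dualLift_change (ψ := φ) hI ht (dotDual_rep_ne_zero c t) hφ h
  obtain ⟨-, h4⟩ := dualLift_change (ψ := dotDual (c t).rep) hI ht hφ (dotDual_rep_ne_zero c t) h1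
  exact ⟨h1, fun k => le_antisymm (h2 k) (h4 k)⟩

theorem le_intersectionMult {n : ℕ} {c : ℝ → ProjSpace n} {φ : Module.Dual ℝ (Fin n → ℝ)}
    {I : Set ℝ} {t : ℝ} (hI : UniqueDiffOn ℝ I) (ht : t ∈ I) (h : SmoothCurveAt c I t) {k : ℕ}
    (hk : osculatingSubspace c I t k ≤ LinearMap.ker φ) :
    (k : ℕ∞) ≤ intersectionMult c I φ t := by
  refine le_iSup₂_of_le k (fun j hj => ?_) le_rfl
  rw [iteratedDerivWithin_dual φ ht hI h]
  exact hk (iteratedDerivWithin_mem_jetSpan _ I t hj)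

theorem IsConvexCurveOn.sum_le {n : ℕ} {γ : ℝ → ProjSpace n} {I : Set ℝ}
    (h : IsConvexCurveOn γ I) (hI : UniqueDiffOn ℝ I) {φ : Module.Dual ℝ (Fin n → ℝ)} (hφ : φ ≠ 0)
    (S : Finset ℝ) (hS : (S : Set ℝ) ⊆ I) (k : ℝ → ℕ)
    (hk : ∀ t ∈ S, osculatingSubspace γ I t (k t) ≤ LinearMap.ker φ) :
    ∑ t ∈ S, k t ≤ n - 1 := by
  have h1 := h.sum_mult_le φ hφ S hS
  have h2 : ∑ t ∈ S, (k t : ℕ∞) ≤ ∑ t ∈ S, intersectionMult γ I φ t :=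
    Finset.sum_le_sum fun t ht => le_intersectionMult hI (hS ht) (h.smooth t (hS ht)) (hk t ht)
  have := h2.trans h1
  exact_mod_cast this

/-- The jets `G` of a lift of a convex curve on an interval `J` open at its left end, and a jet `R`
of a lift of the curve at that end. -/
structure ConvexJet (n : ℕ) (J : Set ℝ) (G : ℕ → ℝ → Fin n → ℝ) (R : ℕ → Fin n → ℝ) : Prop where
  ordConnected : J.OrdConnected
  exists_lt : ∀ t ∈ J, ∃ s ∈ J, s < t
  hasDerivWithinAt : ∀ j, ∀ t ∈ J, HasDerivWithinAt (G j) (G (j + 1) t) J t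
  sum_le : ∀ φ : Module.Dual ℝ (Fin n → ℝ), φ ≠ 0 → ∀ k₀, (∀ j < k₀, φ (R j) = 0) →
    ∀ S : Finset ℝ, (S : Set ℝ) ⊆ J → ∀ k : ℝ → ℕ, (∀ t ∈ S, ∀ j < k t, φ (G j t) = 0) →
    k₀ + ∑ t ∈ S, k t ≤ n - 1

theorem uniqueDiffOn_of_ordConnected {I : Set ℝ} (hI : I.OrdConnected) (hnt : I.Nontrivial) :
    UniqueDiffOn ℝ I := by
  obtain ⟨a, ha, b, hb, hab⟩ := hnt.exists_lt
  exact uniqueDiffOn_convex hI.convex ⟨(a + b) / 2, by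
    rw [mem_interior_iff_mem_nhds]
    exact Filter.mem_of_superset (Icc_mem_nhds (by linarith) (by linarith)) (hI.out ha hb)⟩

theorem span_range_lt_le_iff {n : ℕ} {G : ℕ → Fin n → ℝ} {k : ℕ} {p : Submodule ℝ (Fin n → ℝ)} :
    Submodule.span ℝ {v | ∃ j < k, v = G j} ≤ p ↔ ∀ j < k, G j ∈ p := by
  rw [Submodule.span_le]
  constructor
  · exact fun h j hj => h ⟨j, hj, rfl⟩
  · rintro h _ ⟨j, hj, rfl⟩
    exact h j hj

theorem finrank_span_range_lt_le {n : ℕ} (G : ℕ → Fin n → ℝ) (k : ℕ) :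
    Module.finrank ℝ (Submodule.span ℝ {v | ∃ j < k, v = G j}) ≤ k := by
  classical
  have : {v | ∃ j < k, v = G j} = ((Finset.range k).image G : Set (Fin n → ℝ)) := by
    ext v; simp [eq_comm]
  rw [this]
  refine (finrank_span_finset_le_card _).trans (Finset.card_image_le.trans ?_)
  simp

/-- One affine chart contains the whole curve after `t₁`: a hyperplane through the first `n - 1` jet
vectors at `t₁` already has multiplicity `n - 1` there, so by convexity it meets the curve nowhere
else, and its functional normalises a lift. -/
theorem IsConvexCurveOn.exists_convexJet {n : ℕ} (hn : 1 ≤ n) {γ : ℝ → ProjSpace n} {I : Set ℝ}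
    (h : IsConvexCurveOn γ I) (hI : I.OrdConnected) (hnt : I.Nontrivial) {t₁ : ℝ} (ht₁ : t₁ ∈ I) :
    ∃ G R, ConvexJet n (I ∩ Set.Ioi t₁) G R ∧
      (∀ t ∈ I ∩ Set.Ioi t₁, ∀ k, osculatingSubspace γ I t k =
        Submodule.span ℝ {v | ∃ j < k, v = G j t}) ∧
      ∀ k, osculatingSubspace γ I t₁ k = Submodule.span ℝ {v | ∃ j < k, v = R j} := by
  have hU := uniqueDiffOn_of_ordConnected hI hnt
  set J := I ∩ Set.Ioi t₁ with hJ
  have hUJ : UniqueDiffOn ℝ J := hU.inter isOpen_Ioi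
  set R : ℕ → Fin n → ℝ := fun j => iteratedDerivWithin j (affineLift γ t₁) I t₁ with hR
  have hlt : Submodule.span ℝ {v | ∃ j < n - 1, v = R j} < ⊤ := by
    refine lt_top_iff_ne_top.mpr fun htop => ?_
    have := finrank_span_range_lt_le R (n - 1)
    rw [htop, finrank_top, Module.finrank_fin_fun] at this
    omega
  obtain ⟨φ₀, hφ₀, hle⟩ := Submodule.exists_le_ker_of_lt_top _ hlt
  have hne : ∀ t ∈ J, φ₀ (γ t).rep ≠ 0 := by
    intro t ht h0
    have hne : t₁ ≠ t := ne_of_lt ht.2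
    have := h.sum_le hU hφ₀ {t₁, t} (by
      intro s hs
      simp only [Finset.coe_insert, Finset.coe_singleton, Set.mem_insert_iff,
        Set.mem_singleton_iff] at hs
      rcases hs with rfl | rfl
      exacts [ht₁, ht.1]) (fun s => if s = t₁ then n - 1 else 1) ?_
    · rw [Finset.sum_pair hne] at this
      simp only [↓reduceIte, hne.symm] at this
      omega
    · intro s hs
      simp only [Finset.mem_insert, Finset.mem_singleton] at hs
      rcases hs with rfl | rfl
      · rw [if_pos rfl]
        exact hle
      · rw [if_neg hne.symm]
        refine span_range_lt_le_iff.mpr fun j hj => ?_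
        obtain rfl : j = 0 := by omega
        rw [iteratedDerivWithin_zero, LinearMap.mem_ker]
        simp only [affineLift, map_smul, h0, smul_zero]
  have hz : ∀ t ∈ J, ContDiffWithinAt ℝ ∞ (dualLift γ φ₀) I t ∧
      ∀ k, jetSpan (dualLift γ φ₀) I t k = osculatingSubspace γ I t k := fun t ht =>
    dualLift_of_smooth hU ht.1 (h.smooth t ht.1) (hne t ht)
  have hzJ : ContDiffOn ℝ ∞ (dualLift γ φ₀) J := fun t ht =>
    (hz t ht).1.mono Set.inter_subset_left
  have hIJ : ∀ t ∈ J, ∀ j, iteratedDerivWithin j (dualLift γ φ₀) J t =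
      iteratedDerivWithin j (dualLift γ φ₀) I t := by
    intro t ht j
    unfold iteratedDerivWithin
    rw [iteratedFDerivWithin_congr_set]
    rw [hJ]
    filter_upwards [isOpen_Ioi.mem_nhds ht.2] with s hs
    exact propext ⟨fun h => h.1, fun h => ⟨h, hs⟩⟩
  have hosc : ∀ t ∈ J, ∀ k, osculatingSubspace γ I t k =
      Submodule.span ℝ {v | ∃ j < k, v = iteratedDerivWithin j (dualLift γ φ₀) J t} := by
    intro t ht k
    rw [← (hz t ht).2 k]
    simp only [jetSpan, hIJ t ht]
  refine ⟨fun j t => iteratedDerivWithin j (dualLift γ φ₀) J t, R,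
    ⟨hI.inter Set.ordConnected_Ioi, ?_, ?_, ?_⟩, hosc, fun k => rfl⟩
  · intro t ht
    obtain ⟨s, hs1, hs2⟩ := exists_between (show t₁ < t from ht.2)
    exact ⟨s, ⟨hI.out ht₁ ht.1 ⟨hs1.le, hs2.le⟩, hs1⟩, hs2⟩
  · intro j t ht
    have := (hzJ.differentiableOn_iteratedDerivWithin (m := j)
      (mod_cast (WithTop.coe_lt_top j)) hUJ t ht).hasDerivWithinAt
    rwa [← iteratedDerivWithin_succ] at this
  · intro φ hφ k₀ hk₀ S hS k hk
    have ht₁S : t₁ ∉ S := fun hmem => lt_irrefl t₁ (hS hmem).2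
    have := h.sum_le hU hφ (insert t₁ S) (by
      rw [Finset.coe_insert]
      exact Set.insert_subset ht₁ (hS.trans Set.inter_subset_left))
      (fun s => if s = t₁ then k₀ else k s) ?_
    · rw [Finset.sum_insert ht₁S, if_pos rfl, Finset.sum_congr rfl fun s hs =>
        if_neg (fun h : s = t₁ => ht₁S (h ▸ hs))] at this
      exact this
    · intro s hs
      rcases Finset.mem_insert.mp hs with rfl | hs
      · rw [if_pos rfl]
        exact span_range_lt_le_iff.mpr hk₀
      · rw [if_neg (fun h : s = t₁ => ht₁S (h ▸ hs)), hosc s (hS hs)]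
        exact span_range_lt_le_iff.mpr (hk s hs)

theorem encard_le_of_finset {α : Type*} {Z : Set α} {c : ℕ}
    (h : ∀ S : Finset α, (S : Set α) ⊆ Z → S.card ≤ c) : Z.encard ≤ c := by
  by_contra hcon
  obtain ⟨S, hS, hcard⟩ := Set.exists_subset_encard_eq (s := Z) (k := ((c + 1 : ℕ) : ℕ∞))
    (by push_cast; exact Order.add_one_le_of_lt (not_le.mp hcon))
  have hfin : S.Finite := Set.finite_of_encard_eq_coe hcard
  have := h hfin.toFinset (by simpa using hS)
  rw [hfin.encard_eq_coe_toFinset_card] at hcard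
  have : hfin.toFinset.card = c + 1 := by exact_mod_cast hcard
  omega

/-- The smallest element of a finite part plays the role of the first meeting `t₁` in all bounds
below. -/
theorem encard_le_add_one {Z : Set ℝ} {c : ℕ}
    (h : ∀ t ∈ Z, (Z ∩ Set.Ioi t).encard ≤ c) : Z.encard ≤ ((c + 1 : ℕ) : ℕ∞) := by
  refine encard_le_of_finset fun S hS => ?_
  rcases S.eq_empty_or_nonempty with rfl | hne
  · simp
  · have hmin := S.min'_mem hne
    have hsub : ((S.erase (S.min' hne) : Finset ℝ) : Set ℝ) ⊆ Z ∩ Set.Ioi (S.min' hne) := by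
      intro s hs
      have hs' := Finset.mem_erase.mp (Finset.mem_coe.mp hs)
      exact ⟨hS hs'.2, lt_of_le_of_ne (S.min'_le s hs'.2) hs'.1.symm⟩
    have h1 := (Set.encard_le_encard hsub).trans (h _ (hS hmin))
    rw [Set.encard_coe_eq_coe_finsetCard, Finset.card_erase_of_mem hmin] at h1
    have : S.card - 1 ≤ c := by exact_mod_cast h1
    omega

theorem mem_span_range_lt {n : ℕ} {G : ℕ → Fin n → ℝ} {k : ℕ} {w : Fin n → ℝ}
    (h : w ∈ Submodule.span ℝ {v | ∃ j < k, v = G j}) :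
    ∃ c : ℕ → ℝ, w = ∑ j ∈ Finset.range k, c j • G j := by
  induction h using Submodule.span_induction with
  | mem x hx =>
    obtain ⟨j, hj, rfl⟩ := hx
    exact ⟨fun i => if i = j then 1 else 0, by simp [hj]⟩
  | zero => exact ⟨0, by simp⟩
  | add x y _ _ hx hy =>
    obtain ⟨c, rfl⟩ := hx
    obtain ⟨d, rfl⟩ := hy
    exact ⟨c + d, by simp [add_smul, Finset.sum_add_distrib]⟩
  | smul a x _ hx =>
    obtain ⟨c, rfl⟩ := hx
    exact ⟨a • c, by simp [Finset.smul_sum, smul_smul]⟩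

/-- The coordinates with respect to a family of vectors that no nonzero functional kills. -/
theorem exists_coords {n : ℕ} {v : ℕ → Fin n → ℝ}
    (hv : ∀ φ : Module.Dual ℝ (Fin n → ℝ), φ ≠ 0 → ∃ i < n, φ (v i) ≠ 0) :
    ∃ φ : ℕ → Module.Dual ℝ (Fin n → ℝ),
      (∀ i < n, ∀ j < n, φ i (v j) = if i = j then 1 else 0) ∧
      ∀ w, w = ∑ i ∈ Finset.range n, φ i w • v i := by
  have htop : ⊤ ≤ Submodule.span ℝ (Set.range fun i : Fin n => v i) := by
    by_contra hlt
    obtain ⟨φ, hφ, hle⟩ := Submodule.exists_le_ker_of_lt_top _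
      (lt_top_iff_ne_top.mpr fun h => hlt h.ge)
    obtain ⟨i, hi, hne⟩ := hv φ hφ
    exact hne (hle (Submodule.subset_span ⟨⟨i, hi⟩, rfl⟩))
  have hli := linearIndependent_of_top_le_span_of_card_eq_finrank htop (by simp)
  let b := Module.Basis.mk hli htop
  refine ⟨fun i => if h : i < n then b.coord ⟨i, h⟩ else 0, fun i hi j hj => ?_, fun w => ?_⟩
  · have : v j = b ⟨j, hj⟩ := by simp [b]
    rw [this]
    dsimp only
    rw [dif_pos hi, Module.Basis.coord_apply, Module.Basis.repr_self, Finsupp.single_apply]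
    simp [Fin.ext_iff, eq_comm]
  · conv_lhs => rw [← b.sum_repr w]
    rw [Finset.sum_range]
    refine Finset.sum_congr rfl fun i _ => ?_
    simp [b]

theorem exists_dual_of_finrank_lt {n : ℕ} {p : Submodule ℝ (Fin n → ℝ)}
    (h : Module.finrank ℝ p < n) : ∃ φ : Module.Dual ℝ (Fin n → ℝ), φ ≠ 0 ∧ ∀ w ∈ p, φ w = 0 := by
  obtain ⟨φ, h1, h2⟩ := p.exists_le_ker_of_lt_top (lt_top_iff_ne_top.mpr fun htop => by
    rw [htop, finrank_top, Module.finrank_fin_fun] at h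
    exact lt_irrefl _ h)
  exact ⟨φ, h1, fun w hw => h2 hw⟩

theorem finrank_sup_lt {n : ℕ} {p q : Submodule ℝ (Fin n → ℝ)} (h : p ⊓ q ≠ ⊥) :
    Module.finrank ℝ ↑(p ⊔ q) < Module.finrank ℝ p + Module.finrank ℝ q := by
  have h1 := Submodule.finrank_sup_add_finrank_inf_eq p q
  have h2 := Submodule.one_le_finrank_iff.mpr h
  omega

theorem HasDerivWithinAt.dual {n : ℕ} (φ : Module.Dual ℝ (Fin n → ℝ)) {f : ℝ → Fin n → ℝ}
    {f' : Fin n → ℝ} {J : Set ℝ} {t : ℝ} (h : HasDerivWithinAt f f' J t) :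
    HasDerivWithinAt (fun s => φ (f s)) (φ f') J t :=
  (LinearMap.toContinuousLinearMap φ).hasFDerivAt.comp_hasDerivWithinAt t h

section

variable {n : ℕ} {J : Set ℝ} {G : ℕ → ℝ → Fin n → ℝ} {R : ℕ → Fin n → ℝ}

theorem ConvexJet.exists_apply_ne_zero (h : ConvexJet n J G R) (hn : 1 ≤ n)
    {φ : Module.Dual ℝ (Fin n → ℝ)} (hφ : φ ≠ 0) : ∃ i < n, φ (R i) ≠ 0 := by
  by_contra hcon
  push Not at hcon
  have := h.sum_le φ hφ n hcon ∅ (by simp) 0 (by simp)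
  simp at this
  omega

/-- The coordinates of the lift in the basis dual to the reversed jet at the left end form a
Chebyshev system. -/
theorem ConvexJet.isChebyshevOn (h : ConvexJet n J G R) (hn : 2 ≤ n)
    {φ : ℕ → Module.Dual ℝ (Fin n → ℝ)}
    (hφ : ∀ i < n, ∀ j < n, φ i (R j) = if i = j then 1 else 0) :
    IsChebyshevOn n (fun i t => φ (n - 1 - i) (G 0 t)) (fun i t => φ (n - 1 - i) (G 1 t)) J := by
  refine ⟨h.ordConnected, h.exists_lt, fun i hi t ht => (h.hasDerivWithinAt 0 t ht).dual _,
    fun i hi t ht => ((h.hasDerivWithinAt 1 t ht).dual _).continuousWithinAt, ?_, ?_⟩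
  · intro k hk x hx hxJ hdet
    obtain ⟨v, hv, hv0⟩ := Matrix.exists_vecMul_eq_zero_iff.mpr hdet
    set ψ : Module.Dual ℝ (Fin n → ℝ) := ∑ i : Fin k, v i • φ (n - 1 - i) with hψ
    have hψR : ∀ j < n, ψ (R j) = ∑ i : Fin k, v i * if n - 1 - i = j then 1 else 0 := by
      intro j hj
      simp only [hψ, LinearMap.sum_apply, LinearMap.smul_apply, smul_eq_mul]
      exact Finset.sum_congr rfl fun i _ => by rw [hφ _ (by omega) j hj]
    have hψ0 : ψ ≠ 0 := by
      obtain ⟨i, hi⟩ := Function.ne_iff.mp hv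
      intro h0
      have := hψR (n - 1 - i) (by omega)
      rw [h0, LinearMap.zero_apply, Finset.sum_eq_single i, if_pos rfl, mul_one] at this
      · exact hi this.symm
      · intro j _ hji
        rw [if_neg, mul_zero]
        intro h
        exact hji (Fin.ext (by omega))
      · simp
    -- The first `k` functions are dual to the last `k` jet vectors, so `ψ` vanishes on the first `n
    -- - k` of these; with `k` further zeros the total multiplicity would be `n`.
    have := h.sum_le ψ hψ0 (n - k) (fun j hj => by
      rw [hψR j (by omega)]
      refine Finset.sum_eq_zero fun i _ => ?_
      rw [if_neg (by omega), mul_zero]) (Finset.univ.image x) (by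
        intro t ht
        simp only [Finset.coe_image, Finset.coe_univ, Set.image_univ, Set.mem_range] at ht
        obtain ⟨i, rfl⟩ := ht
        exact hxJ i) (fun _ => 1) (by
        intro t ht j hj
        obtain rfl : j = 0 := by omega
        obtain ⟨i, _, rfl⟩ := Finset.mem_image.mp ht
        have := congrFun hv0 i
        simpa [Matrix.vecMul, dotProduct, hψ, LinearMap.sum_apply] using this)
    rw [Finset.sum_const, Finset.card_image_of_injective _ hx.injective, Finset.card_univ,
      Fintype.card_fin, smul_eq_mul, mul_one] at this
    omega
  · intro t ht h0
    have key : ∀ α β : ℝ, α * φ (n - 1) (G 0 t) + β * φ (n - 1 - 1) (G 0 t) = 0 →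
        α * φ (n - 1) (G 1 t) + β * φ (n - 1 - 1) (G 1 t) = 0 → α = 0 ∧ β = 0 := by
      intro α β h1 h2
      by_contra hαβ
      set ψ : Module.Dual ℝ (Fin n → ℝ) := α • φ (n - 1) + β • φ (n - 1 - 1) with hψ
      have hψR : ∀ j < n, ψ (R j) =
          α * (if n - 1 = j then 1 else 0) + β * if n - 1 - 1 = j then 1 else 0 := by
        intro j hj
        simp only [hψ, LinearMap.add_apply, LinearMap.smul_apply, smul_eq_mul]
        rw [hφ _ (by omega) j hj, hφ _ (by omega) j hj]
      have hψ0 : ψ ≠ 0 := by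
        intro h0
        have e1 := hψR (n - 1) (by omega)
        have e2 := hψR (n - 1 - 1) (by omega)
        rw [h0, LinearMap.zero_apply, if_pos rfl, if_neg (by omega)] at e1
        rw [h0, LinearMap.zero_apply, if_pos rfl, if_neg (by omega)] at e2
        exact hαβ ⟨by linarith, by linarith⟩
      have := h.sum_le ψ hψ0 (n - 2) (fun j hj => by
        rw [hψR j (by omega), if_neg (by omega), if_neg (by omega)]; simp) {t} (by simpa using ht)
        (fun _ => 2) (by
          intro s hs j hj
          obtain rfl := Finset.mem_singleton.mp hs
          simp only [hψ, LinearMap.add_apply, LinearMap.smul_apply, smul_eq_mul]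
          interval_cases j
          · exact h1
          · exact h2)
      simp at this
      omega
    simp only [Nat.sub_zero] at h0
    have k1 := key (φ (n - 1 - 1) (G 0 t)) (-φ (n - 1) (G 0 t)) (by ring) (by linarith)
    have k2 := key (φ (n - 1 - 1) (G 1 t)) (-φ (n - 1) (G 1 t)) (by linarith) (by ring)
    have := key 1 0 (by linarith [k1.2]) (by linarith [k2.2])
    exact one_ne_zero this.1

end

/-- The annihilator of a subspace of corank at least two contains a functional independent of a
given one. -/
theorem exists_second_dual {n : ℕ} {p : Submodule ℝ (Fin n → ℝ)}
    (h : Module.finrank ℝ p + 1 < n) {φ : Module.Dual ℝ (Fin n → ℝ)} (hφ : φ ≠ 0) :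
    ∃ ψ : Module.Dual ℝ (Fin n → ℝ), (∀ w ∈ p, ψ w = 0) ∧
      ∀ α β : ℝ, α • φ + β • ψ = 0 → α = 0 ∧ β = 0 := by
  obtain ⟨w, hw⟩ : ∃ w, φ w ≠ 0 := by
    by_contra hcon
    push Not at hcon
    exact hφ (LinearMap.ext hcon)
  have h1 := Submodule.finrank_add_le_finrank_add_finrank p (ℝ ∙ w)
  have h2 := finrank_span_le_card (R := ℝ) ({w} : Set (Fin n → ℝ))
  simp only [Set.toFinset_singleton, Finset.card_singleton] at h2
  obtain ⟨ψ, hψ, hψ0⟩ := exists_dual_of_finrank_lt (p := p ⊔ ℝ ∙ w) (by omega)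
  refine ⟨ψ, fun v hv => hψ0 v (Submodule.mem_sup_left hv), fun α β h => ?_⟩
  have e := LinearMap.congr_fun h w
  simp only [LinearMap.add_apply, LinearMap.smul_apply, smul_eq_mul, LinearMap.zero_apply,
    hψ0 w (Submodule.mem_sup_right (Submodule.mem_span_singleton_self w)), mul_zero,
    add_zero] at e
  have hα : α = 0 := (mul_eq_zero.mp e).resolve_right hw
  refine ⟨hα, ?_⟩
  rw [hα, zero_smul, zero_add] at h
  exact (smul_eq_zero.mp h).resolve_right hψ

theorem pencilVec_eq_of_expansion {r : ℕ} {E : Type*} [AddCommGroup E] [Module ℝ E]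
    {u : ℕ → E} {b : ℕ → ℝ} {w : E} (hw : w = ∑ i ∈ Finset.range (r + 3), b i • u i)
    (f g : E →ₗ[ℝ] ℝ) (h1 : f (u (r + 1)) = 0) (h2 : f (u (r + 2)) = 0) :
    pencilVec r (fun i => f (u i)) (fun i => g (u i)) b = (f w, g w) := by
  subst hw
  unfold pencilVec
  simp only [map_sum, map_smul, smul_eq_mul]
  rw [Finset.sum_range_succ (fun i => b i * f (u i)) (r + 2),
    Finset.sum_range_succ (fun i => b i * f (u i)) (r + 1), h1, h2, mul_zero, mul_zero,
    add_zero, add_zero, Prod.mk.injEq]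
  exact ⟨Finset.sum_congr rfl fun i _ => mul_comm _ _, Finset.sum_congr rfl fun i _ => mul_comm _ _⟩

theorem planeDet_eq_zero_of_combination {u v : ℝ × ℝ} {a b : ℝ} (hab : ¬ (a = 0 ∧ b = 0))
    (h1 : a * u.1 + b * v.1 = 0) (h2 : a * u.2 + b * v.2 = 0) : planeDet u v = 0 := by
  by_contra hne
  unfold planeDet at hne
  apply hab
  constructor
  · have : a * (u.1 * v.2 - u.2 * v.1) = 0 := by linear_combination v.2 * h1 - v.1 * h2
    exact (mul_eq_zero.mp this).resolve_right hne
  · have : b * (u.1 * v.2 - u.2 * v.1) = 0 := by linear_combination u.1 * h2 - u.2 * h1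
    exact (mul_eq_zero.mp this).resolve_right hne

/-! ### Meetings of points and tangents of the curve -/

/-- The moments at which the `k`-dimensional member of the osculating flag meets `V`. -/
def meetingSet {n : ℕ} (γ : ℝ → ProjSpace n) (I : Set ℝ) (k : ℕ) (V : Submodule ℝ (Fin n → ℝ)) :
    Set ℝ := {t ∈ I | osculatingSubspace γ I t k ⊓ V ≠ ⊥}

theorem encard_meetingSet_one_le {n : ℕ} (hn : 1 ≤ n) {γ : ℝ → ProjSpace n} {I : Set ℝ}
    (h : IsConvexCurveOn γ I) (hI : I.OrdConnected) (hnt : I.Nontrivial)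
    {V : Submodule ℝ (Fin n → ℝ)} (hV : Module.finrank ℝ V = n - 1) :
    (meetingSet γ I 1 V).encard ≤ ((n - 1 : ℕ) : ℕ∞) := by
  obtain ⟨φ, hφ, hφV⟩ := exists_dual_of_finrank_lt (p := V) (by omega)
  refine encard_le_of_finset fun S hS => ?_
  have := h.sum_le (uniqueDiffOn_of_ordConnected hI hnt) hφ S (fun t ht => (hS ht).1) (fun _ => 1) ?_
  · simpa using this
  · intro t ht
    obtain ⟨w, hw, hw0⟩ := Submodule.exists_mem_ne_zero_of_ne_bot (hS ht).2
    obtain ⟨hw1, hw2⟩ := Submodule.mem_inf.mp hw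
    refine span_range_lt_le_iff.mpr fun j hj => ?_
    obtain rfl : j = 0 := by omega
    obtain ⟨c, hc⟩ := mem_span_range_lt (G := fun j => iteratedDerivWithin j (affineLift γ t) I t) hw1
    rw [Finset.sum_range_one] at hc
    have e := hφV w hw2
    rw [hc, map_smul, smul_eq_mul] at e
    refine (mul_eq_zero.mp e).resolve_left fun h0 => hw0 ?_
    rw [hc, h0, zero_smul]

theorem encard_meetingSet_two_le {r : ℕ} {γ : ℝ → ProjSpace (r + 3)} {I : Set ℝ}
    (h : IsConvexCurveOn γ I) (hI : I.OrdConnected) (hnt : I.Nontrivial)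
    {V : Submodule ℝ (Fin (r + 3) → ℝ)} (hV : Module.finrank ℝ V = r + 1) :
    (meetingSet γ I 2 V).encard ≤ ((2 * r + 1 + 1 : ℕ) : ℕ∞) := by
  refine encard_le_add_one fun t₁ ht₁ => ?_
  obtain ⟨G, R, hJ, hG, hR⟩ := h.exists_convexJet (by omega) hI hnt ht₁.1
  obtain ⟨φ, hφ, hexp⟩ := exists_coords fun φ hφ => hJ.exists_apply_ne_zero (by omega) hφ
  have hch := hJ.isChebyshevOn (by omega) hφ
  have hR2 := hR 2
  have hne := ht₁.2
  rw [hR2] at hne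
  have hlt := finrank_sup_lt hne
  have hle := finrank_span_range_lt_le R 2
  -- Because of the meeting at `t₁` the sum of the two subspaces has dimension at most `2 + (r + 1)
  -- - 1`, so it is proper. In reversed order, the two jet vectors killed by `g₁` carry the last two
  -- coordinates, which gives the shape of `pencilVec`.
  obtain ⟨g₁, hg₁, hg₁V⟩ := exists_dual_of_finrank_lt (p := Submodule.span ℝ {v | ∃ j < 2, v = R j} ⊔ V)
    (by omega)
  obtain ⟨g₂, hg₂V, hind⟩ := exists_second_dual (p := V) (by omega) hg₁
  have hg₁R : ∀ j < 2, g₁ (R j) = 0 := fun j hj =>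
    hg₁V _ (Submodule.mem_sup_left (Submodule.subset_span ⟨j, hj, rfl⟩))
  have hvec : ∀ w, pencilVec r (fun i => g₁ (R (r + 3 - 1 - i))) (fun i => g₂ (R (r + 3 - 1 - i)))
      (fun i => φ (r + 3 - 1 - i) w) = (g₁ w, g₂ w) := by
    intro w
    refine pencilVec_eq_of_expansion (u := fun i => R (r + 3 - 1 - i)) ?_ g₁ g₂
      (hg₁R _ (by omega)) (hg₁R _ (by omega))
    conv_lhs => rw [hexp w]
    rw [← Finset.sum_range_reflect]
  have hpen : IndepPencil r (fun i => g₁ (R (r + 3 - 1 - i))) (fun i => g₂ (R (r + 3 - 1 - i))) := by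
    intro α β hαβ
    refine hind α β ?_
    by_contra hne
    obtain ⟨j, hj, hne⟩ := hJ.exists_apply_ne_zero (by omega) hne
    apply hne
    have := hαβ (r + 3 - 1 - j) (by omega)
    dsimp only at this
    rw [show r + 3 - 1 - (r + 3 - 1 - j) = j by omega] at this
    rw [LinearMap.add_apply, LinearMap.smul_apply, LinearMap.smul_apply, smul_eq_mul, smul_eq_mul,
      ← this]
    split_ifs with hi
    · rfl
    · rw [hg₁R j (by omega)]
  refine (Set.encard_le_encard ?_).trans (encard_pencilWronskian_zeros_le hch hpen)
  rintro t ⟨⟨htI, ht⟩, htt⟩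
  refine ⟨⟨htI, htt⟩, ?_⟩
  unfold pencilWronskian
  rw [hvec, hvec]
  obtain ⟨w, hw, hw0⟩ := Submodule.exists_mem_ne_zero_of_ne_bot ht
  obtain ⟨hw1, hw2⟩ := Submodule.mem_inf.mp hw
  rw [hG t ⟨htI, htt⟩] at hw1
  obtain ⟨c, hc⟩ := mem_span_range_lt (G := fun j => G j t) hw1
  rw [Finset.sum_range_succ, Finset.sum_range_one] at hc
  have e1 := hg₁V w (Submodule.mem_sup_right hw2)
  have e2 := hg₂V w hw2
  rw [hc, map_add, map_smul, map_smul, smul_eq_mul, smul_eq_mul] at e1 e2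
  refine planeDet_eq_zero_of_combination (a := c 0) (b := c 1) ?_ e1 e2
  rintro ⟨h0, h1⟩
  apply hw0
  rw [hc, h0, h1]
  simp

/-! ### Mixed determinants and osculating hyperplanes -/

/-- The determinant of the matrix with the given rows. -/
def rowDet {n : ℕ} (v : Fin n → Fin n → ℝ) : ℝ := Matrix.det (Matrix.of v)

theorem rowDet_eq_zero_of_eq {n : ℕ} {v : Fin n → Fin n → ℝ} {i j : Fin n} (h : v i = v j)
    (hij : i ≠ j) : rowDet v = 0 := Matrix.det_zero_of_row_eq hij h

/-- The determinant as a functional of its `i`-th row. -/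
def rowFunctional {n : ℕ} (v : Fin n → Fin n → ℝ) (i : Fin n) : Module.Dual ℝ (Fin n → ℝ) :=
  (Matrix.detRowAlternating (R := ℝ) (n := Fin n)).toMultilinearMap.toLinearMap v i

theorem rowFunctional_apply {n : ℕ} (v : Fin n → Fin n → ℝ) (i : Fin n) (x : Fin n → ℝ) :
    rowFunctional v i x = rowDet (Function.update v i x) := rfl

theorem rowDet_eq_zero_iff {n : ℕ} {v : Fin n → Fin n → ℝ} :
    rowDet v = 0 ↔ ∃ φ : Module.Dual ℝ (Fin n → ℝ), φ ≠ 0 ∧ ∀ i, φ (v i) = 0 := by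
  unfold rowDet
  rw [← Matrix.exists_mulVec_eq_zero_iff]
  constructor
  · rintro ⟨x, hx, h⟩
    refine ⟨dotDual x, fun h0 => hx ?_, fun i => ?_⟩
    · exact dotProduct_self_eq_zero.mp (LinearMap.congr_fun h0 x)
    · have := congrFun h i
      exact (dotProduct_comm _ _).trans this
  · rintro ⟨φ, hφ, h⟩
    have hφ' : ∀ w, φ w = ∑ i, w i * φ (Pi.single i 1) := by
      intro w
      conv_lhs => rw [pi_eq_sum_univ' w]
      simp [map_sum]
    refine ⟨fun i => φ (Pi.single i 1), fun h0 => hφ (LinearMap.ext fun w => ?_), ?_⟩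
    · rw [hφ']
      simp [fun i => congrFun h0 i]
    · ext i
      have := h i
      rw [hφ'] at this
      exact this

theorem rowDet_smul_eq_sum {n : ℕ} (v : Fin n → Fin n → ℝ) (x : Fin n → ℝ) :
    rowDet v • x = ∑ i, rowDet (Function.update v i x) • v i := by
  have h := Matrix.mulVec_cramer (Matrix.of v).transpose x
  rw [Matrix.det_transpose] at h
  rw [rowDet, ← h]
  ext j
  simp only [Matrix.mulVec, dotProduct, Matrix.transpose_apply, Matrix.cramer_transpose_apply,
    Finset.sum_apply, Pi.smul_apply, smul_eq_mul, Matrix.of_apply]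
  exact Finset.sum_congr rfl fun i _ => mul_comm _ _

/-- The determinant as a function of two of its rows. -/
def pairDet {n : ℕ} (v : Fin n → Fin n → ℝ) (p q : Fin n) (x y : Fin n → ℝ) : ℝ :=
  rowDet (Function.update (Function.update v p x) q y)

theorem pairDet_swap {n : ℕ} (v : Fin n → Fin n → ℝ) {p q : Fin n} (hpq : p ≠ q)
    (x y : Fin n → ℝ) : pairDet v p q y x = -pairDet v p q x y := by
  have h : rowDet (Function.update (Function.update v p x) q y ∘ Equiv.swap p q) =
      -rowDet (Function.update (Function.update v p x) q y) :=
    (Matrix.detRowAlternating (R := ℝ) (n := Fin n)).map_swap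
      (Function.update (Function.update v p x) q y) hpq
  unfold pairDet
  rw [← h]
  congr 1
  funext i
  simp only [Function.comp_apply, Function.update_apply]
  by_cases h1 : i = p
  · subst h1; simp [hpq]
  · by_cases h2 : i = q
    · subst h2; simp [hpq]
    · simp [h1, h2, Equiv.swap_apply_of_ne_of_ne]

/-- Cramer's rule expands `c` in rows containing `a` and `b`; applying the determinant with `d` as
its other free row kills the terms of the common rows, which would occur twice. -/
theorem pairDet_plucker {n : ℕ} (v : Fin n → Fin n → ℝ) {p q : Fin n} (hpq : p ≠ q)
    (a b c d : Fin n → ℝ) : pairDet v p q a b * pairDet v p q c d -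
      pairDet v p q a c * pairDet v p q b d + pairDet v p q a d * pairDet v p q b c = 0 := by
  set M := Function.update (Function.update v p a) q b with hM
  have h := congrArg (rowFunctional (Function.update v q d) p) (rowDet_smul_eq_sum M c)
  have hF : ∀ x, rowFunctional (Function.update v q d) p x = pairDet v p q x d := by
    intro x
    rw [rowFunctional_apply, pairDet, Function.update_comm hpq]
  simp only [map_smul, map_sum, smul_eq_mul] at h
  simp only [hF] at h
  rw [Finset.sum_eq_add_of_mem p q (Finset.mem_univ _) (Finset.mem_univ _) hpq] at h
  · have e1 : M p = a := by simp [hM, hpq]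
    have e2 : M q = b := by simp [hM]
    have e3 : rowDet (Function.update M p c) = pairDet v p q c b := by
      rw [hM, Function.update_comm hpq, Function.update_idem, pairDet, Function.update_comm hpq.symm]
    have e4 : rowDet (Function.update M q c) = pairDet v p q a c := by
      rw [hM, Function.update_idem, pairDet]
    have e5 : rowDet M = pairDet v p q a b := rfl
    rw [e1, e2, e3, e4, e5, pairDet_swap v hpq b c] at h
    linear_combination h
  · intro i _ hi
    have e : M i = v i := by simp [hM, hi.1, hi.2]
    have e' : pairDet v p q (v i) d = 0 :=
      rowDet_eq_zero_of_eq (i := i) (j := p) (by simp [hi.1, hi.2, hpq]) hi.1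
    rw [e, e', mul_zero]

theorem hasDerivWithinAt_rowDet {n : ℕ} {v : ℝ → Fin n → Fin n → ℝ} {v' : Fin n → Fin n → ℝ}
    {J : Set ℝ} {t : ℝ} (h : ∀ i, HasDerivWithinAt (fun t => v t i) (v' i) J t) :
    HasDerivWithinAt (fun t => rowDet (v t))
      (∑ i, rowDet (Function.update (v t) i (v' i))) J t := by
  let D : ContinuousMultilinearMap ℝ (fun _ : Fin n => Fin n → ℝ) ℝ :=
    ⟨(Matrix.detRowAlternating (R := ℝ) (n := Fin n)).toMultilinearMap,
      Continuous.matrix_det continuous_id⟩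
  have := (HasFDerivWithinAt.multilinear_comp D fun i => (h i).hasFDerivWithinAt).hasDerivWithinAt
  refine this.congr_deriv ?_
  simp [D]
  rfl

theorem encard_zeros_le_of_deriv {J : Set ℝ} (hJ : J.OrdConnected) {f f' : ℝ → ℝ}
    (h : ∀ t ∈ J, HasDerivWithinAt f (f' t) J t) {c : ℕ}
    (hc : {t ∈ J | f' t = 0}.encard ≤ c) : {t ∈ J | f t = 0}.encard ≤ ((c + 1 : ℕ) : ℕ∞) := by
  refine encard_le_of_finset fun S hS => ?_
  have hfin : {t ∈ J | f' t = 0}.Finite := Set.finite_of_encard_le_coe hc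
  rw [hfin.encard_eq_coe_toFinset_card] at hc
  have hc' : hfin.toFinset.card ≤ c := by exact_mod_cast hc
  refine le_trans (Finset.card_le_of_interleaved (t := hfin.toFinset) ?_) (Nat.succ_le_succ hc')
  intro x hx y hy hxy _
  have hsub : Set.Icc x y ⊆ J := hJ.out (hS hx).1 (hS hy).1
  obtain ⟨z, hz, hz0⟩ := exists_hasDerivAt_eq_zero hxy
    (fun t ht => (h t (hsub ht)).continuousWithinAt.mono hsub)
    ((hS hx).2.trans (hS hy).2.symm)
    (fun t ht => (h t (hsub (Set.Ioo_subset_Icc_self ht))).hasDerivAt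
      (Filter.mem_of_superset (Icc_mem_nhds ht.1 ht.2) hsub))
  exact ⟨z, hfin.mem_toFinset.mpr ⟨hsub (Set.Ioo_subset_Icc_self hz), hz0⟩, hz.1, hz.2⟩

section

variable {m : ℕ} {J : Set ℝ} {G : ℕ → ℝ → Fin (m + 2) → ℝ} {R : ℕ → Fin (m + 2) → ℝ}

/-- The vectors `G₀(t), …, G_{m-k}(t), R₀, …, R_{k-1}, v`. -/
def mixedRows (G : ℕ → ℝ → Fin (m + 2) → ℝ) (R : ℕ → Fin (m + 2) → ℝ) (k : ℕ) (t : ℝ)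
    (v : Fin (m + 2) → ℝ) : Fin (m + 2) → Fin (m + 2) → ℝ := fun i =>
  if (i : ℕ) ≤ m then (if (i : ℕ) + k ≤ m then G i t else R (i + k - (m + 1))) else v

/-- The position of the last of the vectors `G` among the mixed rows. -/
def lastJet (m k : ℕ) : Fin (m + 2) := ⟨m - k, by omega⟩

theorem lastJet_ne_last (m k : ℕ) : lastJet m k ≠ Fin.last (m + 1) := by
  simp only [lastJet, ne_eq, Fin.ext_iff, Fin.val_last]; omega

theorem pairDet_mixedRows {k : ℕ} (hk : k ≤ m) (t : ℝ) (u v : Fin (m + 2) → ℝ) :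
    pairDet (mixedRows G R k t u) (lastJet m k) (Fin.last _) (G (m - k) t) v =
      rowDet (mixedRows G R k t v) := by
  unfold pairDet
  congr 1
  funext i
  simp only [Function.update_apply, mixedRows, lastJet, Fin.ext_iff, Fin.val_last]
  by_cases h1 : (i : ℕ) = m + 1
  · simp [h1]
  · have : (i : ℕ) ≤ m := by have := i.2; omega
    by_cases h2 : (i : ℕ) = m - k
    · rw [if_neg h1, if_pos h2, if_pos this, if_pos (by omega), h2]
    · simp [h1, h2, this]

/-- Differentiating any jet row but the last one duplicates the following row, so a single term of
the product rule survives. -/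
theorem hasDerivWithinAt_mixedRows (h : ConvexJet (m + 2) J G R) {k : ℕ} (hk : k ≤ m) {t : ℝ}
    (ht : t ∈ J) (u v : Fin (m + 2) → ℝ) :
    HasDerivWithinAt (fun t => rowDet (mixedRows G R k t v))
      (pairDet (mixedRows G R k t u) (lastJet m k) (Fin.last _) (G (m - k + 1) t) v) J t := by
  have := hasDerivWithinAt_rowDet (v := fun t => mixedRows G R k t v) (J := J) (t := t)
    (v' := fun i => if (i : ℕ) ≤ m then (if (i : ℕ) + k ≤ m then G (i + 1) t else 0) else 0) ?_
  · refine this.congr_deriv ?_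
    rw [Finset.sum_eq_single (lastJet m k)]
    · have e0 : ((lastJet m k : Fin (m + 2)) : ℕ) = m - k := rfl
      rw [if_pos (by omega), if_pos (by omega), e0]
      unfold pairDet
      congr 1
      funext i
      simp only [Function.update_apply, mixedRows, Fin.ext_iff, Fin.val_last, e0]
      by_cases h1 : (i : ℕ) = m + 1
      · rw [if_neg (by omega), if_neg (by omega), if_pos h1]
      · have : (i : ℕ) ≤ m := by have := i.2; omega
        by_cases h2 : (i : ℕ) = m - k
        · rw [if_pos h2, if_neg h1, if_pos h2]
        · simp [h1, h2, this]
    · intro i _ hi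
      have hi' : (i : ℕ) ≠ m - k := fun h => hi (Fin.ext h)
      by_cases h1 : (i : ℕ) ≤ m ∧ (i : ℕ) + k ≤ m
      · have hlt : (i : ℕ) + 1 < m + 2 := by omega
        refine rowDet_eq_zero_of_eq (i := i) (j := ⟨i + 1, hlt⟩) ?_ (by simp [Fin.ext_iff])
        have e1 : (i : ℕ) + 1 ≤ m := by omega
        have e2 : (i : ℕ) + 1 + k ≤ m := by omega
        simp [mixedRows, Fin.ext_iff, h1.1, h1.2, e1, e2]
      · have : (if (i : ℕ) ≤ m then (if (i : ℕ) + k ≤ m then G (i + 1) t else 0) else 0) =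
            (0 : Fin (m + 2) → ℝ) := by
          split_ifs with h2 h3
          · exact absurd ⟨h2, h3⟩ h1
          · rfl
          · rfl
        rw [this, ← rowFunctional_apply, map_zero]
    · simp
  · intro i
    simp only [mixedRows]
    split_ifs
    · exact h.hasDerivWithinAt i t ht
    · exact hasDerivWithinAt_const _ _ _
    · exact hasDerivWithinAt_const _ _ _

theorem ConvexJet.dual_eq_zero (h : ConvexJet (m + 2) J G R) {t : ℝ} (ht : t ∈ J)
    {φ : Module.Dual ℝ (Fin (m + 2) → ℝ)} {a b : ℕ} (hab : m + 2 ≤ a + b)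
    (ha : ∀ j < a, φ (R j) = 0) (hb : ∀ j < b, φ (G j t) = 0) : φ = 0 := by
  by_contra hφ
  have := h.sum_le φ hφ a ha {t} (by simpa using ht) (fun _ => b) (by
    intro s hs j hj
    obtain rfl := Finset.mem_singleton.mp hs
    exact hb j hj)
  simp at this
  omega

theorem pairDet_eq_zero_iff {n : ℕ} {v : Fin n → Fin n → ℝ} {p q : Fin n} (hpq : p ≠ q)
    {x y : Fin n → ℝ} : pairDet v p q x y = 0 ↔ ∃ φ : Module.Dual ℝ (Fin n → ℝ), φ ≠ 0 ∧
      φ x = 0 ∧ φ y = 0 ∧ ∀ i, i ≠ p → i ≠ q → φ (v i) = 0 := by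
  unfold pairDet
  rw [rowDet_eq_zero_iff]
  refine exists_congr fun φ => and_congr_right fun _ => ⟨fun h => ⟨?_, ?_, fun i h1 h2 => ?_⟩,
    fun h i => ?_⟩
  · have := h p
    simpa [hpq] using this
  · have := h q
    simpa using this
  · have := h i
    simpa [h1, h2] using this
  · by_cases h2 : i = q
    · subst h2; simpa using h.2.1
    · by_cases h1 : i = p
      · subst h1; simpa [hpq] using h.1
      · simpa [h1, h2] using h.2.2 i h1 h2

theorem dual_mixedRows_iff {φ : Module.Dual ℝ (Fin (m + 2) → ℝ)} {k : ℕ} (hk : k ≤ m + 1) {t : ℝ}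
    {v : Fin (m + 2) → ℝ} : (∀ i, φ (mixedRows G R k t v i) = 0) ↔
      (∀ j < m + 1 - k, φ (G j t) = 0) ∧ (∀ j < k, φ (R j) = 0) ∧ φ v = 0 := by
  constructor
  · refine fun h => ⟨fun j hj => ?_, fun j hj => ?_, ?_⟩
    · have := h ⟨j, by omega⟩
      simp only [mixedRows] at this
      rwa [if_pos (by omega), if_pos (by omega)] at this
    · have := h ⟨m + 1 - k + j, by omega⟩
      simp only [mixedRows] at this
      rwa [if_pos (by omega), if_neg (by omega),
        show m + 1 - k + j + k - (m + 1) = j by omega] at this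
    · have := h (Fin.last _)
      simpa [mixedRows] using this
  · rintro ⟨h1, h2, h3⟩ i
    simp only [mixedRows]
    split_ifs
    · exact h1 _ (by omega)
    · exact h2 _ (by omega)
    · exact h3

theorem dual_mixedRows_inner_iff {φ : Module.Dual ℝ (Fin (m + 2) → ℝ)} {k : ℕ} (hk : k ≤ m) {t : ℝ}
    {v : Fin (m + 2) → ℝ} : (∀ i, i ≠ lastJet m k → i ≠ Fin.last _ →
      φ (mixedRows G R k t v i) = 0) ↔
      (∀ j < m - k, φ (G j t) = 0) ∧ (∀ j < k, φ (R j) = 0) := by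
  constructor
  · refine fun h => ⟨fun j hj => ?_, fun j hj => ?_⟩
    · have := h ⟨j, by omega⟩ (by simp [lastJet]; omega) (by simp [Fin.ext_iff]; omega)
      simp only [mixedRows] at this
      rwa [if_pos (by omega), if_pos (by omega)] at this
    · have := h ⟨m + 1 - k + j, by omega⟩ (by simp [lastJet]; omega) (by simp [Fin.ext_iff]; omega)
      simp only [mixedRows] at this
      rwa [if_pos (by omega), if_neg (by omega),
        show m + 1 - k + j + k - (m + 1) = j by omega] at this
  · rintro ⟨h1, h2⟩ i hi hi'
    simp only [lastJet, Fin.ext_iff, Fin.val_last, ne_eq] at hi hi'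
    have := i.2
    simp only [mixedRows]
    rw [if_pos (by omega)]
    split_ifs
    · exact h1 _ (by omega)
    · exact h2 _ (by omega)

theorem ConvexJet.rowDet_mixedRows_ne_zero (h : ConvexJet (m + 2) J G R) {t : ℝ} (ht : t ∈ J)
    {k : ℕ} (hk : k ≤ m + 1) : rowDet (mixedRows G R k t (R k)) ≠ 0 := by
  rw [Ne, rowDet_eq_zero_iff]
  rintro ⟨φ, hφ, h0⟩
  obtain ⟨h1, h2, h3⟩ := (dual_mixedRows_iff hk).mp h0
  refine hφ (h.dual_eq_zero ht (a := k + 1) (b := m + 1 - k) (by omega) (fun j hj => ?_) h1)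
  rcases Nat.lt_succ_iff_lt_or_eq.mp hj with h | rfl
  · exact h2 j h
  · exact h3

theorem ConvexJet.pairDet_jet_ne_zero (h : ConvexJet (m + 2) J G R) {t : ℝ} (ht : t ∈ J)
    {k : ℕ} (hk : k ≤ m) (u : Fin (m + 2) → ℝ) :
    pairDet (mixedRows G R k t u) (lastJet m k) (Fin.last _) (G (m - k) t) (G (m - k + 1) t) ≠ 0 := by
  rw [Ne, pairDet_eq_zero_iff (lastJet_ne_last m k)]
  rintro ⟨φ, hφ, h1, h2, h3⟩
  obtain ⟨h4, h5⟩ := (dual_mixedRows_inner_iff hk).mp h3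
  refine hφ (h.dual_eq_zero ht (a := k) (b := m - k + 2) (by omega) h5 fun j hj => ?_)
  rcases Nat.lt_succ_iff_lt_or_eq.mp hj with h | rfl
  · rcases Nat.lt_succ_iff_lt_or_eq.mp h with h | rfl
    · exact h4 j h
    · exact h1
  · exact h2

theorem pairDet_right_eq_zero_iff {t : ℝ} {k : ℕ} (hk : k ≤ m) (u v : Fin (m + 2) → ℝ) :
    pairDet (mixedRows G R k t u) (lastJet m k) (Fin.last _) v (R k) = 0 ↔
      rowDet (mixedRows G R (k + 1) t v) = 0 := by
  rw [pairDet_eq_zero_iff (lastJet_ne_last m k), rowDet_eq_zero_iff]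
  refine exists_congr fun φ => and_congr_right fun _ => ?_
  rw [dual_mixedRows_inner_iff hk, dual_mixedRows_iff (by omega)]
  constructor
  · rintro ⟨h1, h2, h3, h4⟩
    refine ⟨fun j hj => h3 j (by omega), fun j hj => ?_, h1⟩
    rcases Nat.lt_succ_iff_lt_or_eq.mp hj with h | rfl
    · exact h4 j h
    · exact h2
  · rintro ⟨h1, h2, h3⟩
    exact ⟨h3, h2 k (by omega), fun j hj => h1 j (by omega), fun j hj => h2 j (by omega)⟩

/-- Divide by the nonvanishing determinant with `R k` in place of `v`. By the Plücker relation the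
numerator of the derivative is, up to sign, a nonvanishing determinant times one that vanishes
exactly when the mixed determinant of level `k + 1` does, and Rolle's theorem costs one zero. -/
theorem ConvexJet.encard_mixedRows_step (h : ConvexJet (m + 2) J G R) {k c : ℕ} (hk : k ≤ m)
    (v : Fin (m + 2) → ℝ) (hc : {t ∈ J | rowDet (mixedRows G R (k + 1) t v) = 0}.encard ≤ c) :
    {t ∈ J | rowDet (mixedRows G R k t v) = 0}.encard ≤ ((c + 1 : ℕ) : ℕ∞) := by
  set f : ℝ → ℝ := fun t => rowDet (mixedRows G R k t v) / rowDet (mixedRows G R k t (R k)) with hf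
  set f' : ℝ → ℝ := fun t => (pairDet (mixedRows G R k t v) (lastJet m k) (Fin.last _)
    (G (m - k + 1) t) v * rowDet (mixedRows G R k t (R k)) - rowDet (mixedRows G R k t v) *
    pairDet (mixedRows G R k t v) (lastJet m k) (Fin.last _) (G (m - k + 1) t) (R k)) /
    rowDet (mixedRows G R k t (R k)) ^ 2 with hf'
  have hr : ∀ t ∈ J, rowDet (mixedRows G R k t (R k)) ≠ 0 := fun t ht =>
    h.rowDet_mixedRows_ne_zero ht (by omega)
  have hder : ∀ t ∈ J, HasDerivWithinAt f (f' t) J t := fun t ht =>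
    (hasDerivWithinAt_mixedRows h hk ht v v).div (hasDerivWithinAt_mixedRows h hk ht v (R k)) (hr t ht)
  have e1 : {t ∈ J | rowDet (mixedRows G R k t v) = 0} = {t ∈ J | f t = 0} := by
    ext t
    refine and_congr_right fun ht => ?_
    simp only [hf, div_eq_zero_iff, hr t ht, or_false]
  have e2 : {t ∈ J | f' t = 0} ⊆ {t ∈ J | rowDet (mixedRows G R (k + 1) t v) = 0} := by
    rintro t ⟨ht, h0⟩
    refine ⟨ht, ?_⟩
    simp only [hf', div_eq_zero_iff, pow_eq_zero_iff two_ne_zero, hr t ht, or_false] at h0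
    rw [← pairDet_mixedRows hk t v v, ← pairDet_mixedRows hk t v (R k)] at h0
    have hp := pairDet_plucker (mixedRows G R k t v) (lastJet_ne_last m k) (G (m - k) t)
      (G (m - k + 1) t) v (R k)
    rw [← pairDet_right_eq_zero_iff hk v v]
    refine (mul_eq_zero.mp (?_ : _ * _ = (0 : ℝ))).resolve_left (h.pairDet_jet_ne_zero ht hk v)
    linear_combination hp - h0
  rw [e1]
  exact encard_zeros_le_of_deriv h.ordConnected hder ((Set.encard_le_encard e2).trans hc)

/-- At level `k = j` the lower jet vectors at the left end are among the rows, so the determinant is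
`c j` times a nonvanishing one; going down to level `k` allows one zero per step. -/
theorem ConvexJet.encard_mixedRows_le (h : ConvexJet (m + 2) J G R) (c : ℕ → ℝ) (j : ℕ)
    (hj : j ≤ m + 1) (hc : c j ≠ 0) (i k : ℕ) (hik : k + i = j) :
    {t ∈ J | rowDet (mixedRows G R k t (∑ l ∈ Finset.range (j + 1), c l • R l)) = 0}.encard ≤ i := by
  induction i generalizing k with
  | zero =>
    obtain rfl : k = j := by omega
    rw [Nat.cast_zero, nonpos_iff_eq_zero, Set.encard_eq_zero, Set.eq_empty_iff_forall_notMem]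
    rintro t ⟨ht, h0⟩
    obtain ⟨φ, hφ, h0⟩ := rowDet_eq_zero_iff.mp h0
    obtain ⟨h1, h2, h3⟩ := (dual_mixedRows_iff hj).mp h0
    refine h.rowDet_mixedRows_ne_zero ht hj (rowDet_eq_zero_iff.mpr ⟨φ, hφ,
      (dual_mixedRows_iff hj).mpr ⟨h1, h2, ?_⟩⟩)
    rw [map_sum, Finset.sum_range_succ, Finset.sum_eq_zero, zero_add, map_smul, smul_eq_mul] at h3
    · exact (mul_eq_zero.mp h3).resolve_left hc
    · intro l hl
      rw [map_smul, h2 l (Finset.mem_range.mp hl), smul_zero]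
  | succ i ih => exact h.encard_mixedRows_step (by omega) _ (ih (k + 1) (by omega))

/-- A vector of the `j`-dimensional member of the flag at the left end lies in at most `j - 1`
osculating hyperplanes of the curve. -/
theorem ConvexJet.encard_hyperplanes_le (h : ConvexJet (m + 2) J G R) (c : ℕ → ℝ) (j : ℕ)
    (hj : j ≤ m + 2) (hc : ∃ l < j, c l ≠ 0) :
    {t ∈ J | rowDet (mixedRows G R 0 t (∑ l ∈ Finset.range j, c l • R l)) = 0}.encard ≤
      ((j - 1 : ℕ) : ℕ∞) := by
  induction j with
  | zero => obtain ⟨l, hl, -⟩ := hc; omega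
  | succ j ih =>
    by_cases h0 : c j = 0
    · rw [Finset.sum_range_succ, h0, zero_smul, add_zero]
      obtain ⟨l, hl, hne⟩ := hc
      refine (ih (by omega) ⟨l, ?_, hne⟩).trans (by gcongr; omega)
      rcases Nat.lt_succ_iff_lt_or_eq.mp hl with h | rfl
      · exact h
      · exact absurd h0 hne
    · exact h.encard_mixedRows_le c j (by omega) h0 j 0 (by omega)

end

/-- The first meeting puts a generator of `V` into the `(m + 1)`-dimensional member of the flag at
`t₁`, which leaves at most `m` later hyperplanes containing it. -/
theorem encard_meetingSet_hyperplanes_le {m : ℕ} {γ : ℝ → ProjSpace (m + 2)} {I : Set ℝ}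
    (h : IsConvexCurveOn γ I) (hI : I.OrdConnected) (hnt : I.Nontrivial)
    {V : Submodule ℝ (Fin (m + 2) → ℝ)} (hV : Module.finrank ℝ V = 1) :
    (meetingSet γ I (m + 1) V).encard ≤ ((m + 1 : ℕ) : ℕ∞) := by
  refine encard_le_add_one fun t₁ ht₁ => ?_
  obtain ⟨G, R, hJ, hG, hR⟩ := h.exists_convexJet (by omega) hI hnt ht₁.1
  obtain ⟨w, hw, hw0⟩ := Submodule.exists_mem_ne_zero_of_ne_bot ht₁.2
  obtain ⟨hw1, hw2⟩ := Submodule.mem_inf.mp hw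
  rw [hR] at hw1
  obtain ⟨c, hc⟩ := mem_span_range_lt hw1
  have hc0 : ∃ l < m + 1, c l ≠ 0 := by
    by_contra hcon
    push Not at hcon
    refine hw0 (hc.trans (Finset.sum_eq_zero fun l hl => ?_))
    rw [hcon l (Finset.mem_range.mp hl), zero_smul]
  refine (Set.encard_le_encard ?_).trans (hJ.encard_hyperplanes_le c (m + 1) (by omega) hc0)
  rintro t ⟨⟨htI, ht⟩, htt⟩
  refine ⟨⟨htI, htt⟩, ?_⟩
  rw [← hc, rowDet_eq_zero_iff]
  rw [hG t ⟨htI, htt⟩] at ht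
  have hlt := finrank_sup_lt ht
  have hle := finrank_span_range_lt_le (fun j => G j t) (m + 1)
  obtain ⟨φ, hφ, h0⟩ := exists_dual_of_finrank_lt
    (p := Submodule.span ℝ {v | ∃ j < m + 1, v = G j t} ⊔ V) (by omega)
  exact ⟨φ, hφ, (dual_mixedRows_iff (by omega)).mpr
    ⟨fun j hj => h0 _ (Submodule.mem_sup_left (Submodule.subset_span ⟨j, hj, rfl⟩)),
      fun j hj => absurd hj (Nat.not_lt_zero j), h0 _ (Submodule.mem_sup_right hw2)⟩⟩

/-! ### The dual Chebyshev system and meetings in corank two -/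

section

variable {m : ℕ} {J : Set ℝ} {G : ℕ → ℝ → Fin (m + 2) → ℝ} {R : ℕ → Fin (m + 2) → ℝ}

/-- The functional `v ↦ det (G₀(t), …, G_{m-1}(t), x, v)`. -/
def hyperplaneForm (G : ℕ → ℝ → Fin (m + 2) → ℝ) (R : ℕ → Fin (m + 2) → ℝ) (t : ℝ)
    (x : Fin (m + 2) → ℝ) : Module.Dual ℝ (Fin (m + 2) → ℝ) :=
  rowFunctional (Function.update (mixedRows G R 0 t 0) (lastJet m 0) x) (Fin.last _)

theorem hyperplaneForm_apply (t : ℝ) (x v : Fin (m + 2) → ℝ) :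
    hyperplaneForm G R t x v = pairDet (mixedRows G R 0 t 0) (lastJet m 0) (Fin.last _) x v := rfl

theorem hyperplaneForm_jet (t : ℝ) (v : Fin (m + 2) → ℝ) :
    hyperplaneForm G R t (G m t) v = rowDet (mixedRows G R 0 t v) :=
  pairDet_mixedRows (Nat.zero_le m) t 0 v

theorem hyperplaneForm_plucker (t : ℝ) (a b c d : Fin (m + 2) → ℝ) :
    hyperplaneForm G R t a c * hyperplaneForm G R t b d -
      hyperplaneForm G R t a d * hyperplaneForm G R t b c =
      hyperplaneForm G R t a b * hyperplaneForm G R t c d := by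
  simp only [hyperplaneForm_apply]
  linear_combination -pairDet_plucker (mixedRows G R 0 t 0) (lastJet_ne_last m 0) a b c d

theorem hyperplaneForm_eq_zero_iff {t : ℝ} {x v : Fin (m + 2) → ℝ} :
    hyperplaneForm G R t x v = 0 ↔ ∃ φ : Module.Dual ℝ (Fin (m + 2) → ℝ), φ ≠ 0 ∧
      φ x = 0 ∧ φ v = 0 ∧ ∀ j < m, φ (G j t) = 0 := by
  rw [hyperplaneForm_apply, pairDet_eq_zero_iff (lastJet_ne_last m 0)]
  simp only [dual_mixedRows_inner_iff (Nat.zero_le m)]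
  simp

theorem ConvexJet.continuousOn_hyperplaneForm (h : ConvexJet (m + 2) J G R) (k : ℕ)
    (v : Fin (m + 2) → ℝ) : ContinuousOn (fun t => hyperplaneForm G R t (G k t) v) J := by
  intro t ht
  refine (hasDerivWithinAt_rowDet (v := fun t => Function.update (Function.update
    (mixedRows G R 0 t 0) (lastJet m 0) (G k t)) (Fin.last _) v)
    (v' := fun i => if i = Fin.last _ then 0 else if i = lastJet m 0 then G (k + 1) t else
      G (i + 1) t) fun i => ?_).continuousWithinAt
  by_cases h1 : i = Fin.last _
  · subst h1
    simpa using hasDerivWithinAt_const t J v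
  · by_cases h2 : i = lastJet m 0
    · subst h2
      simpa [h1] using h.hasDerivWithinAt k t ht
    · have : (i : ℕ) ≤ m := by
        have := i.2
        have h1' : (i : ℕ) ≠ m + 1 := fun h => h1 (Fin.ext h)
        omega
      simpa [h1, h2, mixedRows, this] using h.hasDerivWithinAt i t ht

/-- The pairings of the osculating hyperplanes with the jet at the left end form a Chebyshev
system. -/
theorem ConvexJet.isChebyshevOn_dual (h : ConvexJet (m + 2) J G R) :
    IsChebyshevOn (m + 2) (fun i t => hyperplaneForm G R t (G m t) (R i))
      (fun i t => hyperplaneForm G R t (G (m + 1) t) (R i)) J := by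
  refine ⟨h.ordConnected, h.exists_lt, fun i _ t ht => ?_,
    fun i _ => h.continuousOn_hyperplaneForm _ _, ?_, ?_⟩
  · simp only [hyperplaneForm_jet]
    exact hasDerivWithinAt_mixedRows h (Nat.zero_le m) ht 0 (R i)
  · intro k hk x hx hxJ hdet
    obtain ⟨v, hv, hv0⟩ := Matrix.exists_vecMul_eq_zero_iff.mpr hdet
    obtain ⟨i, hi⟩ := Function.ne_iff.mp hv
    have hle := h.encard_hyperplanes_le (fun i => if h : i < k then v ⟨i, h⟩ else 0) k hk
      ⟨i, i.2, by simpa using hi⟩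
    have hsub : ((Finset.univ.image x : Finset ℝ) : Set ℝ) ⊆ {t ∈ J | rowDet (mixedRows G R 0 t
        (∑ l ∈ Finset.range k, (if h : l < k then v ⟨l, h⟩ else 0) • R l)) = 0} := by
      intro t ht
      simp only [Finset.coe_image, Finset.coe_univ, Set.image_univ, Set.mem_range] at ht
      obtain ⟨j, rfl⟩ := ht
      refine ⟨hxJ j, ?_⟩
      rw [← hyperplaneForm_jet, Finset.sum_range, map_sum]
      have := congrFun hv0 j
      simpa [Matrix.vecMul, dotProduct] using this
    have := (Set.encard_le_encard hsub).trans hle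
    rw [Set.encard_coe_eq_coe_finsetCard, Finset.card_image_of_injective _ hx.injective,
      Finset.card_univ, Fintype.card_fin] at this
    have h1 : k ≤ k - 1 := by exact_mod_cast this
    have := i.2
    omega
  · intro t ht h0
    -- The Wronskian factors into the determinant with `G m, G (m + 1)` and the one with `R 0, R 1`;
    -- a zero of either gives a functional of total multiplicity `m + 2`.
    have h1 := hyperplaneForm_plucker (G := G) (R := R) t (G m t) (G (m + 1) t) (R 0) (R 1)
    rw [h0] at h1
    rcases mul_eq_zero.mp h1.symm with h2 | h2
    · exact h.pairDet_jet_ne_zero ht (Nat.zero_le m) 0 h2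
    · obtain ⟨φ, hφ, h3, h4, h5⟩ := hyperplaneForm_eq_zero_iff.mp h2
      refine hφ (h.dual_eq_zero ht (a := 2) (b := m) (by omega) (fun j hj => ?_) h5)
      interval_cases j
      · exact h3
      · exact h4

end

theorem exists_second_vector {n : ℕ} {V : Submodule ℝ (Fin n → ℝ)}
    (hV : Module.finrank ℝ V = 2) {v : Fin n → ℝ} (hv : v ≠ 0) :
    ∃ w ∈ V, ∀ α β : ℝ, α • v + β • w = 0 → α = 0 ∧ β = 0 := by
  have hnle : ¬ V ≤ ℝ ∙ v := fun hle => by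
    have := Submodule.finrank_mono hle
    rw [hV, finrank_span_singleton hv] at this
    omega
  obtain ⟨w, hw, hwv⟩ := SetLike.not_le_iff_exists.mp hnle
  refine ⟨w, hw, fun α β h => ?_⟩
  have hβ : β = 0 := by
    by_contra hβ
    refine hwv (Submodule.mem_span_singleton.mpr ⟨-(β⁻¹ * α), ?_⟩)
    have : w = β⁻¹ • (β • w) := by rw [smul_smul, inv_mul_cancel₀ hβ, one_smul]
    rw [this, eq_neg_of_add_eq_zero_right h, smul_neg, smul_smul, neg_smul]
  rw [hβ, zero_smul, add_zero] at h
  exact ⟨(smul_eq_zero.mp h).resolve_right hv, hβ⟩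

/-- The roles of vectors and functionals are exchanged: the pencil consists of the evaluations of
the osculating hyperplane form at two independent vectors `v₁, v₂` of `V`, where `v₁` lies in the
osculating subspace at `t₁`. Plücker turns its Wronskian into a determinant that vanishes when `V`
meets the osculating subspace. -/
theorem encard_meetingSet_corank_two_le {r : ℕ} {γ : ℝ → ProjSpace (r + 3)} {I : Set ℝ}
    (h : IsConvexCurveOn γ I) (hI : I.OrdConnected) (hnt : I.Nontrivial)
    {V : Submodule ℝ (Fin (r + 3) → ℝ)} (hV : Module.finrank ℝ V = 2) :
    (meetingSet γ I (r + 1) V).encard ≤ ((2 * r + 1 + 1 : ℕ) : ℕ∞) := by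
  refine encard_le_add_one fun t₁ ht₁ => ?_
  obtain ⟨G, R, hJ, hG, hR⟩ := h.exists_convexJet (by omega) hI hnt ht₁.1
  obtain ⟨φ, hφ, hexp⟩ := exists_coords fun φ hφ => hJ.exists_apply_ne_zero (by omega) hφ
  have hch : IsChebyshevOn (r + 3) _ _ _ := ConvexJet.isChebyshevOn_dual (m := r + 1) hJ
  obtain ⟨v₁, hv, hv0⟩ := Submodule.exists_mem_ne_zero_of_ne_bot ht₁.2
  obtain ⟨hv1, hv2⟩ := Submodule.mem_inf.mp hv
  rw [hR] at hv1
  obtain ⟨c, hc⟩ := mem_span_range_lt hv1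
  obtain ⟨v₂, hv₂, hind⟩ := exists_second_vector hV hv0
  -- `v₁` is a combination of the first `r + 1` jet vectors at `t₁`, so its last two coordinates
  -- vanish.
  have hφv : ∀ i, r + 1 ≤ i → i < r + 3 → φ i v₁ = 0 := by
    intro i hi hi'
    rw [hc, map_sum]
    refine Finset.sum_eq_zero fun j hj => ?_
    have := Finset.mem_range.mp hj
    rw [map_smul, hφ i hi' j (by omega), if_neg (by omega), smul_zero]
  have hvec : ∀ D : Module.Dual ℝ (Fin (r + 3) → ℝ), pencilVec r (fun i => φ i v₁)
      (fun i => φ i v₂) (fun i => D (R i)) = (D v₁, D v₂) := by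
    intro D
    refine pencilVec_eq_of_expansion (u := φ) (w := D) ?_ (Module.Dual.eval ℝ _ v₁)
      (Module.Dual.eval ℝ _ v₂) (hφv _ (by omega) (by omega)) (hφv _ (by omega) (by omega))
    refine LinearMap.ext fun w => ?_
    conv_lhs => rw [hexp w]
    simp [map_sum, LinearMap.sum_apply, mul_comm]
  have hpen : IndepPencil r (fun i => φ i v₁) (fun i => φ i v₂) := by
    intro α β hαβ
    refine hind α β ?_
    rw [hexp (α • v₁ + β • v₂)]
    refine Finset.sum_eq_zero fun i hi => ?_
    have hi' := Finset.mem_range.mp hi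
    have := hαβ i hi'
    rw [map_add, map_smul, map_smul, smul_eq_mul, smul_eq_mul]
    split_ifs at this with hlt
    · rw [this, zero_smul]
    · rw [hφv i (by omega) hi', this, zero_smul]
  refine (Set.encard_le_encard ?_).trans (encard_pencilWronskian_zeros_le hch hpen)
  rintro t ⟨⟨htI, ht⟩, htt⟩
  refine ⟨⟨htI, htt⟩, ?_⟩
  unfold pencilWronskian planeDet
  rw [hvec, hvec]
  dsimp only
  rw [hyperplaneForm_plucker]
  refine mul_eq_zero_of_right _ (hyperplaneForm_eq_zero_iff.mpr ?_)
  rw [hG t ⟨htI, htt⟩] at ht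
  have hlt := finrank_sup_lt ht
  have hle := finrank_span_range_lt_le (fun j => G j t) (r + 1)
  obtain ⟨ψ, hψ, h0⟩ := exists_dual_of_finrank_lt
    (p := Submodule.span ℝ {v | ∃ j < r + 1, v = G j t} ⊔ V) (by omega)
  exact ⟨ψ, hψ, h0 _ (Submodule.mem_sup_right hv2), h0 _ (Submodule.mem_sup_right hv₂),
    fun j hj => h0 _ (Submodule.mem_sup_left (Submodule.subset_span ⟨j, hj, rfl⟩))⟩

/-! ### The upper bound on an interval -/

/-- The upper bound for curves on an interval. -/
theorem sharpFlagOn_le {n : ℕ} (hn : n = 4 ∨ n = 5) {γ : ℝ → ProjSpace n} {I : Set ℝ}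
    (hI : I.OrdConnected) (hnt : I.Nontrivial) (h : IsConvexCurveOn γ I) (f : CompleteFlag n) :
    sharpFlagOn γ I f ≤ (((n ^ 3 - n) / 6 : ℕ) : ℕ∞) := by
  rcases hn with rfl | rfl
  · have hsub : {t ∈ I | ¬ FlagTransversal (osculatingSubspace γ I t) f.subspace} ⊆
        meetingSet γ I 1 (f.subspace 3) ∪ meetingSet γ I 2 (f.subspace 2) ∪
        meetingSet γ I 3 (f.subspace 1) := by
      rintro t ⟨htI, ht⟩
      unfold FlagTransversal at ht
      push Not at ht
      obtain ⟨i, hi1, hi2, hne⟩ := ht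
      have : i = 1 ∨ i = 2 ∨ i = 3 := by omega
      rcases this with rfl | rfl | rfl
      · exact Or.inl (Or.inl ⟨htI, hne⟩)
      · exact Or.inl (Or.inr ⟨htI, hne⟩)
      · exact Or.inr ⟨htI, hne⟩
    have h1 := encard_meetingSet_one_le (by omega) h hI hnt (f.finrank_eq 3 (by omega))
    have h2 := encard_meetingSet_two_le (r := 1) h hI hnt (f.finrank_eq 2 (by omega))
    have h3 := encard_meetingSet_hyperplanes_le (m := 2) h hI hnt (f.finrank_eq 1 (by omega))
    calc _ ≤ _ := Set.encard_le_encard hsub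
      _ ≤ _ := (Set.encard_union_le _ _).trans (add_le_add_left (Set.encard_union_le _ _) _)
      _ ≤ _ := add_le_add (add_le_add h1 h2) h3
      _ = _ := by norm_num
  · have hsub : {t ∈ I | ¬ FlagTransversal (osculatingSubspace γ I t) f.subspace} ⊆
        (meetingSet γ I 1 (f.subspace 4) ∪ meetingSet γ I 2 (f.subspace 3)) ∪
        (meetingSet γ I 3 (f.subspace 2) ∪ meetingSet γ I 4 (f.subspace 1)) := by
      rintro t ⟨htI, ht⟩
      unfold FlagTransversal at ht
      push Not at ht
      obtain ⟨i, hi1, hi2, hne⟩ := ht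
      have : i = 1 ∨ i = 2 ∨ i = 3 ∨ i = 4 := by omega
      rcases this with rfl | rfl | rfl | rfl
      · exact Or.inl (Or.inl ⟨htI, hne⟩)
      · exact Or.inl (Or.inr ⟨htI, hne⟩)
      · exact Or.inr (Or.inl ⟨htI, hne⟩)
      · exact Or.inr (Or.inr ⟨htI, hne⟩)
    have h1 := encard_meetingSet_one_le (by omega) h hI hnt (f.finrank_eq 4 (by omega))
    have h2 := encard_meetingSet_two_le (r := 2) h hI hnt (f.finrank_eq 3 (by omega))
    have h3 := encard_meetingSet_corank_two_le (r := 2) h hI hnt (f.finrank_eq 2 (by omega))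
    have h4 := encard_meetingSet_hyperplanes_le (m := 3) h hI hnt (f.finrank_eq 1 (by omega))
    calc _ ≤ _ := Set.encard_le_encard hsub
      _ ≤ _ := (Set.encard_union_le _ _).trans
        (add_le_add (Set.encard_union_le _ _) (Set.encard_union_le _ _))
      _ ≤ _ := add_le_add (add_le_add h1 h2) (add_le_add h3 h4)
      _ = _ := by norm_num

/-! ### The lower bound: rescaling a small arc to the moment curve -/

/-- A small arc around an interior point suffices, and there two-sided derivatives are available. A
functional killing the first `n` jet vectors would have multiplicity `n` at one point, against
convexity. -/
theorem IsConvexCurveOn.exists_local_jet {n : ℕ} (hn : 1 ≤ n) {γ : ℝ → ProjSpace n} {I : Set ℝ}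
    (h : IsConvexCurveOn γ I) (hI : I.OrdConnected) (hnt : I.Nontrivial) :
    ∃ (G : ℕ → ℝ → Fin n → ℝ) (t₀ δ : ℝ), 0 < δ ∧ Set.Ioo (t₀ - δ) (t₀ + δ) ⊆ I ∧
      (∀ j, ∀ t ∈ Set.Ioo (t₀ - δ) (t₀ + δ), HasDerivAt (G j) (G (j + 1) t) t) ∧
      (∀ t ∈ Set.Ioo (t₀ - δ) (t₀ + δ), ∀ k, osculatingSubspace γ I t k =
        Submodule.span ℝ {v | ∃ j < k, v = G j t}) ∧
      ∀ t ∈ Set.Ioo (t₀ - δ) (t₀ + δ), ∀ φ : Module.Dual ℝ (Fin n → ℝ), φ ≠ 0 →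
        ∃ j < n, φ (G j t) ≠ 0 := by
  have hU := uniqueDiffOn_of_ordConnected hI hnt
  obtain ⟨a, ha, b, hb, hab⟩ := hnt.exists_lt
  set t₀ := (a + b) / 2 with ht₀
  have hIoo : Set.Ioo a b ⊆ I := Set.Ioo_subset_Icc_self.trans (hI.out ha hb)
  have hmem : t₀ ∈ Set.Ioo a b := ⟨by linarith, by linarith⟩
  set φ₀ := dotDual (γ t₀).rep with hφ₀
  have hsm : ContDiffWithinAt ℝ ∞ (dualLift γ φ₀) I t₀ := h.smooth t₀ (hIoo hmem)
  have hcont : ContinuousAt (fun t => φ₀ (dualLift γ φ₀ t)) t₀ :=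
    (dual_contDiffWithinAt φ₀ hsm).continuousWithinAt.continuousAt
      (Filter.mem_of_superset (isOpen_Ioo.mem_nhds hmem) hIoo)
  have hne0 : φ₀ (dualLift γ φ₀ t₀) ≠ 0 := by
    simp only [dualLift, map_smul, smul_eq_mul]
    have := dotDual_rep_ne_zero γ t₀
    exact mul_ne_zero (inv_ne_zero this) this
  obtain ⟨δ, hδ, hball⟩ := Metric.eventually_nhds_iff_ball.mp
    ((hcont.eventually_ne hne0).and (isOpen_Ioo.mem_nhds hmem))
  rw [Real.ball_eq_Ioo] at hball
  have hsub : Set.Ioo (t₀ - δ) (t₀ + δ) ⊆ I := fun t ht => hIoo (hball t ht).2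
  have hrep : ∀ t ∈ Set.Ioo (t₀ - δ) (t₀ + δ), φ₀ (γ t).rep ≠ 0 := by
    intro t ht h0
    apply (hball t ht).1
    simp only [dualLift, map_smul, h0, smul_zero]
  have hz : ∀ t ∈ Set.Ioo (t₀ - δ) (t₀ + δ), ContDiffWithinAt ℝ ∞ (dualLift γ φ₀) I t ∧
      ∀ k, jetSpan (dualLift γ φ₀) I t k = osculatingSubspace γ I t k := fun t ht =>
    dualLift_of_smooth hU (hsub ht) (h.smooth t (hsub ht)) (hrep t ht)
  have hIn : ∀ t ∈ Set.Ioo (t₀ - δ) (t₀ + δ), I ∈ 𝓝 t := fun t ht =>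
    Filter.mem_of_superset (isOpen_Ioo.mem_nhds ht) hsub
  have hG : ∀ t ∈ Set.Ioo (t₀ - δ) (t₀ + δ), ∀ j,
      iteratedDerivWithin j (dualLift γ φ₀) I t = iteratedDeriv j (dualLift γ φ₀) t := by
    intro t ht j
    rw [← iteratedDerivWithin_univ]
    unfold iteratedDerivWithin
    rw [iteratedFDerivWithin_congr_set]
    filter_upwards [hIn t ht] with s hs
    exact propext ⟨fun _ => trivial, fun _ => hs⟩
  have hosc : ∀ t ∈ Set.Ioo (t₀ - δ) (t₀ + δ), ∀ k, osculatingSubspace γ I t k =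
      Submodule.span ℝ {v | ∃ j < k, v = iteratedDeriv j (dualLift γ φ₀) t} := by
    intro t ht k
    rw [← (hz t ht).2 k]
    simp only [jetSpan, hG t ht]
  refine ⟨fun j => iteratedDeriv j (dualLift γ φ₀), t₀, δ, hδ, hsub, fun j t ht => ?_, hosc,
    fun t ht φ hφ => ?_⟩
  · have h1 : ContDiffAt ℝ ∞ (dualLift γ φ₀) t := (hz t ht).1.contDiffAt (hIn t ht)
    have h2 := (h1.contDiffWithinAt (s := Set.univ)).differentiableWithinAt_iteratedDerivWithin
      (m := j) (mod_cast (WithTop.coe_lt_top j)) (by simp)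
    rw [iteratedDerivWithin_univ, differentiableWithinAt_univ] at h2
    have h3 := h2.hasDerivAt
    rwa [← iteratedDeriv_succ] at h3
  · by_contra hcon
    push Not at hcon
    have := h.sum_le hU hφ {t} (by simpa using hsub ht) (fun _ => n) (by
      intro s hs
      obtain rfl := Finset.mem_singleton.mp hs
      rw [hosc s ht]
      exact span_range_lt_le_iff.mpr hcon)
    simp at this
    omega

/-- This is the leading Taylor coefficient, obtained by applying L'Hôpital's rule `d` times. -/
theorem tendsto_div_pow {U : Set ℝ} (hU : IsOpen U) {t₀ : ℝ} (ht₀ : t₀ ∈ U) (d : ℕ) :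
    ∀ V : ℕ → ℝ → ℝ, (∀ j ≤ d, ∀ t ∈ U, HasDerivAt (V j) (V (j + 1) t) t) →
      (∀ j < d, V j t₀ = 0) → V d t₀ = 1 →
      Filter.Tendsto (fun t => V 0 t / (t - t₀) ^ d) (𝓝[>] t₀) (𝓝 (1 / (d.factorial : ℝ))) := by
  induction d with
  | zero =>
    intro V hV _ h1
    have := (hV 0 le_rfl t₀ ht₀).continuousAt.tendsto.mono_left (nhdsWithin_le_nhds (s := Set.Ioi t₀))
    rw [h1] at this
    simpa using this
  | succ d ih =>
    intro V hV h0 h1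
    have hlim := (ih (fun j => V (j + 1)) (fun j hj => hV (j + 1) (by omega))
      (fun j hj => h0 (j + 1) (by omega)) h1).div_const ((d : ℝ) + 1)
    have hpos : ∀ᶠ t in 𝓝[>] t₀, t₀ < t := self_mem_nhdsWithin
    have hUe : ∀ᶠ t in 𝓝[>] t₀, t ∈ U := nhdsWithin_le_nhds (hU.mem_nhds ht₀)
    refine HasDerivAt.lhopital_zero_nhdsGT (f' := V 1)
      (g' := fun t => ((d : ℝ) + 1) * (t - t₀) ^ d) ?_ ?_ ?_ ?_ ?_ ?_
    · filter_upwards [hUe] with t ht using hV 0 (by omega) t ht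
    · refine Filter.Eventually.of_forall fun t => ?_
      have := ((hasDerivAt_id t).sub_const t₀).fun_pow (d + 1)
      refine this.congr_deriv ?_
      simp
    · filter_upwards [hpos] with t ht
      have : 0 < t - t₀ := sub_pos.mpr ht
      positivity
    · have := (hV 0 (by omega) t₀ ht₀).continuousAt.tendsto.mono_left
        (nhdsWithin_le_nhds (s := Set.Ioi t₀))
      rwa [h0 0 (by omega)] at this
    · have : Continuous fun t : ℝ => (t - t₀) ^ (d + 1) := by fun_prop
      have := this.tendsto t₀
      simp only [sub_self, ne_eq, Nat.add_eq_zero_iff, one_ne_zero, and_false, not_false_eq_true,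
        zero_pow] at this
      exact this.mono_left nhdsWithin_le_nhds
    · have e : (1 : ℝ) / ((d + 1).factorial : ℝ) = 1 / (d.factorial : ℝ) / ((d : ℝ) + 1) := by
        rw [Nat.factorial_succ]
        push_cast
        field_simp
      rw [e]
      refine hlim.congr fun t => ?_
      rw [div_div, mul_comm]

/-- The rescaled limit of the coordinates of a jet dual to the jet at `t₀`. -/
theorem tendsto_rescaled_jet {U : Set ℝ} (hU : IsOpen U) {t₀ : ℝ} (ht₀ : t₀ ∈ U) {V : ℕ → ℝ → ℝ}
    (hV : ∀ j, ∀ t ∈ U, HasDerivAt (V j) (V (j + 1) t) t) {i l n : ℕ} (hi : i < n)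
    (h0 : ∀ j < n, V j t₀ = if i = j then 1 else 0) {s : ℝ} (hs : 0 < s) :
    Filter.Tendsto (fun ε : ℝ => ε ^ l * ((i.factorial : ℝ) * (ε ^ i)⁻¹ * V l (t₀ + ε * s)))
      (𝓝[>] 0) (𝓝 ((i.descFactorial l : ℝ) * s ^ (i - l))) := by
  have hpos : ∀ᶠ ε : ℝ in 𝓝[>] (0 : ℝ), 0 < ε := self_mem_nhdsWithin
  have harg : Filter.Tendsto (fun ε : ℝ => t₀ + ε * s) (𝓝[>] 0) (𝓝[>] t₀) := by
    refine tendsto_nhdsWithin_iff.mpr ⟨?_, ?_⟩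
    · have : Continuous fun ε : ℝ => t₀ + ε * s := by fun_prop
      have := this.tendsto 0
      simp only [zero_mul, add_zero] at this
      exact this.mono_left nhdsWithin_le_nhds
    · filter_upwards [hpos] with ε hε
      exact lt_add_of_pos_right _ (mul_pos hε hs)
  -- For `l ≤ i` the leading term survives the rescaling. For `l > i` a positive power of `ε` is
  -- left over, and the limit is zero like the falling factorial.
  rcases le_or_gt l i with hli | hli
  · have h1 := (tendsto_div_pow hU ht₀ (i - l) (fun j => V (j + l))
      (fun j _ t ht => by have := hV (j + l) t ht; rwa [show j + l + 1 = j + 1 + l by ring] at this)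
      (fun j hj => by rw [h0 _ (by omega), if_neg (by omega)])
      (by rw [h0 _ (by omega), if_pos (by omega)])).comp harg
    have h2 := h1.const_mul ((i.factorial : ℝ) * s ^ (i - l))
    have e : (i.factorial : ℝ) * s ^ (i - l) * (1 / ((i - l).factorial : ℝ)) =
        (i.descFactorial l : ℝ) * s ^ (i - l) := by
      rw [← Nat.factorial_mul_descFactorial hli]
      push_cast
      field_simp
    rw [e] at h2
    refine h2.congr' ?_
    filter_upwards [hpos] with ε hε
    have e1 : t₀ + ε * s - t₀ = ε * s := by ring
    have e2 : ε ^ i = ε ^ l * ε ^ (i - l) := by rw [← pow_add, Nat.add_sub_cancel' hli]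
    simp only [Function.comp_apply, zero_add, e1, e2, mul_pow]
    field_simp
  · rw [Nat.descFactorial_eq_zero_iff_lt.mpr hli, Nat.cast_zero, zero_mul]
    have h1 := (hV l t₀ ht₀).continuousAt.tendsto.comp (harg.mono_right nhdsWithin_le_nhds)
    have h2 : Filter.Tendsto (fun ε : ℝ => (i.factorial : ℝ) * ε ^ (l - i)) (𝓝[>] 0) (𝓝 0) := by
      have : Continuous fun ε : ℝ => (i.factorial : ℝ) * ε ^ (l - i) := by fun_prop
      have := this.tendsto 0
      rw [zero_pow (by omega), mul_zero] at this
      exact this.mono_left nhdsWithin_le_nhds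
    have h3 := h2.mul h1
    rw [zero_mul] at h3
    refine h3.congr' ?_
    filter_upwards [hpos] with ε hε
    have e2 : ε ^ l = ε ^ i * ε ^ (l - i) := by rw [← pow_add, Nat.add_sub_cancel' hli.le]
    simp only [Function.comp_apply, e2]
    field_simp

/-- The flag of common kernels of linearly independent functionals. -/
def kernelFlag {n : ℕ} (g : ℕ → Module.Dual ℝ (Fin n → ℝ))
    (hg : LinearIndependent ℝ fun a : Fin n => g a) : CompleteFlag n where
  subspace i := (Submodule.span ℝ {φ | ∃ a < n - i, φ = g a}).dualCoannihilator
  mono i j hij := Submodule.dualCoannihilator_anti (Submodule.span_mono (by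
    rintro _ ⟨a, ha, rfl⟩
    exact ⟨a, by omega, rfl⟩))
  finrank_eq i hi := by
    have h1 := Subspace.finrank_add_finrank_dualCoannihilator_eq
      (Submodule.span ℝ {φ | ∃ a < n - i, φ = g a})
    have e : {φ | ∃ a < n - i, φ = g a} = Set.range fun a : Fin (n - i) => g a := by
      ext φ
      constructor
      · rintro ⟨a, ha, rfl⟩; exact ⟨⟨a, ha⟩, rfl⟩
      · rintro ⟨a, rfl⟩; exact ⟨a, a.2, rfl⟩
    have h2 : LinearIndependent ℝ fun a : Fin (n - i) => g a :=
      hg.comp (Fin.castLE (Nat.sub_le n i)) (Fin.castLE_injective _)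
    have h3 := finrank_span_eq_card h2
    rw [← e, Fintype.card_fin] at h3
    rw [Module.finrank_fin_fun] at h1
    omega

theorem mem_kernelFlag {n : ℕ} {g : ℕ → Module.Dual ℝ (Fin n → ℝ)}
    {hg : LinearIndependent ℝ fun a : Fin n => g a} {i : ℕ} {w : Fin n → ℝ}
    (h : ∀ a < n - i, g a w = 0) : w ∈ (kernelFlag g hg).subspace i := by
  refine (Submodule.mem_dualCoannihilator w).mpr fun φ hφ => ?_
  induction hφ using Submodule.span_induction with
  | mem x hx => obtain ⟨a, ha, rfl⟩ := hx; exact h a ha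
  | zero => rfl
  | add x y _ _ hx hy => rw [LinearMap.add_apply, hx, hy, add_zero]
  | smul a x _ hx => rw [LinearMap.smul_apply, hx, smul_zero]

/-- A kernel vector of the matrix combines the first `k` jet vectors into a vector killed by the
first `k` functionals, that is, into one of the member of dimension `n - k`; it is nonzero since the
jet vectors are independent. -/
theorem osculating_inf_kernelFlag_ne_bot {n : ℕ} {g : ℕ → Module.Dual ℝ (Fin n → ℝ)}
    {hg : LinearIndependent ℝ fun a : Fin n => g a} {v : ℕ → Fin n → ℝ}
    (hv : ∀ φ : Module.Dual ℝ (Fin n → ℝ), φ ≠ 0 → ∃ j < n, φ (v j) ≠ 0) {k : ℕ} (hk : k ≤ n)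
    (hdet : (Matrix.of fun a l : Fin k => g a (v l)).det = 0) :
    Submodule.span ℝ {w | ∃ j < k, w = v j} ⊓ (kernelFlag g hg).subspace (n - k) ≠ ⊥ := by
  obtain ⟨x, hx, hx0⟩ := Matrix.exists_mulVec_eq_zero_iff.mpr hdet
  obtain ⟨φ, hφ, -⟩ := exists_coords hv
  obtain ⟨i, hi⟩ := Function.ne_iff.mp hx
  set w := ∑ l : Fin k, x l • v l with hw
  have hw0 : w ≠ 0 := by
    intro h0
    have := congrArg (φ i) h0
    rw [hw, map_sum, map_zero, Finset.sum_eq_single i] at this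
    · rw [map_smul, hφ i (by omega) i (by omega), if_pos rfl, smul_eq_mul, mul_one] at this
      exact hi this
    · intro j _ hj
      rw [map_smul, hφ i (by omega) j (by omega), if_neg (fun h => hj (Fin.ext h.symm)), smul_zero]
    · simp
  refine (Submodule.ne_bot_iff _).mpr ⟨w, Submodule.mem_inf.mpr ⟨?_, mem_kernelFlag fun a ha => ?_⟩,
    hw0⟩
  · exact Submodule.sum_mem _ fun l _ => Submodule.smul_mem _ _
      (Submodule.subset_span ⟨l, l.2, rfl⟩)
  · have := congrFun hx0 ⟨a, by omega⟩
    rw [hw, map_sum]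
    simpa [Matrix.mulVec, dotProduct, mul_comm] using this

/-- The Wronskian at `s` of the first `k` of the polynomials `∑ i < n, c a i * X ^ i`. -/
def polyWronskian (n : ℕ) (c : ℕ → ℕ → ℝ) (k : ℕ) (s : ℝ) : ℝ :=
  Matrix.det (Matrix.of fun a l : Fin k =>
    ∑ i ∈ Finset.range n, c a i * ((i.descFactorial l : ℝ) * s ^ (i - l)))

/-- The flag transported from polynomials to a small arc of the curve. -/
theorem exists_flag_of_polyWronskian {n : ℕ} (hn : 1 ≤ n) (c : ℕ → ℕ → ℝ)
    (hc : ∀ x : Fin n → ℝ, (∀ i < n, ∑ a, x a * c a i = 0) → x = 0) {N : ℕ} {σ : ℕ → ℝ}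
    (hσ0 : ∀ j ≤ N, 0 < σ j) (hσ : ∀ j < N, σ j < σ (j + 1)) {κ : ℕ → ℕ}
    (hκ : ∀ j < N, 1 ≤ κ j ∧ κ j ≤ n - 1)
    (hW : ∀ j < N, polyWronskian n c (κ j) (σ j) * polyWronskian n c (κ j) (σ (j + 1)) < 0)
    {γ : ℝ → ProjSpace n} {I : Set ℝ} (h : IsConvexCurveOn γ I) (hI : I.OrdConnected)
    (hnt : I.Nontrivial) : ∃ f : CompleteFlag n, (N : ℕ∞) ≤ sharpFlagOn γ I f := by
  obtain ⟨G, t₀, δ, hδ, hUI, hG, hosc, hne⟩ := h.exists_local_jet hn hI hnt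
  set U := Set.Ioo (t₀ - δ) (t₀ + δ) with hU
  have ht₀ : t₀ ∈ U := ⟨by linarith, by linarith⟩
  obtain ⟨ψ, hψ, -⟩ := exists_coords (hne t₀ ht₀)
  -- `ψ i` behaves along the curve like `(t - t₀)^i / i!`; the weights turn it into `s^i` at `t = t₀
  -- + εs`, so `g ε a` tends to the polynomial with coefficients `c a`.
  set g : ℝ → ℕ → Module.Dual ℝ (Fin n → ℝ) := fun ε a =>
    ∑ i ∈ Finset.range n, (c a i * ((i.factorial : ℝ) * (ε ^ i)⁻¹)) • ψ i with hg
  have hgG : ∀ ε a l t, g ε a (G l t) =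
      ∑ i ∈ Finset.range n, c a i * ((i.factorial : ℝ) * (ε ^ i)⁻¹ * ψ i (G l t)) := by
    intro ε a l t
    simp only [hg, LinearMap.sum_apply, LinearMap.smul_apply, smul_eq_mul, mul_assoc]
  have hgli : ∀ ε : ℝ, 0 < ε → LinearIndependent ℝ fun a : Fin n => g ε a := by
    intro ε hε
    refine Fintype.linearIndependent_iff.mpr fun x hx => ?_
    refine congrFun (hc x fun i hi => ?_)
    have := LinearMap.congr_fun hx (G i t₀)
    simp only [LinearMap.sum_apply, LinearMap.smul_apply, smul_eq_mul, LinearMap.zero_apply,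
      hgG] at this
    have e : ∀ a : Fin n, ∑ l ∈ Finset.range n,
        c a l * ((l.factorial : ℝ) * (ε ^ l)⁻¹ * ψ l (G i t₀)) =
        c a i * ((i.factorial : ℝ) * (ε ^ i)⁻¹) := by
      intro a
      rw [Finset.sum_eq_single i]
      · rw [hψ i hi i hi, if_pos rfl, mul_one]
      · intro l hl hli
        rw [hψ l (Finset.mem_range.mp hl) i hi, if_neg hli, mul_zero, mul_zero]
      · exact fun h => absurd (Finset.mem_range.mpr hi) h
    simp only [e] at this
    simp only [← mul_assoc, ← Finset.sum_mul] at this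
    have hf : (i.factorial : ℝ) ≠ 0 := by positivity
    exact (mul_eq_zero.mp ((mul_eq_zero.mp this).resolve_right
      (inv_ne_zero (pow_pos hε i).ne'))).resolve_right hf
  set D : ℝ → ℕ → ℝ → ℝ := fun ε k t =>
    (Matrix.of fun a l : Fin k => g ε a (G l t)).det with hD
  have hDc : ∀ ε k, ContinuousOn (D ε k) U := by
    intro ε k
    simp only [hD, Matrix.det_apply, Matrix.of_apply]
    refine continuousOn_finsetSum _ fun τ _ => ContinuousOn.const_smul ?_ _
    refine continuousOn_finsetProd _ fun i _ => fun t ht => ?_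
    exact ((hG i t ht).hasDerivWithinAt.dual (g ε (τ i))).continuousWithinAt
  have hlim : ∀ k, k ≤ n → ∀ s : ℝ, 0 < s → Filter.Tendsto
      (fun ε : ℝ => (∏ l : Fin k, ε ^ (l : ℕ)) * D ε k (t₀ + ε * s)) (𝓝[>] 0)
      (𝓝 (polyWronskian n c k s)) := by
    intro k hk s hs
    have e : ∀ ε : ℝ, (∏ l : Fin k, ε ^ (l : ℕ)) * D ε k (t₀ + ε * s) =
        (Matrix.of fun a l : Fin k => ∑ i ∈ Finset.range n, c a i *
          (ε ^ (l : ℕ) * ((i.factorial : ℝ) * (ε ^ i)⁻¹ * ψ i (G l (t₀ + ε * s))))).det := by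
      intro ε
      rw [hD, ← Matrix.det_mul_row]
      congr 1
      ext a l
      simp only [Matrix.of_apply, hgG, Finset.mul_sum]
      exact Finset.sum_congr rfl fun i _ => by ring
    simp only [e, polyWronskian, Matrix.det_apply, Matrix.of_apply]
    refine tendsto_finsetSum _ fun τ _ => Filter.Tendsto.const_smul ?_ _
    refine tendsto_finsetProd _ fun l _ => tendsto_finsetSum _ fun i hi =>
      Filter.Tendsto.const_mul _ ?_
    exact tendsto_rescaled_jet isOpen_Ioo ht₀ (V := fun j t => ψ i (G j t))
      (fun j t ht => by
        have := ((hG j t ht).hasDerivWithinAt (s := Set.univ)).dual (ψ i)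
        exact hasDerivWithinAt_univ.mp this) (Finset.mem_range.mp hi)
      (fun j hj => hψ i (Finset.mem_range.mp hi) j hj) hs
  have hpos : ∀ᶠ ε : ℝ in 𝓝[>] (0 : ℝ), 0 < ε := self_mem_nhdsWithin
  have hev : ∀ᶠ ε : ℝ in 𝓝[>] (0 : ℝ), ∀ j : Fin (N + 1), t₀ + ε * σ j ∈ U := by
    refine Filter.eventually_all.mpr fun j => ?_
    have : Continuous fun ε : ℝ => t₀ + ε * σ j := by fun_prop
    have := this.tendsto 0
    simp only [zero_mul, add_zero] at this
    exact nhdsWithin_le_nhds (this.eventually (isOpen_Ioo.mem_nhds ht₀))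
  have hev2 : ∀ᶠ ε : ℝ in 𝓝[>] (0 : ℝ), ∀ j : Fin N,
      D ε (κ j) (t₀ + ε * σ j) * D ε (κ j) (t₀ + ε * σ (j + 1)) < 0 := by
    refine Filter.eventually_all.mpr fun j => ?_
    have hκj := hκ j j.2
    have h1 := (hlim (κ j) (by omega) (σ j) (hσ0 j (by omega))).mul
      (hlim (κ j) (by omega) (σ (j + 1)) (hσ0 (j + 1) (by omega)))
    filter_upwards [h1.eventually (gt_mem_nhds (hW j j.2)), hpos] with ε hε hε0
    -- The rescaling factor is positive and the same at both ends, so the sign change of the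
    -- polynomial Wronskian passes to the determinant of the curve. The resulting zeros lie in
    -- disjoint intervals and are therefore distinct.
    have hp : 0 < (∏ l : Fin (κ j), ε ^ (l : ℕ)) * ∏ l : Fin (κ j), ε ^ (l : ℕ) := by positivity
    rw [mul_mul_mul_comm] at hε
    exact (pos_iff_neg_of_mul_neg hε).mp hp
  obtain ⟨ε, hε0, hεU, hεD⟩ := (hpos.and (hev.and hev2)).exists
  have hzero : ∀ j : Fin N, ∃ τ, t₀ + ε * σ j < τ ∧ τ < t₀ + ε * σ (j + 1) ∧ τ ∈ U ∧
      D ε (κ j) τ = 0 := by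
    intro j
    have hlt : t₀ + ε * σ j < t₀ + ε * σ (j + 1) := by have := hσ j j.2; gcongr
    have hsub : Set.Icc (t₀ + ε * σ j) (t₀ + ε * σ (j + 1)) ⊆ U :=
      Set.ordConnected_Ioo.out (hεU ⟨j, by omega⟩) (hεU ⟨j + 1, by omega⟩)
    have hcont := (hDc ε (κ j)).mono hsub
    have hs := hεD j
    rcases mul_neg_iff.mp hs with ⟨h1, h2⟩ | ⟨h1, h2⟩
    · obtain ⟨τ, hτ, h0⟩ := intermediate_value_Ioo' hlt.le hcont ⟨h2, h1⟩
      exact ⟨τ, hτ.1, hτ.2, hsub (Set.Ioo_subset_Icc_self hτ), h0⟩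
    · obtain ⟨τ, hτ, h0⟩ := intermediate_value_Ioo hlt.le hcont ⟨h1, h2⟩
      exact ⟨τ, hτ.1, hτ.2, hsub (Set.Ioo_subset_Icc_self hτ), h0⟩
  choose τ hτ1 hτ2 hτU hτ0 using hzero
  have hσle : ∀ i j, i ≤ j → j ≤ N → σ i ≤ σ j := by
    intro i j hij hj
    induction j, hij using Nat.le_induction with
    | base => exact le_rfl
    | succ j _ ih => exact (ih (by omega)).trans (hσ j (by omega)).le
  have hmono : StrictMono τ := by
    intro i j hij
    have := hσle (i + 1) j (by simpa using hij) (by omega)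
    calc τ i < t₀ + ε * σ (i + 1) := hτ2 i
      _ ≤ t₀ + ε * σ j := by gcongr
      _ < τ j := hτ1 j
  refine ⟨kernelFlag (g ε) (hgli ε hε0), ?_⟩
  have hsub : ((Finset.univ.image τ : Finset ℝ) : Set ℝ) ⊆
      {t ∈ I | ¬ FlagTransversal (osculatingSubspace γ I t)
        (kernelFlag (g ε) (hgli ε hε0)).subspace} := by
    intro t ht
    simp only [Finset.coe_image, Finset.coe_univ, Set.image_univ, Set.mem_range] at ht
    obtain ⟨j, rfl⟩ := ht
    refine ⟨hUI (hτU j), fun htr => ?_⟩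
    have hκj := hκ j j.2
    have := htr (κ j) hκj.1 hκj.2
    rw [hosc _ (hτU j)] at this
    exact osculating_inf_kernelFlag_ne_bot (hne _ (hτU j)) (by omega) (hτ0 j) this
  have := Set.encard_le_encard hsub
  rwa [Set.encard_coe_eq_coe_finsetCard, Finset.card_image_of_injective _ hmono.injective,
    Finset.card_univ, Fintype.card_fin] at this

/-! ### Explicit polynomials for dimensions four and five -/

theorem det_fin_four {R : Type*} [CommRing R] (A : Matrix (Fin 4) (Fin 4) R) :
    A.det = A 0 0 * (A.submatrix Fin.succ (Fin.succAbove 0)).det -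
      A 0 1 * (A.submatrix Fin.succ (Fin.succAbove 1)).det +
      A 0 2 * (A.submatrix Fin.succ (Fin.succAbove 2)).det -
      A 0 3 * (A.submatrix Fin.succ (Fin.succAbove 3)).det := by
  rw [Matrix.det_succ_row_zero, Fin.sum_univ_four]
  simp
  ring

/-- Coefficients of cubic polynomials all of whose Wronskians have only real zeros. -/
def cubicCoeff : ℕ → ℕ → ℝ
  | 0, 0 => 2 ^ 32 | 0, 1 => -2 ^ 27 | 0, 2 => 2 ^ 15 | 0, 3 => -2 ^ 0
  | 1, 0 => 2 ^ 15 | 1, 1 => -2 ^ 14 | 1, 2 => 2 ^ 11 | 1, 3 => -2 ^ 0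
  | 2, 0 => 2 ^ 0 | 2, 1 => -2 ^ 4 | 2, 2 => 2 ^ 6 | 2, 3 => -2 ^ 4
  | 3, 3 => 1
  | _, _ => 0

theorem polyWronskian_cubic_1 (s : ℝ) : polyWronskian 4 cubicCoeff 1 s =
      (4294967296) * s ^ 0 + (-134217728) * s ^ 1 + (32768) * s ^ 2 + (-1) * s ^ 3 := by
  simp [polyWronskian, Finset.sum_range_succ, cubicCoeff]
  ring

theorem polyWronskian_cubic_2 (s : ℝ) : polyWronskian 4 cubicCoeff 2 s =
      (-65970697666560) * s ^ 0 + (17590038560768) * s ^ 1 + (-287225839616) * s ^ 2 +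
      (268402688) * s ^ 3 + (-30720) * s ^ 4 := by
  simp [polyWronskian, Matrix.det_fin_two, Finset.sum_range_succ, cubicCoeff, Nat.descFactorial]
  ring

theorem polyWronskian_cubic_3 (s : ℝ) : polyWronskian 4 cubicCoeff 3 s =
      (-8163357366419456) * s ^ 0 + (6332775467483136) * s ^ 1 + (-842672596242432) * s ^ 2 +
      (8761736364032) * s ^ 3 := by
  simp [polyWronskian, Matrix.det_fin_three, Finset.sum_range_succ, cubicCoeff, Nat.descFactorial]
  ring

theorem exists_flag_cubic {γ : ℝ → ProjSpace 4} {I : Set ℝ} (h : IsConvexCurveOn γ I)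
    (hI : I.OrdConnected) (hnt : I.Nontrivial) :
    ∃ f : CompleteFlag 4, ((10 : ℕ) : ℕ∞) ≤ sharpFlagOn γ I f := by
  -- `κ j` names a Wronskian with opposite signs at the `j`-th and the next point of `σ`. The values
  -- `1, 2, 3` occur `3, 4, 3` times, which are the degrees of the three Wronskians. The fourth
  -- polynomial only completes the basis.
  refine exists_flag_of_polyWronskian (by norm_num) cubicCoeff (fun x hx => ?_) (N := 10)
    (σ := fun j => ([1, 2, 5, 10, 40, 70, 1000, 2000, 5000, 10000, 100000] : List ℝ).getD j 0)
    (κ := fun j => ([3, 2, 3, 1, 2, 3, 2, 1, 2, 1] : List ℕ).getD j 0) ?_ ?_ ?_ ?_ h hI hnt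
  · have e0 := hx 0 (by norm_num)
    have e1 := hx 1 (by norm_num)
    have e2 := hx 2 (by norm_num)
    have e3 := hx 3 (by norm_num)
    simp [Fin.sum_univ_succ, cubicCoeff] at e0 e1 e2 e3
    ext a
    fin_cases a <;> simp <;> linarith
  · intro j hj
    interval_cases j <;> simp
  · intro j hj
    interval_cases j <;> norm_num
  · intro j hj
    interval_cases j <;> simp
  · intro j hj
    interval_cases j <;> norm_num [polyWronskian_cubic_1, polyWronskian_cubic_2,
      polyWronskian_cubic_3]

/-- Coefficients of quartic polynomials all of whose Wronskians have only real zeros. -/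
def quarticCoeff : ℕ → ℕ → ℝ
  | 0, 0 => 2 ^ 52 | 0, 1 => -2 ^ 45 | 0, 2 => 2 ^ 33 | 0, 3 => -2 ^ 18 | 0, 4 => 2 ^ 0
  | 1, 0 => 2 ^ 28 | 1, 1 => -2 ^ 26 | 1, 2 => 2 ^ 22 | 1, 3 => -2 ^ 12 | 1, 4 => 2 ^ 0
  | 2, 0 => 2 ^ 4 | 2, 1 => -2 ^ 8 | 2, 2 => 2 ^ 10 | 2, 3 => -2 ^ 7 | 2, 4 => 2 ^ 0
  | 3, 0 => 2 ^ 0 | 3, 1 => -2 ^ 13 | 3, 2 => 2 ^ 20 | 3, 3 => -2 ^ 22 | 3, 4 => 2 ^ 20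
  | 4, 4 => 1
  | _, _ => 0

theorem polyWronskian_quartic_1 (s : ℝ) : polyWronskian 5 quarticCoeff 1 s =
      (4503599627370496) * s ^ 0 + (-35184372088832) * s ^ 1 + (8589934592) * s ^ 2 + (-262144)
      * s ^ 3 + (1) * s ^ 4 := by
  simp [polyWronskian, Finset.sum_range_succ, quarticCoeff]
  ring

theorem polyWronskian_quartic_2 (s : ℝ) : polyWronskian 5 quarticCoeff 2 s =
      (-292786721937918003249152) * s ^ 0 + (37774320176938734321664) * s ^ 1 +
      (-202337512952269111296) * s ^ 2 + (306209589215363072) * s ^ 3 + (-139637775400960) * s ^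
      4 + (17171480576) * s ^ 5 + (-258048) * s ^ 6 := by
  simp [polyWronskian, Matrix.det_fin_two, Finset.sum_range_succ, quarticCoeff, Nat.descFactorial]
  ring

theorem polyWronskian_quartic_3 (s : ℝ) : polyWronskian 5 quarticCoeff 3 s =
      (-589961684483298550603579392) * s ^ 0 + (224831882190879405102858240) * s ^ 1 +
      (-17905429422926485272920064) * s ^ 2 + (339457037931244739887104) * s ^ 3 +
      (-1096211347686447906816) * s ^ 4 + (837564029510615040) * s ^ 5 + (-65972299890688) * s ^
      6 := by
  simp [polyWronskian, Matrix.det_fin_three, Finset.sum_range_succ, quarticCoeff, Nat.descFactorial]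
  ring

theorem polyWronskian_quartic_4 (s : ℝ) : polyWronskian 5 quarticCoeff 4 s =
      (14375601085396238911627437916815360) * s ^ 0 + (-14832142963135769464953232750018560) * s
      ^ 1 + (2740621517577164637660368181657600) * s ^ 2 + (-116928208364539897394299026800640)
      * s ^ 3 + (227504402677452463019466424320) * s ^ 4 := by
  simp [polyWronskian, det_fin_four, Matrix.det_fin_three, Finset.sum_range_succ, quarticCoeff,
    Nat.descFactorial, Fin.succAbove]
  ring

theorem exists_flag_quartic {γ : ℝ → ProjSpace 5} {I : Set ℝ} (h : IsConvexCurveOn γ I)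
    (hI : I.OrdConnected) (hnt : I.Nontrivial) :
    ∃ f : CompleteFlag 5, ((20 : ℕ) : ℕ∞) ≤ sharpFlagOn γ I f := by
  -- Here the values `1, 2, 3, 4` of `κ` occur `4, 6, 6, 4` times, again the degrees of the
  -- Wronskians.
  refine exists_flag_of_polyWronskian (by norm_num) quarticCoeff (fun x hx => ?_) (N := 20)
    (σ := fun j => ([1, 2, 4, 7, 10, 14, 20, 100, 200, 310, 400, 500, 700, 2000, 3000, 5000,
      10000, 20000, 40000, 100000, 1000000] : List ℝ).getD j 0)
    (κ := fun j => ([4, 3, 4, 2, 3, 4, 3, 1, 2, 3, 4, 2, 3, 2, 1, 2, 3, 1, 2, 1] : List ℕ).getD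
      j 0) ?_ ?_ ?_ ?_ h hI hnt
  · have e0 := hx 0 (by norm_num)
    have e1 := hx 1 (by norm_num)
    have e2 := hx 2 (by norm_num)
    have e3 := hx 3 (by norm_num)
    have e4 := hx 4 (by norm_num)
    simp [Fin.sum_univ_succ, quarticCoeff] at e0 e1 e2 e3 e4
    ext a
    fin_cases a <;> simp <;> linarith
  · intro j hj
    interval_cases j <;> simp
  · intro j hj
    interval_cases j <;> norm_num
  · intro j hj
    interval_cases j <;> simp
  · intro j hj
    interval_cases j <;> norm_num [polyWronskian_quartic_1, polyWronskian_quartic_2,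
      polyWronskian_quartic_3, polyWronskian_quartic_4]

/-! ### Closed curves, cut at a point -/

theorem iteratedDerivWithin_shift {E : Type*} [NormedAddCommGroup E] [NormedSpace ℝ E]
    (f : ℝ → E) {I : Set ℝ} {s : ℝ} (hI : I ∈ 𝓝 s) (j : ℕ) :
    iteratedDerivWithin j (fun u => f (s + u)) Set.univ 0 = iteratedDerivWithin j f I s := by
  have h1 : iteratedDerivWithin j f I s = iteratedDeriv j f s := by
    rw [← iteratedDerivWithin_univ]
    unfold iteratedDerivWithin
    rw [iteratedFDerivWithin_congr_set]
    filter_upwards [hI] with t ht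
    exact propext ⟨fun _ => trivial, fun _ => ht⟩
  rw [h1, iteratedDerivWithin_univ, iteratedDeriv_comp_const_add]
  simp only [add_zero]

theorem affineLift_shift {n : ℕ} (c : ℝ → ProjSpace n) (s : ℝ) :
    affineLift (fun u => c (s + u)) 0 = fun u => affineLift c s (s + u) := by
  funext u
  simp [affineLift]

theorem angular_mul_exp {n : ℕ} (γ : Circle → ProjSpace n) (z : Circle) (s : ℝ) :
    angular γ (z * Circle.exp s) = fun u => angular γ z (s + u) := by
  funext u
  simp only [angular, Circle.exp_add, mul_assoc]

theorem osculatingSubspace_angular {n : ℕ} (γ : Circle → ProjSpace n) (z : Circle) {I : Set ℝ}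
    {s : ℝ} (hI : I ∈ 𝓝 s) (k : ℕ) :
    osculatingSubspace (angular γ (z * Circle.exp s)) Set.univ 0 k =
      osculatingSubspace (angular γ z) I s k := by
  unfold osculatingSubspace
  simp only [angular_mul_exp, affineLift_shift, iteratedDerivWithin_shift _ hI]

theorem intersectionMult_angular {n : ℕ} (γ : Circle → ProjSpace n) (z : Circle) {I : Set ℝ}
    {s : ℝ} (hI : I ∈ 𝓝 s) (φ : Module.Dual ℝ (Fin n → ℝ)) :
    intersectionMult (angular γ (z * Circle.exp s)) Set.univ φ 0 =
      intersectionMult (angular γ z) I φ s := by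
  unfold intersectionMult vanishingOrder
  simp only [angular_mul_exp, affineLift_shift,
    iteratedDerivWithin_shift (fun u => φ (affineLift (angular γ z) s u)) hI]

theorem injOn_mul_exp (z : Circle) :
    Set.InjOn (fun s => z * Circle.exp s) (Set.Ioo 0 (2 * Real.pi)) := by
  intro s hs t ht hst
  obtain ⟨m, hm⟩ := Circle.exp_eq_exp.mp (mul_left_cancel hst)
  have hpi := Real.pi_pos
  have h1 : (m : ℝ) < 1 := by
    by_contra h
    have := hs.2
    have := ht.1
    nlinarith
  have h2 : (-1 : ℝ) < m := by
    by_contra h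
    have := hs.1
    have := ht.2
    nlinarith
  have : m = 0 := by
    have h1' : m < 1 := by exact_mod_cast h1
    have h2' : -1 < m := by exact_mod_cast h2
    omega
  rw [hm, this]
  simp

theorem exists_mul_exp_eq {z w : Circle} (h : w ≠ z) :
    ∃ s ∈ Set.Ioo 0 (2 * Real.pi), z * Circle.exp s = w := by
  have hpi := Real.pi_pos
  set u : Circle := z⁻¹ * w with hu
  have hu1 : u ≠ 1 := fun h1 => h (inv_mul_eq_one.mp h1).symm
  have harg : Complex.arg u ≠ 0 := by
    intro h0
    apply hu1
    rw [← Circle.exp_arg u, h0, Circle.exp_zero]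
  have hzu : z * u = w := by rw [hu, mul_inv_cancel_left]
  rcases lt_or_gt_of_ne harg with h0 | h0
  · refine ⟨Complex.arg u + 2 * Real.pi, ⟨?_, ?_⟩, ?_⟩
    · have := Complex.neg_pi_lt_arg (u : ℂ)
      linarith
    · linarith
    · rw [Circle.exp_add, Circle.exp_arg, Circle.exp_two_pi, mul_one, hzu]
  · refine ⟨Complex.arg u, ⟨h0, ?_⟩, ?_⟩
    · have := Complex.arg_le_pi (u : ℂ)
      linarith
    · rw [Circle.exp_arg, hzu]

/-- A convex closed curve cut at a point is a convex curve on an interval. -/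
theorem IsConvexClosedCurve.isConvexCurveOn {n : ℕ} {γ : Circle → ProjSpace n}
    (h : IsConvexClosedCurve γ) (z : Circle) :
    IsConvexCurveOn (angular γ z) (Set.Ioo 0 (2 * Real.pi)) := by
  classical
  refine ⟨fun s hs => ?_, fun φ hφ S hS => ?_⟩
  · have h1 := h.smooth (z * Circle.exp s)
    unfold SmoothCurveAt at h1 ⊢
    rw [angular_mul_exp, affineLift_shift, contDiffWithinAt_univ] at h1
    have h2 : ContDiffAt ℝ ∞ (fun t : ℝ => t - s) s := by fun_prop
    have h3 := ContDiffAt.comp (f := fun t : ℝ => t - s) s (by rwa [sub_self]) h2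
    refine (h3.congr_of_eventuallyEq (Filter.Eventually.of_forall fun t => ?_)).contDiffWithinAt
    simp
  · have h1 := h.sum_mult_le φ hφ (S.image fun s => z * Circle.exp s)
    rw [Finset.sum_image fun s hs t ht => injOn_mul_exp z (hS hs) (hS ht)] at h1
    rwa [Finset.sum_congr rfl fun s hs =>
      intersectionMult_angular γ z (isOpen_Ioo.mem_nhds (hS hs)) φ] at h1

theorem not_flagTransversal_angular_iff {n : ℕ} (γ : Circle → ProjSpace n) (z : Circle) {s : ℝ}
    (hs : s ∈ Set.Ioo 0 (2 * Real.pi)) (f : CompleteFlag n) :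
    ¬ FlagTransversal (osculatingSubspace (angular γ (z * Circle.exp s)) Set.univ 0) f.subspace ↔
      ¬ FlagTransversal (osculatingSubspace (angular γ z) (Set.Ioo 0 (2 * Real.pi)) s)
        f.subspace := by
  unfold FlagTransversal
  simp only [osculatingSubspace_angular γ z (isOpen_Ioo.mem_nhds hs)]

theorem sharpFlagOn_le_sharpFlagClosed {n : ℕ} (γ : Circle → ProjSpace n) (z : Circle)
    (f : CompleteFlag n) :
    sharpFlagOn (angular γ z) (Set.Ioo 0 (2 * Real.pi)) f ≤ sharpFlagClosed γ f := by
  unfold sharpFlagOn sharpFlagClosed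
  rw [← Set.InjOn.encard_image ((injOn_mul_exp z).mono fun s hs => hs.1)]
  refine Set.encard_le_encard ?_
  rintro _ ⟨s, hs, rfl⟩
  exact (not_flagTransversal_angular_iff γ z hs.1 f).mpr hs.2

/-- The open interval misses the cut point, but any finite set of bad moments can be avoided by the
cut, because the circle is infinite. -/
theorem sharpFlagClosed_le {n : ℕ} {γ : Circle → ProjSpace n} {f : CompleteFlag n} {N : ℕ}
    (h : ∀ z, sharpFlagOn (angular γ z) (Set.Ioo 0 (2 * Real.pi)) f ≤ N) :
    sharpFlagClosed γ f ≤ N := by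
  refine encard_le_of_finset fun S hS => ?_
  obtain ⟨z, hz⟩ : ∃ z, z ∉ S := by
    by_contra hcon
    push Not at hcon
    have hinf : (Set.Ioo (0 : ℝ) (2 * Real.pi)).Infinite :=
      Set.Ioo_infinite (by have := Real.pi_pos; positivity)
    exact (hinf.image (injOn_mul_exp 1)) (S.finite_toSet.subset fun w _ => hcon w)
  have hsub : (S : Set Circle) ⊆ (fun s => z * Circle.exp s) ''
      {s ∈ Set.Ioo 0 (2 * Real.pi) | ¬ FlagTransversal
        (osculatingSubspace (angular γ z) (Set.Ioo 0 (2 * Real.pi)) s) f.subspace} := by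
    intro w hw
    obtain ⟨s, hs, rfl⟩ := exists_mul_exp_eq (z := z) (w := w) fun h => hz (h ▸ hw)
    exact ⟨s, ⟨hs, (not_flagTransversal_angular_iff γ z hs f).mp (hS hw)⟩, rfl⟩
  have := (Set.encard_le_encard hsub).trans ((Set.encard_image_le _ _).trans (h z))
  rw [Set.encard_coe_eq_coe_finsetCard] at this
  exact_mod_cast this

theorem exists_flag_le_sharpFlagOn {n : ℕ} (hn : n = 4 ∨ n = 5) {γ : ℝ → ProjSpace n} {I : Set ℝ}
    (hI : I.OrdConnected) (hnt : I.Nontrivial) (h : IsConvexCurveOn γ I) :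
    ∃ f : CompleteFlag n, (((n ^ 3 - n) / 6 : ℕ) : ℕ∞) ≤ sharpFlagOn γ I f := by
  rcases hn with rfl | rfl
  · exact exists_flag_cubic h hI hnt
  · exact exists_flag_quartic h hI hnt

theorem corollary5 (n : ℕ) (hn : n = 4 ∨ n = 5) :
    (∀ γ : Circle → ProjSpace n, IsConvexClosedCurve γ →
      sharpClosed γ = (((n ^ 3 - n) / 6 : ℕ) : ℕ∞)) ∧
    (∀ I : Set ℝ, I.OrdConnected → I.Nontrivial →
      ∀ γ : ℝ → ProjSpace n, IsConvexCurveOn γ I →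
        sharpOn γ I = (((n ^ 3 - n) / 6 : ℕ) : ℕ∞)) := by
  constructor
  · intro γ h
    have hnt : (Set.Ioo (0 : ℝ) (2 * Real.pi)).Nontrivial :=
      (Set.Ioo_infinite (by have := Real.pi_pos; positivity)).nontrivial
    refine le_antisymm (iSup_le fun f => sharpFlagClosed_le fun z =>
      sharpFlagOn_le hn Set.ordConnected_Ioo hnt (h.isConvexCurveOn z) f) ?_
    obtain ⟨f, hf⟩ := exists_flag_le_sharpFlagOn hn Set.ordConnected_Ioo hnt (h.isConvexCurveOn 1)
    exact hf.trans ((sharpFlagOn_le_sharpFlagClosed γ 1 f).trans (le_iSup (sharpFlagClosed γ) f))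
  · intro I hI hnt γ h
    refine le_antisymm (iSup_le fun f => sharpFlagOn_le hn hI hnt h f) ?_
    obtain ⟨f, hf⟩ := exists_flag_le_sharpFlagOn hn hI hnt h
    exact hf.trans (le_iSup (sharpFlagOn γ I) f)
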